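/- Setting. Let $H$ be a real separable Hilbert space with scalar product $(\cdot,\cdot)$ and norm $|\cdot|$, let $A$ be a positive self-adjoint (in general unbounded) linear operator on $H$, let $V=\mathrm{Dom}(A^{1/2})$ with norm $\|v\|=|A^{1/2}v|$, and let $V'$ be the dual of $V$, with duality $\langle\cdot,\cdot\rangle$ extending $(\cdot,\cdot)$. Let $Q$ be a positive trace class operator on $H$, let $H_0=Q^{1/2}H$ with scalar product $(\phi,\psi)_0=(Q^{-1/2}\phi,Q^{-1/2}\psi)$ and norm $|\cdot|_0$ (if $Q$ is not injective, $Q^{-1/2}\phi$ is the preimage of $\phi$ orthogonal to $\ker Q^{1/2}$), and let $L_Q=L_Q(H_0,H)$ be the space of linear operators $S:H_0\to H$ such that $SQ^{1/2}$ is Hilbert–Schmidt, with $|S|_{L_Q}^2=\sum_k|SQ^{1/2}\psi_k|^2$ for any orthonormal basis $(\psi_k)$ of $H$. Let $T>0$ and let $X=C([0,T];H)\cap L^2(0,T;V)$ with the norm $\|u\|_X=\big(\sup_{0\le s\le T}|u(s)|^2+\int_0^T\|u(s)\|^2ds\big)^{1/2}$. Assumptions. (C1) $B:V\times V\to V'$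 is bilinear and continuous; $\langle B(u_1,u_2),u_3\rangle=-\langle B(u_1,u_3),u_2\rangle$ for all $u_i\in V$; and there is a Banach space $\mathcal H$ with $V\subset\mathcal H\subset H$ (the inclusion of $\mathcal H$ in $H$ being continuous) such that: for some $a_0>0$, $\|v\|_{\mathcal H}^2\le a_0|v|\,\|v\|$ for all $v\in V$; and for every $\eta>0$ there is $C_\eta>0$ with $|\langle B(u_1,u_2),u_3\rangle|\le\eta\|u_3\|^2+C_\eta\|u_1\|_{\mathcal H}^2\|u_2\|_{\mathcal H}^2$ for all $u_i\in V$. (C2) with $K_2=L_2=0$: $\sigma\in C([0,T]\times V;L_Q)$, and there are constants $K_0,K_1,L_1\ge0$ with $|\sigma(t,u)|_{L_Q}^2\le K_0+K_1|u|^2$ and $|\sigma(t,u)-\sigma(t,v)|_{L_Q}^2\le L_1|u-v|^2$ for all $t\in[0,T]$, $u,v\in V$. (C3)(ii) $\tilde R:[0,T]\times H\to H$ is continuous, and there are constants $R_0,R_1\ge0$ with $|\tilde R(t,0)|\le R_0$ and $|\tilde R(t,u)-\tilde R(t,v)|\le R_1|u-v|$ for all $t\in[0,T]$, $u,v\in H$.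 (C4) There are constants $\gamma>0$ and $C\ge0$ with $|\sigma(t_1,u)-\sigma(t_2,u)|_{L_Q}\le C(1+\|u\|)|t_1-t_2|^\gamma$ for all $t_1,t_2\in[0,T]$, $u\in V$. Claim. Fix $M>0$ and $\xi\in H$, and let $S_M=\{h\in L^2(0,T;H_0):\int_0^T|h(s)|_0^2ds\le M\}$. For every $h\in S_M$ the equation $$du_h(t)+[Au_h(t)+B(u_h(t),u_h(t))+\tilde R(t,u_h(t))]\,dt=\sigma(t,u_h(t))h(t)\,dt,\qquad u_h(0)=\xi,$$ has exactly one weak solution $u_h\in X$, that is, exactly one $u_h\in X$ such that for all $v\in\mathrm{Dom}(A)$ and $t\in[0,T]$ $$(u_h(t),v)-(\xi,v)+\int_0^t\big[(u_h(s),Av)+\langle B(u_h(s),u_h(s)),v\rangle+(\tilde R(s,u_h(s)),v)\big]ds=\int_0^t\big(\sigma(s,u_h(s))h(s),v\big)ds;$$ and the set $K_M=\{u_h: h\in S_M\}$ is a compact subset of $X$. -/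

import Mathlib

open MeasureTheory Set
open scoped ENNReal NNReal

noncomputable section

universe u

/-! ### Orthonormal bases -/

section OrthonormalBases

/-- Parseval's identity with values in `[0, ∞]`. -/
theorem tsum_enorm_inner_sq {H : Type u} [NormedAddCommGroup H] [InnerProductSpace ℝ H]
    {ι : Type*} (b : HilbertBasis ι ℝ H) (x : H) :
    ∑' i, ‖inner ℝ (b i) x‖ₑ ^ 2 = ‖x‖ₑ ^ 2 := by
  have h := b.hasSum_inner_mul_inner x x
  have h2 : HasSum (fun i => ‖inner ℝ (b i) x‖ ^ 2) (‖x‖ ^ 2) := by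
    rw [← real_inner_self_eq_norm_sq]
    have e : (fun i => ‖inner ℝ (b i) x‖ ^ 2) =
        fun i => inner ℝ x (b i) * inner ℝ (b i) x := by
      funext i
      rw [real_inner_comm (b i) x, Real.norm_eq_abs, sq_abs, sq]
    rw [e]
    exact h
  have e : ∀ r : ℝ, 0 ≤ r → ENNReal.ofReal (r ^ 2) = ENNReal.ofReal r ^ 2 :=
    fun r hr => ENNReal.ofReal_pow hr 2
  have h3 := ENNReal.ofReal_tsum_of_nonneg (fun i => by positivity) h2.summable
  rw [h2.tsum_eq, e _ (norm_nonneg _), ofReal_norm] at h3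
  rw [h3]
  exact tsum_congr fun i => by rw [e _ (norm_nonneg _), ofReal_norm]

variable {H : Type u} [NormedAddCommGroup H] [InnerProductSpace ℝ H] [CompleteSpace H]

theorem tsum_enorm_sq_eq_adjoint {ι κ : Type*} (c : HilbertBasis ι ℝ H) (d : HilbertBasis κ ℝ H)
    (T : H →L[ℝ] H) : ∑' i, ‖T (c i)‖ₑ ^ 2 = ∑' j, ‖T.adjoint (d j)‖ₑ ^ 2 := by
  calc ∑' i, ‖T (c i)‖ₑ ^ 2 = ∑' i, ∑' j, ‖inner ℝ (d j) (T (c i))‖ₑ ^ 2 :=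
        tsum_congr fun i => (tsum_enorm_inner_sq d _).symm
    _ = ∑' j, ∑' i, ‖inner ℝ (d j) (T (c i))‖ₑ ^ 2 := ENNReal.tsum_comm
    _ = ∑' j, ∑' i, ‖inner ℝ (c i) (T.adjoint (d j))‖ₑ ^ 2 := by
        refine tsum_congr fun j => tsum_congr fun i => ?_
        rw [← ContinuousLinearMap.adjoint_inner_left, real_inner_comm]
    _ = ∑' j, ‖T.adjoint (d j)‖ₑ ^ 2 := tsum_congr fun j => tsum_enorm_inner_sq c _

/-- The index set of some orthonormal basis of `H`. -/
def onbIndex (H : Type u) [NormedAddCommGroup H] [InnerProductSpace ℝ H] [CompleteSpace H] :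
    Set H :=
  (exists_hilbertBasis ℝ H).choose

/-- Some orthonormal basis of `H`. -/
def onb (H : Type u) [NormedAddCommGroup H] [InnerProductSpace ℝ H] [CompleteSpace H] :
    HilbertBasis (onbIndex H) ℝ H :=
  (exists_hilbertBasis ℝ H).choose_spec.choose

end OrthonormalBases

/-! ### The operator `A` and the space `V = Dom(A^{1/2})` -/

section FormDomain

variable {H : Type u} [NormedAddCommGroup H] [InnerProductSpace ℝ H] [CompleteSpace H]

/-- `S = A^{1/2}`: `S` is a self-adjoint operator with `(S x, x) ≥ 0`, and `A = S ∘ S` (with equality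
of the domains). -/
structure IsPositiveSqrt (S A : H →ₗ.[ℝ] H) : Prop where
  selfAdjoint : IsSelfAdjoint S
  nonneg : ∀ x : S.domain, 0 ≤ inner ℝ (S x) (x : H)
  mem_domain_iff : ∀ x : H, x ∈ A.domain ↔ ∃ hx : x ∈ S.domain, S ⟨x, hx⟩ ∈ S.domain
  apply_eq : ∀ (x : A.domain) (hx : (x : H) ∈ S.domain) (hSx : S ⟨x, hx⟩ ∈ S.domain),
    A x = S ⟨S ⟨x, hx⟩, hSx⟩

/-- A positive self-adjoint (in general unbounded) operator `A` on `H`, together with its (unique)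
positive self-adjoint square root `A^{1/2}`. -/
structure PositiveOperator (H : Type u) [NormedAddCommGroup H] [InnerProductSpace ℝ H]
    [CompleteSpace H] where
  A : H →ₗ.[ℝ] H
  sqrt : H →ₗ.[ℝ] H
  selfAdjoint : IsSelfAdjoint A
  pos : ∀ x : A.domain, (x : H) ≠ 0 → 0 < inner ℝ (A x) (x : H)
  isSqrt : IsPositiveSqrt sqrt A

namespace PositiveOperator

variable (𝒜 : PositiveOperator H)

/-- The vector space `V = Dom(A^{1/2})`. -/
def V : Type u := 𝒜.sqrt.domain

instance : AddCommGroup 𝒜.V := inferInstanceAs (AddCommGroup 𝒜.sqrt.domain)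

instance : Module ℝ 𝒜.V := inferInstanceAs (Module ℝ 𝒜.sqrt.domain)

/-- The inclusion of `V` in `H`. -/
def incl : 𝒜.V →ₗ[ℝ] H := 𝒜.sqrt.domain.subtype

/-- `A^{1/2} : V → H`. -/
def root : 𝒜.V →ₗ[ℝ] H := 𝒜.sqrt.toFun

theorem root_injective : Function.Injective 𝒜.root := by
  rw [injective_iff_map_eq_zero]
  intro x hx
  have hx' : 𝒜.sqrt ⟨(x : 𝒜.sqrt.domain).1, x.2⟩ = 0 := hx
  have hmem : 𝒜.sqrt ⟨(x : 𝒜.sqrt.domain).1, x.2⟩ ∈ 𝒜.sqrt.domain := by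
    rw [hx']; exact zero_mem _
  have hA : (x : 𝒜.sqrt.domain).1 ∈ 𝒜.A.domain := (𝒜.isSqrt.mem_domain_iff _).2 ⟨x.2, hmem⟩
  by_contra hne
  have hne' : (x : 𝒜.sqrt.domain).1 ≠ 0 := fun h => hne (Subtype.ext h)
  have hp := 𝒜.pos ⟨_, hA⟩ hne'
  have hz : (⟨𝒜.sqrt ⟨(x : 𝒜.sqrt.domain).1, x.2⟩, hmem⟩ : 𝒜.sqrt.domain) = 0 :=
    Subtype.ext hx'
  rw [𝒜.isSqrt.apply_eq ⟨_, hA⟩ x.2 hmem, hz, LinearPMap.map_zero, inner_zero_left] at hp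
  exact lt_irrefl _ hp

/-- The norm of `V` is `‖v‖ = |A^{1/2} v|`. -/
instance : NormedAddCommGroup 𝒜.V :=
  NormedAddCommGroup.induced 𝒜.V H 𝒜.root 𝒜.root_injective

instance : NormedSpace ℝ 𝒜.V := NormedSpace.induced ℝ 𝒜.V H 𝒜.root

theorem norm_def (v : 𝒜.V) : ‖v‖ = ‖𝒜.root v‖ := rfl

/-- The inclusion of `Dom(A)` in `V`. -/
def ofDomain (v : 𝒜.A.domain) : 𝒜.V :=
  ⟨(v : H), ((𝒜.isSqrt.mem_domain_iff _).1 v.2).choose⟩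

theorem incl_ofDomain (v : 𝒜.A.domain) : 𝒜.incl (𝒜.ofDomain v) = v := rfl

end PositiveOperator

end FormDomain

/-! ### The operator `Q` and the spaces `H₀ = Q^{1/2} H` and `L_Q(H₀, H)` -/

section Covariance

variable {H : Type u} [NormedAddCommGroup H] [InnerProductSpace ℝ H] [CompleteSpace H]

/-- A positive trace class operator `Q` on `H`, together with its (unique) positive square root
`Q^{1/2}`. -/
structure Covariance (H : Type u) [NormedAddCommGroup H] [InnerProductSpace ℝ H]
    [CompleteSpace H] where
  Q : H →L[ℝ] H
  sqrt : H →L[ℝ] H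
  isPositive : Q.IsPositive
  traceClass : ∑' i, ENNReal.ofReal (inner ℝ (Q (onb H i)) (onb H i)) < ∞
  sqrt_isPositive : sqrt.IsPositive
  sqrt_comp_sqrt : sqrt.comp sqrt = Q

namespace Covariance

variable (𝒬 : Covariance H)

/-- The vector space `H₀ = Q^{1/2} H`. -/
def H₀ : Type u := LinearMap.range (𝒬.sqrt : H →ₗ[ℝ] H)

instance : AddCommGroup 𝒬.H₀ :=
  inferInstanceAs (AddCommGroup (LinearMap.range (𝒬.sqrt : H →ₗ[ℝ] H)))

instance : Module ℝ 𝒬.H₀ := inferInstanceAs (Module ℝ (LinearMap.range (𝒬.sqrt : H →ₗ[ℝ] H)))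

/-- The inclusion of `H₀` in `H`. -/
def incl : 𝒬.H₀ →ₗ[ℝ] H := (LinearMap.range (𝒬.sqrt : H →ₗ[ℝ] H)).subtype

/-- `Q^{1/2}` as a map from `H` to `H₀`. -/
def sqrtTo : H →ₗ[ℝ] 𝒬.H₀ := (𝒬.sqrt : H →ₗ[ℝ] H).rangeRestrict

theorem incl_sqrtTo (x : H) : 𝒬.incl (𝒬.sqrtTo x) = 𝒬.sqrt x := rfl

theorem sqrtTo_bijective :
    Function.Bijective (𝒬.sqrtTo ∘ₗ (LinearMap.ker (𝒬.sqrt : H →ₗ[ℝ] H))ᗮ.subtype) := by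
  have hclosed : IsClosed ((LinearMap.ker (𝒬.sqrt : H →ₗ[ℝ] H) : Submodule ℝ H) : Set H) :=
    𝒬.sqrt.isClosed_ker
  have : CompleteSpace (LinearMap.ker (𝒬.sqrt : H →ₗ[ℝ] H)) :=
    hclosed.completeSpace_coe
  constructor
  · rw [injective_iff_map_eq_zero]
    intro x hx
    have h1 : 𝒬.sqrt (x : H) = 0 := congrArg 𝒬.incl hx
    have h2 : (x : H) ∈ LinearMap.ker (𝒬.sqrt : H →ₗ[ℝ] H) := h1
    have h3 : inner ℝ (x : H) (x : H) = 0 := Submodule.inner_right_of_mem_orthogonal h2 x.2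
    exact Subtype.ext (inner_self_eq_zero.1 h3)
  · rintro ⟨y, x, rfl⟩
    obtain ⟨k, hk, z, hz, hx⟩ :=
      (LinearMap.ker (𝒬.sqrt : H →ₗ[ℝ] H)).exists_add_mem_mem_orthogonal x
    refine ⟨⟨z, hz⟩, Subtype.ext ?_⟩
    have hk' : 𝒬.sqrt k = 0 := hk
    change 𝒬.sqrt z = 𝒬.sqrt x
    rw [hx, map_add, hk', zero_add]

/-- `Q^{-1/2}` on `H₀`: the preimage under `Q^{1/2}` that is orthogonal to `ker Q^{1/2}` (the inverse
of `Q^{1/2}` when `Q` is injective). -/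
def invSqrt : 𝒬.H₀ →ₗ[ℝ] H :=
  (LinearMap.ker (𝒬.sqrt : H →ₗ[ℝ] H))ᗮ.subtype ∘ₗ
    (LinearEquiv.ofBijective _ 𝒬.sqrtTo_bijective).symm.toLinearMap

theorem invSqrt_injective : Function.Injective 𝒬.invSqrt := by
  intro x y h
  exact (LinearEquiv.ofBijective _ 𝒬.sqrtTo_bijective).symm.injective (Subtype.ext h)

theorem sqrt_invSqrt (φ : 𝒬.H₀) : 𝒬.sqrt (𝒬.invSqrt φ) = 𝒬.incl φ :=
  congrArg 𝒬.incl ((LinearEquiv.ofBijective _ 𝒬.sqrtTo_bijective).apply_symm_apply φ)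

/-- The norm of `H₀` is `|φ|₀ = |Q^{-1/2} φ|`. -/
instance : NormedAddCommGroup 𝒬.H₀ :=
  NormedAddCommGroup.induced 𝒬.H₀ H 𝒬.invSqrt 𝒬.invSqrt_injective

/-- The scalar product of `H₀` is `(φ, ψ)₀ = (Q^{-1/2} φ, Q^{-1/2} ψ)`. -/
instance : InnerProductSpace ℝ 𝒬.H₀ where
  toNormedSpace := NormedSpace.induced ℝ 𝒬.H₀ H 𝒬.invSqrt
  inner φ ψ := inner ℝ (𝒬.invSqrt φ) (𝒬.invSqrt ψ)
  norm_sq_eq_re_inner φ := norm_sq_eq_re_inner (𝕜 := ℝ) (𝒬.invSqrt φ)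
  conj_inner_symm φ ψ := inner_conj_symm _ _
  add_left φ ψ χ := by rw [map_add, inner_add_left]
  smul_left φ ψ r := by rw [map_smul, inner_smul_left]

theorem norm_def (φ : 𝒬.H₀) : ‖φ‖ = ‖𝒬.invSqrt φ‖ := rfl

/-- `|S|²_{L_Q} = ∑ₖ |S Q^{1/2} ψₖ|² ∈ [0, ∞]`, for an orthonormal basis `ψ` of `H`. The space
`L_Q(H₀, H)` consists of the `S` for which this is finite. -/
def lqNormSq (S : 𝒬.H₀ →L[ℝ] H) : ℝ≥0∞ := ∑' i, ‖S (𝒬.sqrtTo (onb H i))‖ₑ ^ 2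

/-- `Q^{1/2} : H → H₀` is a contraction. -/
theorem norm_sqrtTo_le (x : H) : ‖𝒬.sqrtTo x‖ ≤ ‖x‖ := by
  rw [norm_def]
  have hy : 𝒬.invSqrt (𝒬.sqrtTo x) ∈ (LinearMap.ker (𝒬.sqrt : H →ₗ[ℝ] H))ᗮ :=
    ((LinearEquiv.ofBijective _ 𝒬.sqrtTo_bijective).symm (𝒬.sqrtTo x)).2
  have hq : 𝒬.sqrt (𝒬.invSqrt (𝒬.sqrtTo x)) = 𝒬.sqrt x := 𝒬.sqrt_invSqrt _
  generalize 𝒬.invSqrt (𝒬.sqrtTo x) = y at hy hq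
  have hk : x - y ∈ LinearMap.ker (𝒬.sqrt : H →ₗ[ℝ] H) := by
    change 𝒬.sqrt (x - y) = 0
    rw [map_sub, hq, sub_self]
  have h0 : inner ℝ (x - y) y = 0 := Submodule.inner_right_of_mem_orthogonal hk hy
  have h1 : ‖y‖ ^ 2 = inner ℝ x y := by
    rw [inner_sub_left, real_inner_self_eq_norm_sq] at h0
    linarith
  have h2 := real_inner_le_norm x y
  by_contra hlt
  push Not at hlt
  nlinarith [norm_nonneg x, norm_nonneg y]

/-- `|S|²_{L_Q}` can be computed in any orthonormal basis. -/
theorem lqNormSq_eq {ι : Type*} (b : HilbertBasis ι ℝ H) (S : 𝒬.H₀ →L[ℝ] H) :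
    𝒬.lqNormSq S = ∑' i, ‖S (𝒬.sqrtTo (b i))‖ₑ ^ 2 := by
  have key := fun {κ : Type _} (c : HilbertBasis κ ℝ H) => tsum_enorm_sq_eq_adjoint c (onb H)
    (S.comp (𝒬.sqrtTo.mkContinuous 1 fun x => by simpa using 𝒬.norm_sqrtTo_le x))
  exact (tsum_enorm_sq_eq_adjoint (onb H) (onb H)
    (S.comp (𝒬.sqrtTo.mkContinuous 1 fun x => by simpa using 𝒬.norm_sqrtTo_le x))).trans
    (key b).symm

end Covariance

end Covariance

/-! ### The space `X = C([0, T]; H) ∩ L²(0, T; V)` -/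

section EnergySpace

/-- Lebesgue measure on `[0, T]`. -/
abbrev timeMeasure (T : ℝ) : Measure (Icc (0 : ℝ) T) :=
  (volume : Measure ℝ).comap Subtype.val

variable {H : Type u} [NormedAddCommGroup H] [InnerProductSpace ℝ H] [CompleteSpace H]

/-- `X = C([0, T]; H) ∩ L²(0, T; V)`: a function in the intersection is given by its continuous
representative `u` and its class `w` in `L²(0, T; V)`, which agree almost everywhere. The norm is
the restriction of the `ℓ²` norm of the product, `(sup |u|² + ∫ ‖w‖²)^{1/2}`. -/
def EnergySpace (𝒜 : PositiveOperator H) (T : ℝ) :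
    Submodule ℝ (WithLp 2 (C(Icc 0 T, H) × Lp 𝒜.V 2 (timeMeasure T))) where
  carrier := {x | ∀ᵐ s ∂(timeMeasure T), 𝒜.incl (x.snd s) = x.fst s}
  add_mem' := by
    intro x y hx hy
    simp only [mem_ofPred_eq] at hx hy ⊢
    filter_upwards [hx, hy, Lp.coeFn_add x.snd y.snd] with s h1 h2 h3
    rw [WithLp.add_snd, h3, Pi.add_apply, map_add, h1, h2]
    rfl
  zero_mem' := by
    simp only [mem_ofPred_eq]
    filter_upwards [Lp.coeFn_zero 𝒜.V 2 (timeMeasure T)] with s h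
    rw [WithLp.zero_snd, h, Pi.zero_apply, map_zero]
    rfl
  smul_mem' := by
    intro c x hx
    simp only [mem_ofPred_eq] at hx ⊢
    filter_upwards [hx, Lp.coeFn_smul c x.snd] with s h1 h2
    rw [WithLp.smul_snd, h2, Pi.smul_apply, map_smul, h1]
    rfl

namespace EnergySpace

variable {𝒜 : PositiveOperator H} {T : ℝ}

/-- The value at time `t` of the continuous representative. -/
def toC (x : EnergySpace 𝒜 T) : C(Icc 0 T, H) := x.1.fst

/-- The function as an element of `L²(0, T; V)`. -/
def toL2V (x : EnergySpace 𝒜 T) : Lp 𝒜.V 2 (timeMeasure T) := x.1.snd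

theorem norm_sq (x : EnergySpace 𝒜 T) :
    ‖x‖ ^ 2 = ‖toC x‖ ^ 2 + ∫ s, ‖toL2V x s‖ ^ 2 ∂(timeMeasure T) := by
  have h : ‖x‖ ^ 2 = ‖toC x‖ ^ 2 + ‖toL2V x‖ ^ 2 := WithLp.prod_norm_sq_eq_of_L2 x.1
  have h2 : ‖toL2V x‖ ^ 2 = ∫ s, ‖toL2V x s‖ ^ 2 ∂(timeMeasure T) := by
    rw [Lp.norm_def, (Lp.memLp (toL2V x)).eLpNorm_eq_integral_rpow_norm two_ne_zero
      ENNReal.ofNat_ne_top]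
    have h0 : 0 ≤ ∫ s, ‖toL2V x s‖ ^ (2 : ℝ) ∂(timeMeasure T) := integral_nonneg fun s => by positivity
    simp only [ENNReal.toReal_ofNat]
    rw [ENNReal.toReal_ofReal (by positivity), ← Real.rpow_natCast, ← Real.rpow_mul h0]
    simp
  rw [h, h2]

end EnergySpace

end EnergySpace

/-! ### The conditions on the coefficients -/

section Conditions

variable {H : Type u} [NormedAddCommGroup H] [InnerProductSpace ℝ H] [CompleteSpace H]

/-- The conditions on the bilinear continuous mapping `B : V × V → V'`: antisymmetry, and the bounds
in terms of a Banach space `ℋ` with `V ⊂ ℋ ⊂ H`. The inclusions are `k : V → ℋ` and `j : ℋ → H`. -/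
def ConditionC1 (𝒜 : PositiveOperator H) (B : 𝒜.V →L[ℝ] 𝒜.V →L[ℝ] StrongDual ℝ 𝒜.V) : Prop :=
  (∀ u₁ u₂ u₃ : 𝒜.V, B u₁ u₂ u₃ = -B u₁ u₃ u₂) ∧
  ∃ (ℋ : Type u) (_ : NormedAddCommGroup ℋ) (_ : NormedSpace ℝ ℋ) (_ : CompleteSpace ℋ)
    (k : 𝒜.V →ₗ[ℝ] ℋ) (j : ℋ →L[ℝ] H),
    Function.Injective j ∧ (∀ v : 𝒜.V, j (k v) = 𝒜.incl v) ∧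
    (∃ a₀ : ℝ, 0 < a₀ ∧ ∀ v : 𝒜.V, ‖k v‖ ^ 2 ≤ a₀ * ‖𝒜.incl v‖ * ‖v‖) ∧
    (∀ η : ℝ, 0 < η → ∃ C : ℝ, 0 < C ∧ ∀ u₁ u₂ u₃ : 𝒜.V,
      |B u₁ u₂ u₃| ≤ η * ‖u₃‖ ^ 2 + C * ‖k u₁‖ ^ 2 * ‖k u₂‖ ^ 2)

/-- The conditions on `σ ∈ C([0, T] × V; L_Q(H₀, H))`: growth and Lipschitz bounds with given
constants `K₂` and `L₂`. -/
def ConditionC2 (𝒜 : PositiveOperator H) (𝒬 : Covariance H) (T : ℝ)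
    (σ : Icc 0 T → 𝒜.V → (𝒬.H₀ →L[ℝ] H)) (K₂ L₂ : ℝ) : Prop :=
  (∀ (t : Icc 0 T) (u : 𝒜.V), 𝒬.lqNormSq (σ t u) < ∞) ∧
  (∀ p : Icc 0 T × 𝒜.V,
    Filter.Tendsto (fun p' : Icc 0 T × 𝒜.V => 𝒬.lqNormSq (σ p'.1 p'.2 - σ p.1 p.2))
      (nhds p) (nhds 0)) ∧
  ∃ K₀ K₁ L₁ : ℝ, 0 ≤ K₀ ∧ 0 ≤ K₁ ∧ 0 ≤ L₁ ∧
    (∀ (t : Icc 0 T) (u : 𝒜.V), 𝒬.lqNormSq (σ t u) ≤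
      ENNReal.ofReal (K₀ + K₁ * ‖𝒜.incl u‖ ^ 2 + K₂ * ‖u‖ ^ 2)) ∧
    (∀ (t : Icc 0 T) (u v : 𝒜.V), 𝒬.lqNormSq (σ t u - σ t v) ≤
      ENNReal.ofReal (L₁ * ‖𝒜.incl (u - v)‖ ^ 2 + L₂ * ‖u - v‖ ^ 2))

/-- The conditions on `R̃ : [0, T] × H → H`. -/
def ConditionC3ii (T : ℝ) (R : Icc 0 T → H → H) : Prop :=
  Continuous (Function.uncurry R) ∧
  ∃ R₀ R₁ : ℝ, 0 ≤ R₀ ∧ 0 ≤ R₁ ∧ (∀ t : Icc 0 T, ‖R t 0‖ ≤ R₀) ∧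
    ∀ (t : Icc 0 T) (u v : H), ‖R t u - R t v‖ ≤ R₁ * ‖u - v‖

/-- Time Hölder regularity of `σ` (the inequality between the squares of both sides). -/
def ConditionC4 (𝒜 : PositiveOperator H) (𝒬 : Covariance H) (T : ℝ)
    (σ : Icc 0 T → 𝒜.V → (𝒬.H₀ →L[ℝ] H)) : Prop :=
  ∃ γ C : ℝ, 0 < γ ∧ 0 ≤ C ∧ ∀ (t₁ t₂ : Icc 0 T) (u : 𝒜.V),
    𝒬.lqNormSq (σ t₁ u - σ t₂ u) ≤
      ENNReal.ofReal ((C * (1 + ‖u‖) * |(t₁ : ℝ) - t₂| ^ γ) ^ 2)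

end Conditions

/-! ### The controlled equation -/

section ControlEquation

variable {H : Type u} [NormedAddCommGroup H] [InnerProductSpace ℝ H] [CompleteSpace H]

/-- `S_M`: the controls `h ∈ L²(0, T; H₀)` with `∫ |h(s)|₀² ds ≤ M`. -/
def controlSet (𝒬 : Covariance H) (T M : ℝ) : Set (Lp 𝒬.H₀ 2 (timeMeasure T)) :=
  {h | ∫ s, ‖h s‖ ^ 2 ∂(timeMeasure T) ≤ M}

/-- `x ∈ X` is a weak solution on `[0, T]` of
`du + [A u + B(u, u) + R̃(t, u)] dt = σ(t, u) h dt`, `u(0) = ξ`, tested against all `v ∈ Dom(A)`. -/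
def IsControlSolution (𝒜 : PositiveOperator H) (𝒬 : Covariance H) (T : ℝ)
    (B : 𝒜.V →L[ℝ] 𝒜.V →L[ℝ] StrongDual ℝ 𝒜.V) (R : Icc 0 T → H → H)
    (σ : Icc 0 T → 𝒜.V → (𝒬.H₀ →L[ℝ] H)) (ξ : H)
    (h : Lp 𝒬.H₀ 2 (timeMeasure T)) (x : EnergySpace 𝒜 T) : Prop :=
  ∀ (v : 𝒜.A.domain) (t : Icc 0 T),
    inner ℝ (EnergySpace.toC x t) (v : H) - inner ℝ ξ (v : H) +
      ∫ s in Iic t, (inner ℝ (EnergySpace.toC x s) (𝒜.A v) +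
        B (EnergySpace.toL2V x s) (EnergySpace.toL2V x s) (𝒜.ofDomain v) +
        inner ℝ (R s (EnergySpace.toC x s)) (v : H)) ∂(timeMeasure T) =
    ∫ s in Iic t, inner ℝ (σ s (EnergySpace.toL2V x s) (h s)) (v : H) ∂(timeMeasure T)

/-- `K_M`: the solutions of the controlled equation for all controls in `S_M`. -/
def controlledSolutions (𝒜 : PositiveOperator H) (𝒬 : Covariance H) (T : ℝ)
    (B : 𝒜.V →L[ℝ] 𝒜.V →L[ℝ] StrongDual ℝ 𝒜.V) (R : Icc 0 T → H → H)
    (σ : Icc 0 T → 𝒜.V → (𝒬.H₀ →L[ℝ] H)) (ξ : H) (M : ℝ) : Set (EnergySpace 𝒜 T) :=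
  {x | ∃ h ∈ controlSet 𝒬 T M, IsControlSolution 𝒜 𝒬 T B R σ ξ h x}

end ControlEquation

end

/-! By (C1), |v|² ≤ ‖j‖² a₀ |v| ‖v‖, so V embeds continuously in H, A^{1/2} is an isometry of V onto
H, and G = A^{-1/2} is a bounded, symmetric, injective operator on H. Writing u = G w and applying G
to the equation gives an identity in H, G u(t) = G ξ + ∫₀ᵗ (φ - w), φ = G f(w) - b(w, w), where b is
B carried to H by the isometry and f(w) = σ(·, u) h - R̃(·, u). The dual V' has disappeared, and
testing against Dom(A) amounts to testing this identity against the dense range of G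
(`isControlSolution_iff`).

The linear problem (ξ, φ) ↦ (u, w) is solved backwards: for a curve w = a + ∫g the pair (G w, w) is
the solution with data (G a, w + G² g). These data are dense, and the energy equality bounds the
solution by the data, so the solution operator `linearFlow`, the equation and the energy equality
all extend by continuity.

For the nonlinear problem, antisymmetry removes b from the energy balance, and (C1), made scaling
invariant, reads ‖b(x, y)‖² ≤ c |Gx| |x| |Gy| |y|. Young's inequality and Gronwall's lemma with an
integrable kernel give an a priori bound and a stability estimate (`norm_sq_remainder_le`): if two
solutions differ by y + r, with y the linear response to the explicit part of the perturbation, then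
r is bounded by a multiple of y. The case y = 0 is uniqueness. Existence is a continuation argument:
φ ↦ G f(w) - b(w, w) is causal and contracts on short time intervals
(`exists_fixedPoint_of_causal`).

For compactness, a ball of controls is weakly compact, and h ↦ u_h is continuous from the weak
topology to the norm of X (`tendsto_controlledFlow`). By stability it suffices that the linear flow
driven by σ(s, u_{h₀}(s))(h - h₀) tends to zero as h → h₀ weakly (`tendstoFlow_hilbertSchmidt`). The
Hilbert–Schmidt property reduces this to rank one coefficients, density to piecewise constant ones
with values in the range of G². There the solution is an explicit continuous function of a scalar
primitive of (e, h - h₀), which tends to zero uniformly in time. -/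

noncomputable section

/-! ### Lebesgue measure on `[0, T]` -/

section TimeMeasure

variable {T : ℝ}

theorem timeMeasure_apply (A : Set (Icc (0 : ℝ) T)) :
    timeMeasure T A = volume (Subtype.val '' A) :=
  (MeasurableEmbedding.subtype_coe measurableSet_Icc).comap_apply _ _

instance : IsFiniteMeasure (timeMeasure T) where
  measure_univ_lt_top := by
    rw [timeMeasure_apply]
    refine (measure_mono (t := Icc 0 T) ?_).trans_lt measure_Icc_lt_top
    rintro _ ⟨x, -, rfl⟩
    exact x.2

instance : NullSingletonClass (timeMeasure T) where
  measure_singleton x := by rw [timeMeasure_apply, image_singleton, Real.volume_singleton]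

theorem timeMeasure_Ioc_le (s t : Icc (0 : ℝ) T) :
    timeMeasure T (Ioc s t) ≤ ENNReal.ofReal ((t : ℝ) - s) := by
  rw [timeMeasure_apply, ← Real.volume_Ioc]
  refine measure_mono ?_
  rintro _ ⟨x, hx, rfl⟩
  exact hx

theorem setIntegral_Iic_sub {E : Type*} [NormedAddCommGroup E] [NormedSpace ℝ E]
    {g : Icc (0 : ℝ) T → E} (hg : Integrable g (timeMeasure T)) {s t : Icc (0 : ℝ) T}
    (hst : s ≤ t) :
    ∫ r in Iic t, g r ∂(timeMeasure T) =
      ∫ r in Iic s, g r ∂(timeMeasure T) + ∫ r in Ioc s t, g r ∂(timeMeasure T) := by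
  rw [← Iic_union_Ioc_eq_Iic hst, setIntegral_union (Iic_disjoint_Ioc le_rfl) measurableSet_Ioc
    hg.integrableOn hg.integrableOn]

end TimeMeasure

/-! ### Square integrable functions -/

section SquareIntegrable

variable {α : Type*} [MeasurableSpace α] {μ : Measure α}
variable {E F : Type*} [NormedAddCommGroup E] [NormedAddCommGroup F]

theorem Lp_two_norm_sq (f : Lp E 2 μ) : ‖f‖ ^ 2 = ∫ s, ‖f s‖ ^ 2 ∂μ := by
  rw [Lp.norm_def, (Lp.memLp f).eLpNorm_eq_integral_rpow_norm two_ne_zero ENNReal.ofNat_ne_top]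
  have h0 : 0 ≤ ∫ s, ‖f s‖ ^ (2 : ℝ) ∂μ := integral_nonneg fun s => by positivity
  simp only [ENNReal.toReal_ofNat]
  rw [ENNReal.toReal_ofReal (by positivity), ← Real.rpow_natCast, ← Real.rpow_mul h0]
  simp

theorem integrable_norm_sq (f : Lp E 2 μ) : Integrable (fun s => ‖f s‖ ^ 2) μ :=
  (memLp_two_iff_integrable_sq_norm (Lp.aestronglyMeasurable f)).1 (Lp.memLp f)

theorem MeasureTheory.MemLp.integrable_norm_mul {f : α → E} {g : α → F} (hf : MemLp f 2 μ)
    (hg : MemLp g 2 μ) : Integrable (fun s => ‖f s‖ * ‖g s‖) μ :=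
  hf.norm.integrable_mul hg.norm

theorem sq_integral_norm_mul_le {f : α → E} {g : α → F} (hf : MemLp f 2 μ) (hg : MemLp g 2 μ) :
    (∫ s, ‖f s‖ * ‖g s‖ ∂μ) ^ 2 ≤ (∫ s, ‖f s‖ ^ 2 ∂μ) * ∫ s, ‖g s‖ ^ 2 ∂μ := by
  have h := integral_mul_le_Lp_mul_Lq_of_nonneg (μ := μ) Real.HolderConjugate.two_two
    (f := fun s => ‖f s‖) (g := fun s => ‖g s‖) (ae_of_all _ fun s => norm_nonneg _)
    (ae_of_all _ fun s => norm_nonneg _) (by simpa using hf.norm) (by simpa using hg.norm)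
  simp only [Real.rpow_ofNat, ← Real.sqrt_eq_rpow] at h
  have h1 : 0 ≤ ∫ s, ‖f s‖ ^ 2 ∂μ := integral_nonneg fun s => by positivity
  have h2 : 0 ≤ ∫ s, ‖g s‖ ^ 2 ∂μ := integral_nonneg fun s => by positivity
  have h3 : 0 ≤ ∫ s, ‖f s‖ * ‖g s‖ ∂μ := integral_nonneg fun s => by positivity
  calc _ ≤ (√(∫ s, ‖f s‖ ^ 2 ∂μ) * √(∫ s, ‖g s‖ ^ 2 ∂μ)) ^ 2 := by gcongr
    _ = _ := by rw [mul_pow, Real.sq_sqrt h1, Real.sq_sqrt h2]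

theorem integral_norm_mul_le (f : Lp E 2 μ) (g : Lp F 2 μ) :
    ∫ s, ‖f s‖ * ‖g s‖ ∂μ ≤ ‖f‖ * ‖g‖ := by
  have h := sq_integral_norm_mul_le (Lp.memLp f) (Lp.memLp g)
  rw [← Lp_two_norm_sq, ← Lp_two_norm_sq, ← mul_pow] at h
  exact le_of_abs_le (abs_le_of_sq_le_sq h (by positivity))

theorem norm_setIntegral_le_sqrt [NormedSpace ℝ E] [IsFiniteMeasure μ] (f : Lp E 2 μ) (A : Set α) :
    ‖∫ s in A, f s ∂μ‖ ≤ √(μ.real A) * ‖f‖ := by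
  have h := sq_integral_norm_mul_le (μ := μ.restrict A) (memLp_const (1 : ℝ))
    ((Lp.memLp f).mono_measure Measure.restrict_le_self)
  simp only [norm_one, one_mul, one_pow, integral_const, measureReal_restrict_apply_univ,
    smul_eq_mul, mul_one] at h
  have h2 : ∫ s in A, ‖f s‖ ^ 2 ∂μ ≤ ‖f‖ ^ 2 := by
    rw [Lp_two_norm_sq]
    exact setIntegral_le_integral (integrable_norm_sq f) (ae_of_all _ fun s => by positivity)
  refine (norm_integral_le_integral_norm _).trans ?_
  refine le_of_abs_le (abs_le_of_sq_le_sq (b := √(μ.real A) * ‖f‖) (h.trans ?_) (by positivity))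
  rw [mul_pow, Real.sq_sqrt measureReal_nonneg]
  gcongr

theorem Lp_two_integrable [IsFiniteMeasure μ] (f : Lp E 2 μ) : Integrable (fun s => f s) μ :=
  (Lp.memLp f).integrable (by norm_num)

/-- Multiplication by the indicator function of `A` on `L²`. -/
def indicatorL2 (E : Type*) [NormedAddCommGroup E] [NormedSpace ℝ E] (μ : Measure α) {A : Set α}
    (hA : MeasurableSet A) : Lp E 2 μ →L[ℝ] Lp E 2 μ :=
  LinearMap.mkContinuous
    { toFun := fun f => ((Lp.memLp f).indicator hA).toLp _
      map_add' := fun f g => by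
        rw [← MemLp.toLp_add, MemLp.toLp_eq_toLp_iff]
        filter_upwards [Lp.coeFn_add f g] with s hs
        by_cases h : s ∈ A
        · simpa [h] using hs
        · simp [h]
      map_smul' := fun c f => by
        rw [RingHom.id_apply, ← MemLp.toLp_const_smul, MemLp.toLp_eq_toLp_iff]
        filter_upwards [Lp.coeFn_smul c f] with s hs
        by_cases h : s ∈ A
        · simpa [h] using hs
        · simp [h] } 1 fun f => by
    rw [one_mul]
    refine Lp.norm_le_norm_of_ae_le ?_
    filter_upwards [((Lp.memLp f).indicator hA).coeFn_toLp] with s hs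
    change ‖(((Lp.memLp f).indicator hA).toLp _ : Lp E 2 μ) s‖ ≤ _
    rw [hs]
    exact norm_indicator_le_norm_self _ _

variable [NormedSpace ℝ E] {A A' : Set α} (hA : MeasurableSet A) (hA' : MeasurableSet A')

theorem coeFn_indicatorL2 (f : Lp E 2 μ) : indicatorL2 E μ hA f =ᵐ[μ] A.indicator f :=
  ((Lp.memLp f).indicator hA).coeFn_toLp

theorem norm_indicatorL2_le (f : Lp E 2 μ) : ‖indicatorL2 E μ hA f‖ ≤ ‖f‖ := by
  refine ((indicatorL2 E μ hA).le_of_opNorm_le (LinearMap.mkContinuous_norm_le _ zero_le_one _) f).trans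
    (one_mul _).le

theorem indicatorL2_ext_iff (f g : Lp E 2 μ) :
    indicatorL2 E μ hA f = indicatorL2 E μ hA g ↔ ∀ᵐ s ∂μ, s ∈ A → f s = g s := by
  rw [Lp.ext_iff]
  constructor
  · intro h
    filter_upwards [h, coeFn_indicatorL2 hA f, coeFn_indicatorL2 hA g] with s h1 h2 h3 hs
    rwa [h2, h3, indicator_of_mem hs, indicator_of_mem hs] at h1
  · intro h
    filter_upwards [h, coeFn_indicatorL2 hA f, coeFn_indicatorL2 hA g] with s h1 h2 h3
    rw [h2, h3]
    by_cases hs : s ∈ A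
    · rw [indicator_of_mem hs, indicator_of_mem hs, h1 hs]
    · rw [indicator_of_notMem hs, indicator_of_notMem hs]

theorem norm_indicatorL2_sq (f : Lp E 2 μ) :
    ‖indicatorL2 E μ hA f‖ ^ 2 = ∫ s in A, ‖f s‖ ^ 2 ∂μ := by
  rw [Lp_two_norm_sq, ← integral_indicator hA]
  refine integral_congr_ae ?_
  filter_upwards [coeFn_indicatorL2 hA f] with s hs
  rw [hs]
  by_cases h : s ∈ A <;> simp [h]

/-- The norm of an `L²` function on small sets is uniformly small. -/
theorem exists_norm_indicatorL2_le (f : Lp E 2 μ) {ε : ℝ} (hε : 0 < ε) :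
    ∃ δ : ℝ, 0 < δ ∧ ∀ (A : Set α) (hA : MeasurableSet A), μ A ≤ ENNReal.ofReal δ →
      ‖indicatorL2 E μ hA f‖ ≤ ε := by
  obtain ⟨δ, hδ, h⟩ := (Lp.memLp f).eLpNorm_indicator_le one_le_two ENNReal.ofNat_ne_top hε
  refine ⟨δ, hδ, fun A hA hμ => ?_⟩
  rw [Lp.norm_def, eLpNorm_congr_ae (coeFn_indicatorL2 hA f)]
  exact ENNReal.toReal_le_of_le_ofReal hε.le (h A hA hμ)

/-- Absolute continuity of the integral. It supplies the short intervals on which Gronwall's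
argument is run. -/
theorem exists_setIntegral_le {f : α → ℝ} (hf : Integrable f μ) (hf0 : ∀ s, 0 ≤ f s) {ε : ℝ}
    (hε : 0 < ε) :
    ∃ δ : ℝ, 0 < δ ∧ ∀ A : Set α, MeasurableSet A → μ A ≤ ENNReal.ofReal δ →
      ∫ s in A, f s ∂μ ≤ ε := by
  obtain ⟨δ, hδ, h⟩ := (memLp_one_iff_integrable.2 hf).eLpNorm_indicator_le le_rfl
    ENNReal.one_ne_top hε
  refine ⟨δ, hδ, fun A hA hμ => ?_⟩
  have h1 := h A hA hμ
  rw [eLpNorm_indicator_eq_eLpNorm_restrict hA, eLpNorm_one_eq_lintegral_enorm,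
    ← ofReal_integral_norm_eq_lintegral_enorm hf.integrableOn,
    ENNReal.ofReal_le_ofReal_iff hε.le] at h1
  simpa [Real.norm_eq_abs, abs_of_nonneg (hf0 _)] using h1

end SquareIntegrable

/-! ### Gronwall's inequality with an integrable kernel -/

section Gronwall

variable {T : ℝ}

/-- The right-hand side E of the hypothesis is nondecreasing and dominates f, so E(t) ≤ E(s) + E(t)
∫ₛᵗ k. On intervals where ∫k ≤ 1/2 this can be solved for E(t), and finitely many such intervals
cover [0, T]. The factor 2 in the exponent is the price of never differentiating E. -/
theorem le_mul_exp_of_le_add_setIntegral (hT : 0 ≤ T) {f k : Icc (0 : ℝ) T → ℝ} {ε : ℝ}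
    (hf : Continuous f) (hf0 : ∀ s, 0 ≤ f s) (hk : Integrable k (timeMeasure T))
    (hk0 : ∀ s, 0 ≤ k s) (hε : 0 ≤ ε)
    (h : ∀ t, f t ≤ ε + ∫ s in Iic t, k s * f s ∂(timeMeasure T)) (t : Icc (0 : ℝ) T) :
    f t ≤ ε * Real.exp (2 * ∫ s, k s ∂(timeMeasure T)) := by
  have hkf : Integrable (fun s => k s * f s) (timeMeasure T) := by
    obtain ⟨C, hC⟩ := isCompact_univ.exists_bound_of_continuousOn hf.continuousOn
    exact hk.mul_bdd (c := C) hf.aestronglyMeasurable (ae_of_all _ fun s => hC s (mem_univ s))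
  have hkf0 : ∀ s, 0 ≤ k s * f s := fun s => mul_nonneg (hk0 s) (hf0 s)
  let E : Icc (0 : ℝ) T → ℝ := fun t => ε + ∫ s in Iic t, k s * f s ∂(timeMeasure T)
  let K : Icc (0 : ℝ) T → ℝ := fun t => ∫ s in Iic t, k s ∂(timeMeasure T)
  have hEadd : ∀ s t, s ≤ t → E t = E s + ∫ r in Ioc s t, k r * f r ∂(timeMeasure T) := by
    intro s t hst
    simp only [E, setIntegral_Iic_sub hkf hst, add_assoc]
  have hE0 : ∀ t, 0 ≤ E t := fun t => (hf0 t).trans (h t)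
  have hEmono : Monotone E := fun s t hst => by
    rw [hEadd s t hst, le_add_iff_nonneg_right]
    exact setIntegral_nonneg measurableSet_Ioc fun r _ => hkf0 r
  have hstep : ∀ s t, s ≤ t → E t ≤ E s + E t * (K t - K s) := by
    intro s t hst
    have h1 : K t - K s = ∫ r in Ioc s t, k r ∂(timeMeasure T) := by
      simp only [K, setIntegral_Iic_sub hk hst, add_sub_cancel_left]
    have h2 : ∫ r in Ioc s t, k r * f r ∂(timeMeasure T) ≤
        ∫ r in Ioc s t, E t * k r ∂(timeMeasure T) := ?_
    · rw [h1, ← integral_const_mul]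
      linarith [hEadd s t hst]
    refine setIntegral_mono_on hkf.integrableOn (hk.const_mul _).integrableOn measurableSet_Ioc ?_
    intro r hr
    rw [mul_comm]
    exact mul_le_mul_of_nonneg_right ((h r).trans (hEmono hr.2)) (hk0 r)
  obtain ⟨δ, hδ, hsmall⟩ := exists_setIntegral_le hk hk0 (ε := 1 / 2) (by norm_num)
  have hKmono : Monotone K := fun s t hst => by
    simp only [K, setIntegral_Iic_sub hk hst, le_add_iff_nonneg_right]
    exact setIntegral_nonneg measurableSet_Ioc fun r _ => hk0 r
  have hlocal : ∀ s t : Icc (0 : ℝ) T, s ≤ t → (t : ℝ) - s ≤ δ → E t ≤ E s * Real.exp (2 * (K t - K s)) := by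
    intro s t hst hd
    have h1 : K t - K s ≤ 1 / 2 := by
      have := hsmall (Ioc s t) measurableSet_Ioc
        ((timeMeasure_Ioc_le s t).trans (ENNReal.ofReal_le_ofReal hd))
      simpa only [K, setIntegral_Iic_sub hk hst, add_sub_cancel_left] using this
    have h0 : 0 ≤ K t - K s := sub_nonneg.2 (hKmono hst)
    have h2 := hstep s t hst
    generalize K t - K s = x at *
    -- From e^{2x} ≥ 1 + 2x: (1 - x)(1 + 2x) = 1 + x(1 - 2x) ≥ 1 for 0 ≤ x ≤ 1/2.
    have h3 : 1 ≤ (1 - x) * Real.exp (2 * x) := by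
      have := Real.add_one_le_exp (2 * x)
      nlinarith
    calc E t ≤ E t * ((1 - x) * Real.exp (2 * x)) := le_mul_of_one_le_right (hE0 t) h3
      _ = (E t * (1 - x)) * Real.exp (2 * x) := by ring
      _ ≤ E s * Real.exp (2 * x) := by gcongr; linarith
  have hglobal : ∀ (n : ℕ) (s t : Icc (0 : ℝ) T), s ≤ t → (t : ℝ) - s ≤ n * δ →
      E t ≤ E s * Real.exp (2 * (K t - K s)) := by
    intro n
    induction n with
    | zero =>
      intro s t hst hd
      exact hlocal s t hst (hd.trans (by simpa using hδ.le))
    | succ n ih =>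
      intro s t hst hd
      by_cases hc : (t : ℝ) - s ≤ δ
      · exact hlocal s t hst hc
      push Not at hc
      let r : Icc (0 : ℝ) T := ⟨s + δ, by linarith [s.2.1], by linarith [t.2.2]⟩
      have hsr : s ≤ r := Subtype.coe_le_coe.1 (by simp [r, hδ.le])
      have hrt : r ≤ t := Subtype.coe_le_coe.1 (by simp only [r]; linarith)
      have h1 := hlocal s r hsr (by simp [r])
      have h2 := ih r t hrt (by simp only [r]; push_cast at hd; linarith)
      calc E t ≤ E r * Real.exp (2 * (K t - K r)) := h2
        _ ≤ E s * Real.exp (2 * (K r - K s)) * Real.exp (2 * (K t - K r)) := by gcongr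
        _ = E s * Real.exp (2 * (K t - K s)) := by
          rw [mul_assoc, ← Real.exp_add]
          ring_nf
  let z : Icc (0 : ℝ) T := ⟨0, le_rfl, hT⟩
  -- The initial interval is a null singleton, so E(0) = ε and K(0) = 0.
  have hz : Iic z = {z} := by
    ext x
    simp only [mem_Iic, mem_singleton_iff]
    exact ⟨fun hx => le_antisymm hx (Subtype.coe_le_coe.1 x.2.1), fun hx => hx.le⟩
  have hEz : E z = ε := by
    simp only [E, hz, Measure.restrict_singleton, measure_singleton, zero_smul,
      integral_zero_measure, add_zero]
  have hKz : K z = 0 := by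
    simp only [K, hz, Measure.restrict_singleton, measure_singleton, zero_smul,
      integral_zero_measure]
  obtain ⟨n, hn⟩ := exists_nat_ge (T / δ)
  have h1 := hglobal n z t (Subtype.coe_le_coe.1 t.2.1) (by
    rw [div_le_iff₀ hδ] at hn
    simp only [z]
    linarith [t.2.2])
  rw [hEz, hKz, sub_zero] at h1
  refine (h t).trans (h1.trans ?_)
  gcongr
  exact setIntegral_le_integral hk (ae_of_all _ hk0)

end Gronwall

/-! ### Primitives of square integrable functions -/

section Primitive

variable {T : ℝ} {E : Type*} [NormedAddCommGroup E] [NormedSpace ℝ E]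

/-- Cauchy–Schwarz: primitives of L² functions are Hölder continuous of exponent 1/2, with a
constant depending only on the L² norm. This gives continuity here and equicontinuity in the
compactness argument. -/
theorem norm_setIntegral_Iic_sub_le (f : Lp E 2 (timeMeasure T)) (s t : Icc (0 : ℝ) T) :
    ‖∫ r in Iic t, f r ∂(timeMeasure T) - ∫ r in Iic s, f r ∂(timeMeasure T)‖ ≤
      √|(t : ℝ) - s| * ‖f‖ := by
  wlog hst : s ≤ t generalizing s t
  · rw [norm_sub_rev, abs_sub_comm]
    exact this t s (le_of_not_ge hst)
  rw [setIntegral_Iic_sub (Lp_two_integrable f) hst, add_sub_cancel_left]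
  refine (norm_setIntegral_le_sqrt f _).trans ?_
  gcongr
  refine ENNReal.toReal_le_of_le_ofReal (abs_nonneg _) ((timeMeasure_Ioc_le s t).trans ?_)
  exact ENNReal.ofReal_le_ofReal (le_abs_self _)

/-- The primitive `t ↦ ∫₀ᵗ f` of a square integrable function. -/
def primitive (T : ℝ) (E : Type*) [NormedAddCommGroup E] [NormedSpace ℝ E] :
    Lp E 2 (timeMeasure T) →L[ℝ] C(Icc (0 : ℝ) T, E) :=
  LinearMap.mkContinuous
    { toFun := fun f =>
        { toFun := fun t => ∫ s in Iic t, f s ∂(timeMeasure T)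
          continuous_toFun := by
            rw [continuous_iff_continuousAt]
            intro s
            rw [ContinuousAt, tendsto_iff_norm_sub_tendsto_zero]
            refine squeeze_zero (fun t => norm_nonneg _)
              (fun t => norm_setIntegral_Iic_sub_le f s t) ?_
            have h : Continuous fun t : Icc (0 : ℝ) T => √|(t : ℝ) - s| * ‖f‖ := by fun_prop
            simpa using h.tendsto s }
      map_add' := fun f g => by
        ext t
        change ∫ s in Iic t, (f + g) s ∂(timeMeasure T) =
          ∫ s in Iic t, f s ∂(timeMeasure T) + ∫ s in Iic t, g s ∂(timeMeasure T)
        rw [← integral_add (Lp_two_integrable f).integrableOn (Lp_two_integrable g).integrableOn]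
        exact integral_congr_ae (ae_restrict_of_ae (Lp.coeFn_add f g))
      map_smul' := fun c f => by
        ext t
        change ∫ s in Iic t, (c • f) s ∂(timeMeasure T) = c • ∫ s in Iic t, f s ∂(timeMeasure T)
        rw [← integral_smul]
        exact integral_congr_ae (ae_restrict_of_ae (Lp.coeFn_smul c f)) }
    (√((timeMeasure T).real univ)) fun f => by
      rw [ContinuousMap.norm_le _ (by positivity)]
      intro t
      refine (norm_setIntegral_le_sqrt f (Iic t)).trans ?_
      exact mul_le_mul_of_nonneg_right
        (Real.sqrt_le_sqrt (measureReal_mono (subset_univ _))) (norm_nonneg _)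

theorem primitive_apply (f : Lp E 2 (timeMeasure T)) (t : Icc (0 : ℝ) T) :
    primitive T E f t = ∫ s in Iic t, f s ∂(timeMeasure T) := rfl

variable {H : Type*} [NormedAddCommGroup H] [InnerProductSpace ℝ H] [CompleteSpace H]

/-- The chain rule for |∫g|², obtained without differentiation: |∫g|² is the integral of (g(s),
g(r)) over the square [0, t]². Fubini gives the stated integral on the triangle below the diagonal;
the other triangle is its mirror image, and the diagonal is negligible. -/
theorem norm_sq_primitive (g : Lp H 2 (timeMeasure T)) (t : Icc (0 : ℝ) T) :
    ‖primitive T H g t‖ ^ 2 =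
      2 * ∫ s in Iic t, inner ℝ (g s) (primitive T H g s) ∂(timeMeasure T) := by
  set ν := (timeMeasure T).restrict (Iic t)
  have hg : Integrable (fun s => g s) ν := (Lp_two_integrable g).integrableOn
  set K : Icc (0 : ℝ) T × Icc (0 : ℝ) T → ℝ := fun p => inner ℝ (g p.1) (g p.2)
  have hK : Integrable K (ν.prod ν) := by
    refine (hg.norm.mul_prod hg.norm).mono' ?_ (ae_of_all _ fun p => norm_inner_le_norm _ _)
    exact hg.aestronglyMeasurable.comp_fst.inner hg.aestronglyMeasurable.comp_snd
  have hD : MeasurableSet {p : Icc (0 : ℝ) T × Icc (0 : ℝ) T | p.2 ≤ p.1} :=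
    measurableSet_le measurable_snd measurable_fst
  have hD' : MeasurableSet {p : Icc (0 : ℝ) T × Icc (0 : ℝ) T | p.2 < p.1} :=
    measurableSet_lt measurable_snd measurable_fst
  have h1 : ‖primitive T H g t‖ ^ 2 = ∫ p, K p ∂(ν.prod ν) := by
    rw [integral_prod _ hK, ← real_inner_self_eq_norm_sq]
    simp only [K, primitive_apply]
    have h2 : ∀ x : H, ∫ y, inner ℝ x (g y) ∂ν = inner ℝ x (∫ y, g y ∂ν) :=
      fun x => integral_inner hg x
    simp only [h2]
    have h3 := integral_inner (𝕜 := ℝ) hg (∫ y, g y ∂ν)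
    rw [← h3]
    exact integral_congr_ae (ae_of_all _ fun s => real_inner_comm _ _)
  have hmem : ∀ᵐ s ∂ν, s ≤ t := ae_restrict_mem measurableSet_Iic
  have hle : ∫ p in {p | p.2 ≤ p.1}, K p ∂(ν.prod ν) =
      ∫ s, inner ℝ (g s) (primitive T H g s) ∂ν := by
    rw [← integral_indicator hD, integral_prod _ (hK.indicator hD)]
    refine integral_congr_ae ?_
    filter_upwards [hmem] with s hs
    have : (fun r => ({p : Icc (0 : ℝ) T × Icc (0 : ℝ) T | p.2 ≤ p.1}).indicator K (s, r)) =
        (Iic s).indicator fun r => inner ℝ (g s) (g r) := by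
      ext r
      by_cases h : r ≤ s <;> simp [h, K]
    rw [this, integral_indicator measurableSet_Iic, Measure.restrict_restrict measurableSet_Iic,
      inter_eq_self_of_subset_left (Iic_subset_Iic.2 hs), primitive_apply]
    exact integral_inner (Lp_two_integrable g).integrableOn _
  have hlt : ∫ p in {p | p.2 < p.1}, K p ∂(ν.prod ν) =
      ∫ s, inner ℝ (g s) (primitive T H g s) ∂ν := by
    rw [← integral_indicator hD', integral_prod _ (hK.indicator hD')]
    refine integral_congr_ae ?_
    filter_upwards [hmem] with s hs
    have : (fun r => ({p : Icc (0 : ℝ) T × Icc (0 : ℝ) T | p.2 < p.1}).indicator K (s, r)) =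
        (Iio s).indicator fun r => inner ℝ (g s) (g r) := by
      ext r
      by_cases h : r < s <;> simp [h, K]
    rw [this, integral_indicator measurableSet_Iio, Measure.restrict_restrict measurableSet_Iio,
      inter_eq_self_of_subset_left (Iio_subset_Iic_self.trans (Iic_subset_Iic.2 hs)),
      primitive_apply, setIntegral_congr_set (Iio_ae_eq_Iic (a := s)),
      ← integral_inner (Lp_two_integrable g).integrableOn]
  have hcompl : ∫ p in {p | p.2 ≤ p.1}ᶜ, K p ∂(ν.prod ν) =
      ∫ p in {p | p.2 < p.1}, K p ∂(ν.prod ν) := by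
    rw [← integral_indicator hD.compl, ← integral_indicator hD',
      ← integral_prod_swap (μ := ν) (ν := ν)]
    refine integral_congr_ae (ae_of_all _ fun p => ?_)
    by_cases h : p.2 < p.1 <;> simp [h, K, real_inner_comm]
  rw [h1, ← integral_add_compl hD hK, hcompl, hle, hlt, two_mul]

theorem norm_sq_add_primitive (a : H) (g : Lp H 2 (timeMeasure T)) (t : Icc (0 : ℝ) T) :
    ‖a + primitive T H g t‖ ^ 2 = ‖a‖ ^ 2 +
      2 * ∫ s in Iic t, inner ℝ (g s) (a + primitive T H g s) ∂(timeMeasure T) := by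
  have hg : Integrable (fun s => g s) ((timeMeasure T).restrict (Iic t)) :=
    (Lp_two_integrable g).integrableOn
  have h1 : ∫ s in Iic t, inner ℝ (g s) a ∂(timeMeasure T) = inner ℝ a (primitive T H g t) := by
    rw [primitive_apply, ← integral_inner hg]
    exact integral_congr_ae (ae_of_all _ fun s => real_inner_comm _ _)
  have h2 : Integrable (fun s => inner ℝ (g s) (primitive T H g s))
      ((timeMeasure T).restrict (Iic t)) := by
    refine (hg.norm.mul_const ‖primitive T H g‖).mono'
      (hg.aestronglyMeasurable.inner (primitive T H g).continuous.aestronglyMeasurable)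
      (ae_of_all _ fun s => (norm_inner_le_norm _ _).trans ?_)
    gcongr
    exact ContinuousMap.norm_coe_le_norm _ _
  have h3 : Integrable (fun s => inner ℝ (g s) a) ((timeMeasure T).restrict (Iic t)) :=
    hg.inner_const a
  simp only [inner_add_right]
  rw [integral_add h3 h2, h1, norm_add_sq_real, norm_sq_primitive]
  ring

end Primitive

/-! ### The linear equation `G u(t) = G ξ + ∫₀ᵗ (φ - w)`, `u = G w` -/

/-- `L²(0, T; E)`. -/
abbrev TimeL2 (T : ℝ) (E : Type*) [NormedAddCommGroup E] : Type _ := Lp E 2 (timeMeasure T)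

/-- `C([0, T]; E)`. -/
abbrev TimeC (T : ℝ) (E : Type*) [NormedAddCommGroup E] : Type _ := C(Icc (0 : ℝ) T, E)

/-- Multiplication by the indicator function of `[0, t]` on `L²(0, T; E)`. -/
abbrev cutoff {T : ℝ} (E : Type*) [NormedAddCommGroup E] [NormedSpace ℝ E] (t : Icc (0 : ℝ) T) :
    TimeL2 T E →L[ℝ] TimeL2 T E :=
  indicatorL2 E (timeMeasure T) (measurableSet_Iic (a := t))

theorem Iic_top_eq_univ {T : ℝ} (hT : 0 ≤ T) : Iic (⟨T, hT, le_rfl⟩ : Icc (0 : ℝ) T) = univ :=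
  eq_univ_of_forall fun s => mem_Iic.2 (Subtype.coe_le_coe.1 s.2.2)

section LinearFlow

variable {T : ℝ} {H : Type*} [NormedAddCommGroup H] [InnerProductSpace ℝ H] [CompleteSpace H]

/-- The inclusion of `C([0, T]; H)` in `L²(0, T; H)`. -/
abbrev contToL2 (T : ℝ) (H : Type*) [NormedAddCommGroup H] [NormedSpace ℝ H] :
    TimeC T H →L[ℝ] TimeL2 T H :=
  ContinuousMap.toLp 2 (timeMeasure T) ℝ

/-- The curve `a + ∫₀ᵗ g`. -/
def curve (T : ℝ) (H : Type*) [NormedAddCommGroup H] [NormedSpace ℝ H] :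
    H × TimeL2 T H →L[ℝ] TimeC T H :=
  ContinuousLinearMap.const ℝ (Icc (0 : ℝ) T) ∘L ContinuousLinearMap.fst ℝ _ _ +
    primitive T H ∘L ContinuousLinearMap.snd ℝ _ _

omit [CompleteSpace H] in
theorem curve_apply (p : H × TimeL2 T H) (t : Icc (0 : ℝ) T) :
    curve T H p t = p.1 + primitive T H p.2 t := rfl

/-- The pair `(G w, w)` for the curve `w = a + ∫₀ᵗ g`. -/
def smoothFlow (T : ℝ) (G : H →L[ℝ] H) : H × TimeL2 T H →L[ℝ] TimeC T H × TimeL2 T H :=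
  (G.compLeftContinuous ℝ (Icc (0 : ℝ) T) ∘L curve T H).prod (contToL2 T H ∘L curve T H)

/-- The data of the linear equation solved by `smoothFlow`. -/
def smoothData (T : ℝ) (G : H →L[ℝ] H) : H × TimeL2 T H →L[ℝ] H × TimeL2 T H :=
  (G ∘L ContinuousLinearMap.fst ℝ _ _).prod (contToL2 T H ∘L curve T H +
    (G ∘L G).compLpL 2 (timeMeasure T) ∘L ContinuousLinearMap.snd ℝ _ _)

/-- The solution operator `(ξ, φ) ↦ (u, w)` of `u' + A u = φ`, `u(0) = ξ`, `u = G w`. -/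
def linearFlow (T : ℝ) (G : H →L[ℝ] H) : H × TimeL2 T H →L[ℝ] TimeC T H × TimeL2 T H :=
  (smoothFlow T G).toLinearMap.extendOfNorm (smoothData T G).toLinearMap

omit [CompleteSpace H] in
theorem indicatorL2_inner {A : Set (Icc (0 : ℝ) T)} (hA : MeasurableSet A) (f g : TimeL2 T H) :
    inner ℝ (indicatorL2 H (timeMeasure T) hA f) g =
      ∫ s in A, inner ℝ (f s) (g s) ∂(timeMeasure T) := by
  rw [L2.inner_def, ← integral_indicator hA]
  refine integral_congr_ae ?_
  filter_upwards [coeFn_indicatorL2 hA f] with s hs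
  rw [hs]
  by_cases h : s ∈ A <;> simp [h]

omit [CompleteSpace H] in
-- The data are read off from a chosen curve w = a + ∫g: since G(G w) has derivative G² g, the
-- forcing must satisfy φ - w = G² g.
theorem smoothData_snd_sub (G : H →L[ℝ] H) (p : H × TimeL2 T H) :
    (smoothData T G p).2 - (smoothFlow T G p).2 = (G ∘L G).compLp p.2 := by
  change contToL2 T H (curve T H p) + (G ∘L G).compLp p.2 - contToL2 T H (curve T H p) = _
  abel

variable {G : H →L[ℝ] H}

theorem smoothFlow_equation (p : H × TimeL2 T H) (t : Icc (0 : ℝ) T) :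
    G ((smoothFlow T G p).1 t) = G (smoothData T G p).1 +
      primitive T H ((smoothData T G p).2 - (smoothFlow T G p).2) t := by
  rw [smoothData_snd_sub, primitive_apply]
  have h : ∫ s in Iic t, ((G ∘L G).compLp p.2) s ∂(timeMeasure T) =
      (G ∘L G) (primitive T H p.2 t) := by
    rw [primitive_apply, ← ContinuousLinearMap.integral_comp_comm _
      (Lp_two_integrable p.2).integrableOn]
    exact integral_congr_ae (ae_restrict_of_ae (ContinuousLinearMap.coeFn_compLp _ _))
  rw [h]
  change G (G (p.1 + primitive T H p.2 t)) = G (G p.1) + G (G (primitive T H p.2 t))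
  rw [map_add, map_add]

omit [CompleteSpace H] in
theorem smoothFlow_ae (p : H × TimeL2 T H) :
    contToL2 T H (smoothFlow T G p).1 = G.compLp (smoothFlow T G p).2 := by
  rw [Lp.ext_iff]
  filter_upwards [ContinuousMap.coeFn_toLp (p := 2) (𝕜 := ℝ) (timeMeasure T) (smoothFlow T G p).1,
    G.coeFn_compLp (smoothFlow T G p).2,
    ContinuousMap.coeFn_toLp (p := 2) (𝕜 := ℝ) (timeMeasure T) (curve T H p)] with s h1 h2 h3
  rw [h1, h2]
  change G (curve T H p s) = G (contToL2 T H (curve T H p) s)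
  rw [h3]

/-- Here u = G w = G a + ∫G g, so the chain rule gives |u|² = |G a|² + 2∫(G g, G w). By symmetry (G
g, G w) = (G² g, w), and G² g = φ - w. -/
theorem smoothFlow_energy (hG : ∀ x y, inner ℝ (G x) y = inner ℝ x (G y)) (p : H × TimeL2 T H)
    (t : Icc (0 : ℝ) T) :
    ‖(smoothFlow T G p).1 t‖ ^ 2 = ‖(smoothData T G p).1‖ ^ 2 +
      2 * inner ℝ (cutoff H t
        ((smoothData T G p).2 - (smoothFlow T G p).2)) (smoothFlow T G p).2 := by
  rw [smoothData_snd_sub, indicatorL2_inner]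
  have hprim : ∀ s, G (primitive T H p.2 s) = primitive T H (G.compLp p.2) s := by
    intro s
    rw [primitive_apply, primitive_apply,
      ← ContinuousLinearMap.integral_comp_comm _ (Lp_two_integrable p.2).integrableOn]
    exact integral_congr_ae (ae_restrict_of_ae ((ContinuousLinearMap.coeFn_compLp _ _).mono
      fun _ h => h.symm))
  have hcurve : ∀ s, G (curve T H p s) = G p.1 + primitive T H (G.compLp p.2) s := fun s => by
    rw [curve_apply, map_add, hprim]
  have h := norm_sq_add_primitive (G p.1) (G.compLp p.2) t
  rw [← hcurve] at h
  refine h.trans ?_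
  congr 2
  refine integral_congr_ae (ae_restrict_of_ae ?_)
  filter_upwards [G.coeFn_compLp p.2, (G ∘L G).coeFn_compLp p.2,
    ContinuousMap.coeFn_toLp (p := 2) (𝕜 := ℝ) (timeMeasure T) (curve T H p)] with s h1 h2 h3
  change _ = inner ℝ _ (contToL2 T H (curve T H p) s)
  rw [h1, h2, h3, ← hcurve]
  exact (hG _ _).symm

variable (hT : 0 ≤ T) (hG : ∀ x y, inner ℝ (G x) y = inner ℝ x (G y))
include hT

omit [CompleteSpace H] in
-- Young's inequality 2(φ, w) ≤ ‖φ‖² + ‖w‖² uses half of the dissipation 2∫‖w‖² and leaves |u(t)|² +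
-- ∫₀ᵗ‖w‖² ≤ |ξ|² + ‖φ‖².
theorem norm_le_of_energy {ξ : H} {φ : TimeL2 T H} {x : TimeC T H × TimeL2 T H}
    (h : ∀ t : Icc (0 : ℝ) T, ‖x.1 t‖ ^ 2 = ‖ξ‖ ^ 2 + 2 * inner ℝ
      (cutoff H t (φ - x.2)) x.2) :
    ‖x‖ ≤ 2 * ‖(ξ, φ)‖ := by
  have key : ∀ t : Icc (0 : ℝ) T, ‖x.1 t‖ ^ 2 +
      ‖cutoff H t x.2‖ ^ 2 ≤
        ‖ξ‖ ^ 2 + ‖φ‖ ^ 2 := by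
    intro t
    have h1 := h t
    rw [map_sub, inner_sub_left] at h1
    have h2 : inner ℝ (cutoff H t x.2) x.2 =
        ‖cutoff H t x.2‖ ^ 2 := by
      rw [indicatorL2_inner, norm_indicatorL2_sq]
      simp only [real_inner_self_eq_norm_sq]
    have h3 : inner ℝ (cutoff H t φ) x.2 =
        inner ℝ φ (cutoff H t x.2) := by
      rw [real_inner_comm (cutoff H t x.2) φ, indicatorL2_inner, indicatorL2_inner]
      exact integral_congr_ae (ae_of_all _ fun s => real_inner_comm _ _)
    have h4 := real_inner_le_norm φ
      (cutoff H t x.2)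
    nlinarith [sq_nonneg (‖φ‖ -
      ‖cutoff H t x.2‖)]
  have hd1 : ‖ξ‖ ≤ ‖(ξ, φ)‖ := norm_fst_le (ξ, φ)
  have hd2 : ‖φ‖ ≤ ‖(ξ, φ)‖ := norm_snd_le (ξ, φ)
  have hbound : ‖ξ‖ ^ 2 + ‖φ‖ ^ 2 ≤ (2 * ‖(ξ, φ)‖) ^ 2 := by
    nlinarith [norm_nonneg ξ, norm_nonneg φ]
  refine norm_prod_le_iff.2 ⟨(ContinuousMap.norm_le _ (by positivity)).2 fun t => ?_, ?_⟩
  · refine le_of_abs_le (abs_le_of_sq_le_sq ?_ (by positivity))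
    nlinarith [key t, sq_nonneg
      ‖cutoff H t x.2‖]
  · have h5 : cutoff H (⟨T, hT, le_rfl⟩ : Icc (0 : ℝ) T) x.2 = x.2 := by
      rw [Lp.ext_iff]
      filter_upwards [coeFn_indicatorL2 measurableSet_Iic
        (A := Iic (⟨T, hT, le_rfl⟩ : Icc (0 : ℝ) T)) x.2] with s hs
      rw [hs, Iic_top_eq_univ hT, indicator_univ]
    have h6 := key ⟨T, hT, le_rfl⟩
    rw [h5] at h6
    refine le_of_abs_le (abs_le_of_sq_le_sq ?_ (by positivity))
    nlinarith [sq_nonneg ‖x.1 ⟨T, hT, le_rfl⟩‖]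

theorem smoothFlow_norm_le (p : H × TimeL2 T H)
    (hG : ∀ x y, inner ℝ (G x) y = inner ℝ x (G y)) :
    ‖smoothFlow T G p‖ ≤ 2 * ‖smoothData T G p‖ :=
  norm_le_of_energy hT (smoothFlow_energy hG p)

/-- The pairing is half the squared norm of ∫ψ at the final time. This monotonicity of integration
gives both the density of the smooth data and the uniqueness of the linear flow. -/
theorem inner_contToL2_primitive (ψ : TimeL2 T H) :
    0 ≤ inner ℝ ψ (contToL2 T H (primitive T H ψ)) := by
  have h := norm_sq_primitive ψ ⟨T, hT, le_rfl⟩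
  rw [Iic_top_eq_univ hT, Measure.restrict_univ] at h
  have h1 : inner ℝ ψ (contToL2 T H (primitive T H ψ)) =
      ∫ s, inner ℝ (ψ s) (primitive T H ψ s) ∂(timeMeasure T) := by
    rw [L2.inner_def]
    refine integral_congr_ae ?_
    filter_upwards [ContinuousMap.coeFn_toLp (p := 2) (𝕜 := ℝ) (timeMeasure T)
      (primitive T H ψ)] with s hs
    rw [hs]
  nlinarith [sq_nonneg ‖primitive T H ψ ⟨T, hT, le_rfl⟩‖]

include hG

omit [CompleteSpace H] hT in
theorem inner_compLp_comp_self (ψ : TimeL2 T H) :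
    inner ℝ ψ ((G ∘L G).compLp ψ) = ‖G.compLp ψ‖ ^ 2 := by
  rw [L2.inner_def, Lp_two_norm_sq]
  refine integral_congr_ae ?_
  filter_upwards [G.coeFn_compLp ψ, (G ∘L G).coeFn_compLp ψ] with s h1 h2
  rw [h1, h2, ← real_inner_self_eq_norm_sq]
  exact (hG _ _).symm

variable (hinj : Function.Injective G)
include hinj

omit hT hG in
omit [CompleteSpace H] in
theorem eq_zero_of_compLp_eq_zero {ψ : TimeL2 T H} (h : G.compLp ψ = 0) : ψ = 0 := by
  rw [Lp.ext_iff] at h ⊢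
  filter_upwards [h, G.coeFn_compLp ψ, Lp.coeFn_zero H 2 (timeMeasure T)] with s h1 h2 h3
  rw [h3, Pi.zero_apply] at h1 ⊢
  rw [h2] at h1
  exact hinj (by rw [h1, map_zero])

/-- Let (z₁, z₂) be orthogonal to all data. The choice a = 0, g = z₂ gives (z₂, ∫z₂) + ‖G z₂‖² = 0
with both terms nonnegative, hence z₂ = 0. The choice a = G z₁, g = 0 then gives |G z₁|² = 0.
Orthogonality is taken in the ℓ² product, since the product norm on pairs is the maximum. -/
theorem denseRange_smoothData : DenseRange (smoothData T G) := by
  let e := WithLp.prodContinuousLinearEquiv 2 ℝ H (TimeL2 T H)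
  let D : H × TimeL2 T H →L[ℝ] WithLp 2 (H × TimeL2 T H) := e.symm ∘L smoothData T G
  have hD : DenseRange D := by
    have h1 : (LinearMap.range D.toLinearMap).topologicalClosure = ⊤ := by
      rw [Submodule.topologicalClosure_eq_top_iff, Submodule.eq_bot_iff]
      intro z hz
      have hz' : ∀ p, inner ℝ (smoothData T G p).1 z.ofLp.1 +
          inner ℝ (smoothData T G p).2 z.ofLp.2 = 0 := by
        intro p
        have h2 := hz (D p) ⟨p, rfl⟩
        rwa [WithLp.prod_inner_apply] at h2
      have h2 : z.ofLp.2 = 0 := by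
        have h3 := hz' (0, z.ofLp.2)
        have h4 : (smoothData T G (0, z.ofLp.2)).1 = 0 := map_zero G
        have h5 : (smoothData T G (0, z.ofLp.2)).2 =
            contToL2 T H (primitive T H z.ofLp.2) + (G ∘L G).compLp z.ofLp.2 := by
          change contToL2 T H (curve T H (0, z.ofLp.2)) + _ = _
          congr 2
          ext t
          rw [curve_apply, zero_add]
        rw [h4, h5, inner_zero_left, zero_add, real_inner_comm, inner_add_right,
          inner_compLp_comp_self hG] at h3
        have h6 := inner_contToL2_primitive hT z.ofLp.2
        refine eq_zero_of_compLp_eq_zero hinj (norm_eq_zero.1 (pow_eq_zero_iff two_ne_zero |>.1 ?_))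
        nlinarith [sq_nonneg ‖G.compLp z.ofLp.2‖]
      have h3 : z.ofLp.1 = 0 := by
        have h4 := hz' (G z.ofLp.1, 0)
        rw [h2, inner_zero_right, add_zero] at h4
        change inner ℝ (G (G z.ofLp.1)) z.ofLp.1 = 0 at h4
        rw [hG, inner_self_eq_zero] at h4
        exact hinj (h4.trans (map_zero G).symm)
      exact WithLp.ofLp_injective 2 (Prod.ext h3 h2)
    exact (Submodule.dense_iff_topologicalClosure_eq_top.2 h1 :)
  have h2 : (smoothData T G : H × TimeL2 T H → H × TimeL2 T H) = e ∘ D := by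
    ext1 p
    exact (e.apply_symm_apply _).symm
  rw [h2]
  exact e.surjective.denseRange.comp hD e.continuous

/-- The a priori bound makes `smoothFlow` factor through `smoothData`; with density it is exactly
what the continuous extension needs. -/
theorem linearFlow_smoothData (p : H × TimeL2 T H) :
    linearFlow T G (smoothData T G p) = smoothFlow T G p :=
  LinearMap.extendOfNorm_eq (denseRange_smoothData hT hG hinj)
    ⟨2, fun p => smoothFlow_norm_le hT p hG⟩ p

theorem norm_linearFlow_le (d : H × TimeL2 T H) : ‖linearFlow T G d‖ ≤ 2 * ‖d‖ :=
  LinearMap.norm_extendOfNorm_apply_le (denseRange_smoothData hT hG hinj) 2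
    (fun p => smoothFlow_norm_le hT p hG) d

/-- As for the equation and the energy equality below, both sides are continuous in the data and
agree on the dense set of smooth data. -/
theorem linearFlow_ae (d : H × TimeL2 T H) :
    ∀ᵐ s ∂(timeMeasure T), G ((linearFlow T G d).2 s) = (linearFlow T G d).1 s := by
  have h : contToL2 T H (linearFlow T G d).1 = G.compLpL 2 (timeMeasure T) (linearFlow T G d).2 := by
    refine (denseRange_smoothData hT hG hinj).induction_on
      (p := fun d => contToL2 T H (linearFlow T G d).1 =
        G.compLpL 2 (timeMeasure T) (linearFlow T G d).2) d
      (isClosed_eq (by fun_prop) (by fun_prop)) fun p => ?_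
    rw [linearFlow_smoothData hT hG hinj]
    exact smoothFlow_ae p
  rw [Lp.ext_iff] at h
  filter_upwards [h, ContinuousMap.coeFn_toLp (p := 2) (𝕜 := ℝ) (timeMeasure T)
    (linearFlow T G d).1, G.coeFn_compLp (linearFlow T G d).2] with s h1 h2 h3
  rw [← h2, h1]
  exact h3.symm

theorem linearFlow_equation (d : H × TimeL2 T H) (t : Icc (0 : ℝ) T) :
    G ((linearFlow T G d).1 t) = G d.1 + primitive T H (d.2 - (linearFlow T G d).2) t := by
  refine (denseRange_smoothData hT hG hinj).induction_on
      (p := fun d => G ((linearFlow T G d).1 t) =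
        G d.1 + primitive T H (d.2 - (linearFlow T G d).2) t) d
      (isClosed_eq ?_ ?_) fun p => ?_
  · exact G.continuous.comp ((ContinuousMap.evalCLM ℝ t).continuous.comp
      (linearFlow T G).continuous.fst)
  · exact (by fun_prop : Continuous fun d : H × TimeL2 T H => G d.1).add
      ((ContinuousMap.evalCLM ℝ t).continuous.comp ((primitive T H).continuous.comp
        (continuous_snd.sub (linearFlow T G).continuous.snd)))
  · rw [linearFlow_smoothData hT hG hinj]
    exact smoothFlow_equation p t

theorem linearFlow_energy_inner (d : H × TimeL2 T H) (t : Icc (0 : ℝ) T) :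
    ‖(linearFlow T G d).1 t‖ ^ 2 = ‖d.1‖ ^ 2 +
      2 * inner ℝ (cutoff H t
        (d.2 - (linearFlow T G d).2)) (linearFlow T G d).2 := by
  refine (denseRange_smoothData hT hG hinj).induction_on
      (p := fun d => ‖(linearFlow T G d).1 t‖ ^ 2 = ‖d.1‖ ^ 2 +
      2 * inner ℝ (cutoff H t
        (d.2 - (linearFlow T G d).2)) (linearFlow T G d).2) d
      (isClosed_eq ?_ ?_) fun p => ?_
  · exact ((ContinuousMap.evalCLM ℝ t).continuous.comp (linearFlow T G).continuous.fst).norm.pow 2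
  · fun_prop
  · rw [linearFlow_smoothData hT hG hinj]
    exact smoothFlow_energy hG p t

/-- The energy equality. -/
theorem linearFlow_energy (d : H × TimeL2 T H) (t : Icc (0 : ℝ) T) :
    ‖(linearFlow T G d).1 t‖ ^ 2 + 2 * ∫ s in Iic t, ‖(linearFlow T G d).2 s‖ ^ 2 ∂(timeMeasure T) =
      ‖d.1‖ ^ 2 + 2 * ∫ s in Iic t, inner ℝ (d.2 s) ((linearFlow T G d).2 s) ∂(timeMeasure T) := by
  rw [linearFlow_energy_inner hT hG hinj d t, map_sub, inner_sub_left, indicatorL2_inner,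
    indicatorL2_inner]
  simp only [real_inner_self_eq_norm_sq]
  ring

/-- The difference ζ of the two w's satisfies G² ζ = -∫ζ. Pairing with ζ gives ‖G ζ‖² = -(ζ, ∫ζ) ≤
0, so ζ = 0; injectivity of G then identifies the continuous parts. -/
theorem linearFlow_unique {ξ : H} {φ : TimeL2 T H} {u : TimeC T H} {w : TimeL2 T H}
    (hae : ∀ᵐ s ∂(timeMeasure T), G (w s) = u s)
    (heq : ∀ t, G (u t) = G ξ + primitive T H (φ - w) t) : linearFlow T G (ξ, φ) = (u, w) := by
  set x := linearFlow T G (ξ, φ)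
  have hz : ∀ t, G (x.1 t - u t) = - primitive T H (x.2 - w) t := by
    intro t
    rw [map_sub, linearFlow_equation hT hG hinj (ξ, φ) t, heq t]
    simp only [map_sub, ContinuousMap.sub_apply]
    abel
  have h0 : x.2 - w = 0 := by
    have h1 : (G ∘L G).compLp (x.2 - w) = - contToL2 T H (primitive T H (x.2 - w)) := by
      rw [Lp.ext_iff]
      filter_upwards [(G ∘L G).coeFn_compLp (x.2 - w), Lp.coeFn_sub x.2 w,
        Lp.coeFn_neg (contToL2 T H (primitive T H (x.2 - w))), hae,
        linearFlow_ae hT hG hinj (ξ, φ), ContinuousMap.coeFn_toLp (p := 2) (𝕜 := ℝ)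
        (timeMeasure T) (primitive T H (x.2 - w))] with s h1 h2 h3 h4 h5 h6
      rw [h1, h3, Pi.neg_apply, h6, ← hz, h2, ContinuousLinearMap.comp_apply, Pi.sub_apply, map_sub,
        h4, h5]
    have h2 := inner_compLp_comp_self hG (x.2 - w)
    rw [h1, inner_neg_right] at h2
    have h3 := inner_contToL2_primitive hT (x.2 - w)
    refine eq_zero_of_compLp_eq_zero hinj (norm_eq_zero.1 (pow_eq_zero_iff two_ne_zero |>.1 ?_))
    nlinarith [sq_nonneg ‖G.compLp (x.2 - w)‖]
  refine Prod.ext ?_ (sub_eq_zero.1 h0)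
  ext t
  have h1 := hz t
  rw [h0, map_zero, ContinuousMap.zero_apply, neg_zero] at h1
  exact sub_eq_zero.1 (hinj (h1.trans (map_zero G).symm))

/-- For a forcing in `H`, the solution is controlled by the `L¹` norm of the forcing. -/
theorem norm_linearFlow_zero_compLp_le (f : TimeL2 T H) :
    ‖linearFlow T G (0, G.compLp f)‖ ≤ 2 * ∫ s, ‖f s‖ ∂(timeMeasure T) := by
  set x := linearFlow T G (0, G.compLp f)
  set F := ∫ s, ‖f s‖ ∂(timeMeasure T)
  have hF : 0 ≤ F := integral_nonneg fun s => norm_nonneg _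
  have key : ∀ t : Icc (0 : ℝ) T, ‖x.1 t‖ ^ 2 + 2 * ∫ s in Iic t, ‖x.2 s‖ ^ 2 ∂(timeMeasure T) ≤
      2 * (‖x.1‖ * F) := by
    intro t
    have h := linearFlow_energy hT hG hinj (0, G.compLp f) t
    simp only [norm_zero, ne_eq, OfNat.ofNat_ne_zero, not_false_eq_true, zero_pow, zero_add] at h
    rw [h]
    gcongr
    -- Symmetry turns (G f, w) into (f, u), and u is bounded uniformly in time whereas w is only
    -- square integrable. This is why the L¹ norm of f suffices.
    have h1 : ∫ s in Iic t, inner ℝ ((G.compLp f) s) (x.2 s) ∂(timeMeasure T) =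
        ∫ s in Iic t, inner ℝ (f s) (x.1 s) ∂(timeMeasure T) := by
      refine integral_congr_ae (ae_restrict_of_ae ?_)
      filter_upwards [G.coeFn_compLp f, linearFlow_ae hT hG hinj (0, G.compLp f)] with s h2 h3
      rw [h2, hG, h3]
    rw [h1]
    have h4 : Integrable (fun s => ‖f s‖ * ‖x.1‖) (timeMeasure T) :=
      (Lp_two_integrable f).norm.mul_const _
    calc ∫ s in Iic t, inner ℝ (f s) (x.1 s) ∂(timeMeasure T)
        ≤ ∫ s in Iic t, ‖f s‖ * ‖x.1‖ ∂(timeMeasure T) := by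
          refine (Real.le_norm_self _).trans (norm_integral_le_of_norm_le h4.integrableOn
            (ae_of_all _ fun s => (norm_inner_le_norm _ _).trans ?_))
          gcongr
          exact ContinuousMap.norm_coe_le_norm _ _
      _ ≤ ∫ s, ‖f s‖ * ‖x.1‖ ∂(timeMeasure T) :=
          setIntegral_le_integral h4 (ae_of_all _ fun s => by positivity)
      _ = ‖x.1‖ * F := by rw [integral_mul_const, mul_comm]
  have h1 : ‖x.1‖ ≤ 2 * F := by
    have h2 : ‖x.1‖ ≤ √(2 * (‖x.1‖ * F)) := by
      rw [ContinuousMap.norm_le _ (Real.sqrt_nonneg _)]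
      intro t
      refine Real.le_sqrt_of_sq_le ((le_add_of_nonneg_right ?_).trans (key t))
      exact mul_nonneg two_pos.le (integral_nonneg fun s => by positivity)
    have h3 := Real.sq_sqrt (by positivity : 0 ≤ 2 * (‖x.1‖ * F))
    by_contra! hc
    nlinarith [norm_nonneg x.1]
  refine norm_prod_le_iff.2 ⟨h1, ?_⟩
  have h2 := key ⟨T, hT, le_rfl⟩
  rw [Iic_top_eq_univ hT, Measure.restrict_univ, ← Lp_two_norm_sq] at h2
  refine le_of_abs_le (abs_le_of_sq_le_sq ?_ (by positivity))
  nlinarith [sq_nonneg ‖x.1 ⟨T, hT, le_rfl⟩‖]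

/-- The solution up to time `τ` depends only on the forcing up to time `τ`. -/
theorem linearFlow_causal {ξ : H} {φ ψ : TimeL2 T H} {τ : Icc (0 : ℝ) T}
    (h : ∀ᵐ s ∂(timeMeasure T), s ≤ τ → φ s = ψ s) :
    ∀ᵐ s ∂(timeMeasure T), s ≤ τ → (linearFlow T G (ξ, φ)).2 s = (linearFlow T G (ξ, ψ)).2 s := by
  have h1 : linearFlow T G (ξ, φ) - linearFlow T G (ξ, ψ) = linearFlow T G (0, φ - ψ) := by
    rw [← map_sub, Prod.mk_sub_mk, sub_self]
  -- The energy equality at τ for the difference has no forcing term, so both nonnegative terms on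
  -- its left vanish.
  have h2 := linearFlow_energy hT hG hinj (0, φ - ψ) τ
  have h3 : ∫ s in Iic τ, inner ℝ ((φ - ψ) s) ((linearFlow T G (0, φ - ψ)).2 s) ∂(timeMeasure T) =
      0 := by
    refine integral_eq_zero_of_ae ?_
    rw [Filter.EventuallyEq, ae_restrict_iff' measurableSet_Iic]
    filter_upwards [h, Lp.coeFn_sub φ ψ] with s hs h4 hsτ
    rw [h4, Pi.sub_apply, hs hsτ, sub_self, inner_zero_left, Pi.zero_apply]
  rw [h3, ← norm_indicatorL2_sq measurableSet_Iic] at h2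
  have h4 : ‖cutoff H τ
      (linearFlow T G (0, φ - ψ)).2‖ = 0 := by
    refine pow_eq_zero_iff two_ne_zero |>.1 ?_
    simp only [norm_zero, ne_eq, OfNat.ofNat_ne_zero, not_false_eq_true, zero_pow] at h2
    nlinarith [sq_nonneg ‖(linearFlow T G (0, φ - ψ)).1 τ‖, sq_nonneg ‖cutoff H τ (linearFlow T G (0, φ - ψ)).2‖]
  rw [norm_eq_zero, ← h1, Prod.snd_sub, map_sub, sub_eq_zero, indicatorL2_ext_iff] at h4
  exact h4

end LinearFlow

/-! ### Energy estimates for the nonlinear equation -/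

/-- `G` plays the role of `A^{-1/2}`, and `b` that of the bilinear map `B`, transported to `H` by
`A^{1/2}`. -/
structure IsConvection {H : Type*} [NormedAddCommGroup H] [InnerProductSpace ℝ H]
    (G : H →L[ℝ] H) (b : H →L[ℝ] H →L[ℝ] H) (c : ℝ) : Prop where
  symm : ∀ x y, inner ℝ (G x) y = inner ℝ x (G y)
  inj : Function.Injective G
  nonneg : 0 ≤ c
  antisymm : ∀ x y z, inner ℝ (b x y) z = -inner ℝ (b x z) y
  bound : ∀ x y, ‖b x y‖ ^ 2 ≤ c * (‖G x‖ * ‖x‖ * (‖G y‖ * ‖y‖))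

/-- A measurable forcing which is Lipschitz in `G w`, with square integrable constants. -/
structure IsForcing {T : ℝ} {H : Type*} [NormedAddCommGroup H] [InnerProductSpace ℝ H]
    (G : H →L[ℝ] H) (f : Icc (0 : ℝ) T → H → H) (ℓ m : Icc (0 : ℝ) T → ℝ) : Prop where
  meas : ∀ w : Icc (0 : ℝ) T → H, AEStronglyMeasurable w (timeMeasure T) →
    AEStronglyMeasurable (fun s => f s (w s)) (timeMeasure T)
  lip : ∀ s x y, ‖f s x - f s y‖ ≤ ℓ s * ‖G (x - y)‖
  zero_le : ∀ s, ‖f s 0‖ ≤ m s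
  lip_nonneg : ∀ s, 0 ≤ ℓ s
  lip_memLp : MemLp ℓ 2 (timeMeasure T)
  zero_memLp : MemLp m 2 (timeMeasure T)

section EnergyEstimates

variable {T : ℝ} {H : Type*} [NormedAddCommGroup H] [InnerProductSpace ℝ H]
  {G : H →L[ℝ] H} {b : H →L[ℝ] H →L[ℝ] H} {c : ℝ} {f : Icc (0 : ℝ) T → H → H}
  {ℓ m : Icc (0 : ℝ) T → ℝ}

theorem IsConvection.inner_self (hC : IsConvection G b c) (x y : H) : inner ℝ (b x y) y = 0 := by
  have := hC.antisymm x y y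
  linarith

theorem IsForcing.norm_le (hf : IsForcing G f ℓ m) (s : Icc (0 : ℝ) T) (x : H) :
    ‖f s x‖ ≤ m s + ℓ s * ‖G x‖ := by
  have h1 := hf.lip s x 0
  rw [sub_zero] at h1
  have h2 := norm_add_le (f s x - f s 0) (f s 0)
  rw [sub_add_cancel] at h2
  linarith [hf.zero_le s]

theorem IsForcing.zero_nonneg (hf : IsForcing G f ℓ m) (s : Icc (0 : ℝ) T) : 0 ≤ m s :=
  (norm_nonneg _).trans (hf.zero_le s)

theorem IsForcing.memLp (hf : IsForcing G f ℓ m) {w : TimeL2 T H} {u : TimeC T H}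
    (hw : ∀ᵐ s ∂(timeMeasure T), G (w s) = u s) :
    MemLp (fun s => f s (w s)) 2 (timeMeasure T) := by
  refine (hf.zero_memLp.add (hf.lip_memLp.const_mul ‖u‖)).mono'
    (hf.meas w (Lp.aestronglyMeasurable w)) ?_
  filter_upwards [hw] with s hs
  refine (hf.norm_le s _).trans ?_
  rw [hs, Pi.add_apply, mul_comm ‖u‖]
  have := mul_le_mul_of_nonneg_left (u.norm_coe_le_norm s) (hf.lip_nonneg s)
  linarith

theorem IsConvection.norm_sq_le (hC : IsConvection G b c) {u v : TimeC T H} {w z : H}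
    {s : Icc (0 : ℝ) T} (hw : G w = u s) (hz : G z = v s) :
    ‖b w z‖ ^ 2 ≤ c * ‖u‖ * ‖v‖ * (‖w‖ * ‖z‖) := by
  have hc := hC.nonneg
  calc _ ≤ _ := hC.bound w z
    _ ≤ c * (‖u‖ * ‖w‖ * (‖v‖ * ‖z‖)) := by
      rw [hw, hz]
      gcongr <;> exact ContinuousMap.norm_coe_le_norm _ _
    _ = _ := by ring

theorem IsConvection.memLp (hC : IsConvection G b c) {w : TimeL2 T H} {u : TimeC T H}
    (hw : ∀ᵐ s ∂(timeMeasure T), G (w s) = u s) :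
    MemLp (fun s => b (w s) (w s)) 2 (timeMeasure T) := by
  have hb : AEStronglyMeasurable (fun s => b (w s) (w s)) (timeMeasure T) :=
    (by fun_prop : Continuous fun x : H => b x x).comp_aestronglyMeasurable
      (Lp.aestronglyMeasurable w)
  refine ((Lp.memLp w).norm.const_mul (√c * ‖u‖)).mono' hb ?_
  filter_upwards [hw] with s hs
  have hc := hC.nonneg
  refine le_of_abs_le (abs_le_of_sq_le_sq ((hC.norm_sq_le hs hs).trans_eq ?_) (by positivity))
  rw [mul_pow, mul_pow, Real.sq_sqrt hc]
  ring

/-- The right-hand side `G f(w) - b(w, w)` of the equation. -/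
def rhs (G : H →L[ℝ] H) (b : H →L[ℝ] H →L[ℝ] H) (f : Icc (0 : ℝ) T → H → H)
    (w : Icc (0 : ℝ) T → H) (s : Icc (0 : ℝ) T) : H :=
  G (f s (w s)) - b (w s) (w s)

theorem memLp_rhs (hC : IsConvection G b c) (hf : IsForcing G f ℓ m) {w : TimeL2 T H}
    {u : TimeC T H} (hw : ∀ᵐ s ∂(timeMeasure T), G (w s) = u s) :
    MemLp (rhs G b f w) 2 (timeMeasure T) :=
  (G.comp_memLp' (hf.memLp hw)).sub (hC.memLp hw)

variable [CompleteSpace H]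

/-- The hypothesis lets the dissipation 2∫‖w‖² absorb one ∫‖w‖², and Gronwall's inequality with
kernel k bounds |u|² by D e^{2Λ}. Inserting this bound back into the energy inequality controls
∫‖w‖², at the cost of the factor 1 + Λ. -/
theorem norm_sq_linearFlow_le (hT : 0 ≤ T) (hG : ∀ x y, inner ℝ (G x) y = inner ℝ x (G y))
    (hinj : Function.Injective G) {ξ : H} {φ : TimeL2 T H} {k e : Icc (0 : ℝ) T → ℝ} {D Λ : ℝ}
    (hk : Integrable k (timeMeasure T)) (hk0 : ∀ s, 0 ≤ k s)
    (he : Integrable e (timeMeasure T)) (he0 : ∀ s, 0 ≤ e s)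
    (hD : ‖ξ‖ ^ 2 + ∫ s, e s ∂(timeMeasure T) ≤ D) (hΛ : ∫ s, k s ∂(timeMeasure T) ≤ Λ)
    (h : ∀ᵐ s ∂(timeMeasure T), 2 * inner ℝ (φ s) ((linearFlow T G (ξ, φ)).2 s) ≤
      ‖(linearFlow T G (ξ, φ)).2 s‖ ^ 2 + k s * ‖(linearFlow T G (ξ, φ)).1 s‖ ^ 2 + e s) :
    ‖linearFlow T G (ξ, φ)‖ ^ 2 ≤ D * Real.exp (2 * Λ) * (1 + Λ) := by
  set x := linearFlow T G (ξ, φ)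
  have hΛ0 : 0 ≤ Λ := (integral_nonneg hk0).trans hΛ
  have hD0 : 0 ≤ D := (add_nonneg (sq_nonneg _) (integral_nonneg he0)).trans hD
  have hku : Integrable (fun s => k s * ‖x.1 s‖ ^ 2) (timeMeasure T) :=
    hk.mul_bdd (c := ‖x.1‖ ^ 2) (by fun_prop) (ae_of_all _ fun s => by
      rw [Real.norm_of_nonneg (by positivity)]
      gcongr
      exact ContinuousMap.norm_coe_le_norm _ _)
  have key : ∀ t : Icc (0 : ℝ) T, ‖x.1 t‖ ^ 2 + ∫ s in Iic t, ‖x.2 s‖ ^ 2 ∂(timeMeasure T) ≤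
      D + ∫ s in Iic t, k s * ‖x.1 s‖ ^ 2 ∂(timeMeasure T) := by
    intro t
    have h1 := linearFlow_energy hT hG hinj (ξ, φ) t
    have h2 : Integrable (fun s => inner ℝ (φ s) (x.2 s)) (timeMeasure T) :=
      L2.integrable_inner φ x.2
    have h3 : 2 * ∫ s in Iic t, inner ℝ (φ s) (x.2 s) ∂(timeMeasure T) ≤
        ∫ s in Iic t, ‖x.2 s‖ ^ 2 ∂(timeMeasure T) +
          ∫ s in Iic t, k s * ‖x.1 s‖ ^ 2 ∂(timeMeasure T) + ∫ s, e s ∂(timeMeasure T) := by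
      have h4 : ∫ s in Iic t, e s ∂(timeMeasure T) ≤ ∫ s, e s ∂(timeMeasure T) :=
        setIntegral_le_integral he (ae_of_all _ he0)
      have h5 : ∫ s in Iic t, 2 * inner ℝ (φ s) (x.2 s) ∂(timeMeasure T) ≤
          ∫ s in Iic t, (‖x.2 s‖ ^ 2 + k s * ‖x.1 s‖ ^ 2 + e s) ∂(timeMeasure T) :=
        integral_mono_ae (h2.const_mul 2).integrableOn
          (((integrable_norm_sq x.2).add hku).add he).integrableOn (ae_restrict_of_ae h)
      have h6 : Integrable (fun s => ‖x.2 s‖ ^ 2 + k s * ‖x.1 s‖ ^ 2) (timeMeasure T) :=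
        (integrable_norm_sq x.2).add hku
      rw [integral_add h6.integrableOn he.integrableOn,
        integral_add (integrable_norm_sq x.2).integrableOn hku.integrableOn,
        integral_const_mul] at h5
      linarith
    change ‖x.1 t‖ ^ 2 + 2 * ∫ s in Iic t, ‖x.2 s‖ ^ 2 ∂(timeMeasure T) =
      ‖ξ‖ ^ 2 + 2 * ∫ s in Iic t, inner ℝ (φ s) (x.2 s) ∂(timeMeasure T) at h1
    linarith
  have hu : ∀ t, ‖x.1 t‖ ^ 2 ≤ D * Real.exp (2 * Λ) := by
    intro t
    refine (le_mul_exp_of_le_add_setIntegral hT (f := fun t => ‖x.1 t‖ ^ 2) (by fun_prop)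
      (fun s => sq_nonneg _) hk hk0 hD0 (fun t => ?_) t).trans (by gcongr)
    exact (le_add_of_nonneg_right (integral_nonneg fun s => sq_nonneg _)).trans (key t)
  have hexp : 1 ≤ Real.exp (2 * Λ) := Real.one_le_exp (by positivity)
  have h1 : ‖x.1‖ ≤ √(D * Real.exp (2 * Λ) * (1 + Λ)) := by
    rw [ContinuousMap.norm_le _ (Real.sqrt_nonneg _)]
    refine fun t => Real.le_sqrt_of_sq_le ((hu t).trans ?_)
    exact le_mul_of_one_le_right (by positivity) (by linarith)
  have h2 : ‖x.2‖ ≤ √(D * Real.exp (2 * Λ) * (1 + Λ)) := by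
    refine Real.le_sqrt_of_sq_le ?_
    have h3 := key ⟨T, hT, le_rfl⟩
    rw [Iic_top_eq_univ hT, Measure.restrict_univ, ← Lp_two_norm_sq] at h3
    have h4 : ∫ s, k s * ‖x.1 s‖ ^ 2 ∂(timeMeasure T) ≤ Λ * (D * Real.exp (2 * Λ)) := by
      calc _ ≤ ∫ s, k s * (D * Real.exp (2 * Λ)) ∂(timeMeasure T) :=
            integral_mono hku (hk.mul_const _) fun s =>
              mul_le_mul_of_nonneg_left (hu s) (hk0 s)
        _ = (∫ s, k s ∂(timeMeasure T)) * (D * Real.exp (2 * Λ)) := integral_mul_const _ _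
        _ ≤ _ := by gcongr
    have h5 : D ≤ D * Real.exp (2 * Λ) := le_mul_of_one_le_right hD0 hexp
    nlinarith [sq_nonneg ‖x.1 ⟨T, hT, le_rfl⟩‖]
  calc ‖x‖ ^ 2 ≤ √(D * Real.exp (2 * Λ) * (1 + Λ)) ^ 2 := by
        gcongr
        exact norm_prod_le_iff.2 ⟨h1, h2⟩
    _ = _ := Real.sq_sqrt (by positivity)

/-- A priori bound for the equation whose right-hand side is switched on in `A`. -/
theorem norm_sq_le_of_rhs (hT : 0 ≤ T) (hC : IsConvection G b c) (hf : IsForcing G f ℓ m)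
    {A : Set (Icc (0 : ℝ) T)} {ξ : H} {φ : TimeL2 T H} {D Λ : ℝ}
    (hφ : φ =ᵐ[timeMeasure T] A.indicator (rhs G b f (linearFlow T G (ξ, φ)).2))
    (hD : ‖ξ‖ ^ 2 + ∫ s, m s ^ 2 ∂(timeMeasure T) ≤ D)
    (hΛ : ∫ s, (1 + 2 * ℓ s) ∂(timeMeasure T) ≤ Λ) :
    ‖linearFlow T G (ξ, φ)‖ ^ 2 ≤ D * Real.exp (2 * Λ) * (1 + Λ) := by
  have hℓ : Integrable ℓ (timeMeasure T) := hf.lip_memLp.integrable one_le_two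
  refine norm_sq_linearFlow_le hT hC.symm hC.inj (k := fun s => 1 + 2 * ℓ s) (e := fun s => m s ^ 2)
    ((integrable_const _).add (hℓ.const_mul 2)) (fun s => by linarith [hf.lip_nonneg s])
    hf.zero_memLp.integrable_sq (fun s => sq_nonneg _) hD hΛ ?_
  filter_upwards [hφ, linearFlow_ae hT hC.symm hC.inj (ξ, φ)] with s h1 h2
  have hℓ0 := hf.lip_nonneg s
  have h4 := hf.norm_le s ((linearFlow T G (ξ, φ)).2 s)
  rw [h2] at h4
  rw [h1]
  have h0 : 0 ≤ ‖(linearFlow T G (ξ, φ)).2 s‖ ^ 2 +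
      (1 + 2 * ℓ s) * ‖(linearFlow T G (ξ, φ)).1 s‖ ^ 2 + m s ^ 2 := by positivity
  by_cases hs : s ∈ A
  -- Antisymmetry gives (b(w, w), w) = 0, and 2(f, u) ≤ 2(m + ℓ|u|)|u| ≤ m² + (1 + 2ℓ)|u|².
  · rw [indicator_of_mem hs, rhs, inner_sub_left, hC.inner_self, sub_zero, hC.symm, h2]
    have h3 := real_inner_le_norm (f s ((linearFlow T G (ξ, φ)).2 s)) ((linearFlow T G (ξ, φ)).1 s)
    have h5 := mul_le_mul_of_nonneg_right h4 (norm_nonneg ((linearFlow T G (ξ, φ)).1 s))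
    have h6 := sq_nonneg (m s - ‖(linearFlow T G (ξ, φ)).1 s‖)
    have h7 := sq_nonneg ‖(linearFlow T G (ξ, φ)).2 s‖
    linarith
  · rw [indicator_of_notMem hs, inner_zero_left, mul_zero]
    exact h0

omit [CompleteSpace H] in
-- The pointwise inequality behind stability. After expanding the increment of b around w, the term
-- b(w + y + r, r) is orthogonal to r; what remains is linear in r, with kernel depending on w + y,
-- or carries a factor y and counts as a source.
theorem IsConvection.two_mul_inner_le (hC : IsConvection G b c) {ℓ₀ ρ Y : ℝ} {w y r g : H}
    (hℓ : 0 ≤ ℓ₀) (hw : ‖G w‖ ≤ ρ) (hy : ‖G y‖ ≤ ρ) (hY : ‖G y‖ ≤ Y)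
    (hg : ‖g‖ ≤ ℓ₀ * ‖G (y + r)‖) :
    2 * inner ℝ (G g - (b (w + (y + r)) (w + (y + r)) - b w w)) r ≤ ‖r‖ ^ 2 +
      (64 * c ^ 2 * ρ ^ 2 * ‖w + y‖ ^ 2 + 3 * ℓ₀) * ‖G r‖ ^ 2 +
      (4 * c * Y * (‖y‖ * (2 * ρ * ‖w + y‖ + ρ * ‖w‖)) + ℓ₀ * Y ^ 2) := by
  have hc := hC.nonneg
  have hρ : 0 ≤ ρ := (norm_nonneg _).trans hw
  have hY0 : 0 ≤ Y := (norm_nonneg _).trans hY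
  have hGv : ‖G (w + y)‖ ≤ 2 * ρ := by
    rw [map_add]
    exact (norm_add_le _ _).trans (by linarith)
  have hsplit : inner ℝ (b (w + (y + r)) (w + (y + r)) - b w w) r =
      inner ℝ (b r (w + y)) r + inner ℝ (b y (w + y)) r + inner ℝ (b w y) r := by
    have h1 : b (w + (y + r)) (w + (y + r)) - b w w =
        b r (w + y) + b y (w + y) + b w y + b (w + y + r) r := by
      simp only [map_add, add_apply]
      abel
    rw [h1, inner_add_left, hC.inner_self, add_zero, inner_add_left, inner_add_left]
  -- Three uses of this Young inequality cost 3/4 ‖r‖², and the bound `hE1` costs the last quarter: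
  -- together exactly the ‖r‖² that the dissipation absorbs.
  have hin : ∀ p q : H, -(2 * inner ℝ (b p q) r) ≤
      ‖r‖ ^ 2 / 4 + 4 * (c * (‖G p‖ * ‖p‖ * (‖G q‖ * ‖q‖))) := by
    intro p q
    have h1 := neg_le_of_abs_le (abs_real_inner_le_norm (b p q) r)
    nlinarith [hC.bound p q, sq_nonneg (‖r‖ / 2 - 2 * ‖b p q‖)]
  have hE1 : 4 * (c * (‖G r‖ * ‖r‖ * (‖G (w + y)‖ * ‖w + y‖))) ≤
      ‖r‖ ^ 2 / 4 + 64 * c ^ 2 * ρ ^ 2 * ‖w + y‖ ^ 2 * ‖G r‖ ^ 2 := by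
    have h1 : 4 * (c * (‖G r‖ * ‖r‖ * (‖G (w + y)‖ * ‖w + y‖))) ≤
        4 * (c * (‖G r‖ * ‖r‖ * (2 * ρ * ‖w + y‖))) := by gcongr
    nlinarith [sq_nonneg (‖r‖ / 2 - 8 * c * ρ * ‖w + y‖ * ‖G r‖)]
  have hE2 : 4 * (c * (‖G y‖ * ‖y‖ * (‖G (w + y)‖ * ‖w + y‖))) ≤
      4 * c * Y * (‖y‖ * (2 * ρ * ‖w + y‖)) := by
    calc _ ≤ 4 * (c * (Y * ‖y‖ * (2 * ρ * ‖w + y‖))) := by gcongr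
      _ = _ := by ring
  have hE3 : 4 * (c * (‖G w‖ * ‖w‖ * (‖G y‖ * ‖y‖))) ≤ 4 * c * Y * (‖y‖ * (ρ * ‖w‖)) := by
    calc _ ≤ 4 * (c * (ρ * ‖w‖ * (Y * ‖y‖))) := by gcongr
      _ = _ := by ring
  have hEg : 2 * inner ℝ g (G r) ≤ 3 * ℓ₀ * ‖G r‖ ^ 2 + ℓ₀ * Y ^ 2 := by
    have h1 := real_inner_le_norm g (G r)
    have h2 : ‖g‖ ≤ ℓ₀ * (Y + ‖G r‖) := by
      refine hg.trans (mul_le_mul_of_nonneg_left ?_ hℓ)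
      rw [map_add]
      exact (norm_add_le _ _).trans (by linarith)
    have h3 := mul_le_mul_of_nonneg_right h2 (norm_nonneg (G r))
    have h4 := mul_nonneg hℓ (sq_nonneg (Y - ‖G r‖))
    nlinarith
  rw [inner_sub_left, hC.symm, hsplit]
  have e1 := hin r (w + y)
  have e2 := hin y (w + y)
  have e3 := hin w y
  linarith

/-- Stability: the remainder `x₂ - x₁ - y` is controlled by the perturbation `y`. -/
theorem norm_sq_remainder_le (hT : 0 ≤ T) (hC : IsConvection G b c) {A : Set (Icc (0 : ℝ) T)}
    {ρ Λ : ℝ} {x₁ x₂ y : TimeC T H × TimeL2 T H} {ψ : TimeL2 T H} {g : Icc (0 : ℝ) T → H}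
    (hx₁ : ∀ᵐ s ∂(timeMeasure T), G (x₁.2 s) = x₁.1 s)
    (hy : ∀ᵐ s ∂(timeMeasure T), G (y.2 s) = y.1 s)
    (hℓ : Integrable ℓ (timeMeasure T)) (hℓ0 : ∀ s, 0 ≤ ℓ s)
    (hΛ : ∫ s, ℓ s ∂(timeMeasure T) ≤ Λ)
    (hr : x₂ = x₁ + (y + linearFlow T G (0, ψ)))
    (hψ : ∀ᵐ s ∂(timeMeasure T), s ∈ A → ψ s =
      G (g s) - (b (x₂.2 s) (x₂.2 s) - b (x₁.2 s) (x₁.2 s)))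
    (hψ0 : ∀ᵐ s ∂(timeMeasure T), s ∉ A → ψ s = 0)
    (hg : ∀ᵐ s ∂(timeMeasure T), ‖g s‖ ≤ ℓ s * ‖G (x₂.2 s - x₁.2 s)‖)
    (h₁ : ‖x₁‖ ≤ ρ) (h₂ : ‖y‖ ≤ ρ) :
    ‖linearFlow T G (0, ψ)‖ ^ 2 ≤ (20 * c * ρ ^ 2 + Λ) * ‖y‖ ^ 2 *
      Real.exp (2 * (256 * c ^ 2 * ρ ^ 4 + 3 * Λ)) * (1 + (256 * c ^ 2 * ρ ^ 4 + 3 * Λ)) := by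
  set μ := timeMeasure T
  have hc := hC.nonneg
  have hρ : 0 ≤ ρ := (norm_nonneg _).trans h₁
  set v : TimeL2 T H := x₁.2 + y.2
  have hx1 : ‖x₁.2‖ ≤ ρ := (norm_snd_le x₁).trans h₁
  have hy1 : ‖y.2‖ ≤ ‖y‖ := norm_snd_le y
  have hv : ‖v‖ ≤ 2 * ρ := (norm_add_le _ _).trans (by linarith)
  have hyv := (Lp.memLp y.2).integrable_norm_mul (Lp.memLp v)
  have hyx := (Lp.memLp y.2).integrable_norm_mul (Lp.memLp x₁.2)
  have hk : Integrable (fun s => 64 * c ^ 2 * ρ ^ 2 * ‖v s‖ ^ 2 + 3 * ℓ s) μ :=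
    ((integrable_norm_sq v).const_mul _).add (hℓ.const_mul 3)
  have heq : ∀ s, 4 * c * ‖y‖ * (‖y.2 s‖ * (2 * ρ * ‖v s‖ + ρ * ‖x₁.2 s‖)) + ℓ s * ‖y‖ ^ 2 =
      8 * c * ρ * ‖y‖ * (‖y.2 s‖ * ‖v s‖) + 4 * c * ρ * ‖y‖ * (‖y.2 s‖ * ‖x₁.2 s‖) +
        ‖y‖ ^ 2 * ℓ s := fun s => by ring
  have he1 := hyv.const_mul (8 * c * ρ * ‖y‖)
  have he2 := hyx.const_mul (4 * c * ρ * ‖y‖)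
  have he3 := hℓ.const_mul (‖y‖ ^ 2)
  -- The bound of `two_mul_inner_le` with Y = ‖y‖. Since ‖v‖ ≤ 2ρ in L², the kernel integrates to at
  -- most 64·4 c²ρ⁴ + 3Λ, and the source to at most (16 + 4) cρ²‖y‖² + Λ‖y‖².
  refine norm_sq_linearFlow_le hT hC.symm hC.inj
    (k := fun s => 64 * c ^ 2 * ρ ^ 2 * ‖v s‖ ^ 2 + 3 * ℓ s)
    (e := fun s => 4 * c * ‖y‖ * (‖y.2 s‖ * (2 * ρ * ‖v s‖ + ρ * ‖x₁.2 s‖)) + ℓ s * ‖y‖ ^ 2)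
    hk (fun s => ?_) ?_ (fun s => ?_) ?_ ?_ ?_
  · have := hℓ0 s
    positivity
  · simp only [heq]
    exact (he1.add he2).add he3
  · have := hℓ0 s
    positivity
  · simp only [heq]
    rw [integral_add (f := fun s => 8 * c * ρ * ‖y‖ * (‖y.2 s‖ * ‖v s‖) +
      4 * c * ρ * ‖y‖ * (‖y.2 s‖ * ‖x₁.2 s‖)) (he1.add he2) he3, integral_add he1 he2, integral_const_mul,
      integral_const_mul, integral_const_mul, norm_zero]
    have i1 := integral_norm_mul_le y.2 v
    have i2 := integral_norm_mul_le y.2 x₁.2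
    have j1 : ∫ s, ‖y.2 s‖ * ‖v s‖ ∂μ ≤ ‖y‖ * (2 * ρ) := i1.trans (by gcongr)
    have j2 : ∫ s, ‖y.2 s‖ * ‖x₁.2 s‖ ∂μ ≤ ‖y‖ * ρ := i2.trans (by gcongr)
    calc _ ≤ 0 ^ 2 + (8 * c * ρ * ‖y‖ * (‖y‖ * (2 * ρ)) + 4 * c * ρ * ‖y‖ * (‖y‖ * ρ) +
        ‖y‖ ^ 2 * Λ) := by gcongr
      _ = _ := by ring
  · rw [integral_add ((integrable_norm_sq v).const_mul _) (hℓ.const_mul 3), integral_const_mul,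
      integral_const_mul, ← Lp_two_norm_sq]
    calc _ ≤ 64 * c ^ 2 * ρ ^ 2 * (2 * ρ) ^ 2 + 3 * Λ := by gcongr
      _ = _ := by ring
  · have hr2 : x₂.2 = x₁.2 + (y.2 + (linearFlow T G (0, ψ)).2) := by rw [hr]; rfl
    filter_upwards [hx₁, hy, hψ, hψ0, hg, Lp.coeFn_add x₁.2 y.2,
      linearFlow_ae hT hC.symm hC.inj (0, ψ),
      Lp.coeFn_add x₁.2 (y.2 + (linearFlow T G (0, ψ)).2),
      Lp.coeFn_add y.2 (linearFlow T G (0, ψ)).2] with s a1 a2 a3 a4 a5 a6 a7 a8 a9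
    have hℓs := hℓ0 s
    by_cases hs : s ∈ A
    · have hx2s : x₂.2 s = x₁.2 s + (y.2 s + (linearFlow T G (0, ψ)).2 s) := by
        rw [hr2, a8, Pi.add_apply, a9, Pi.add_apply]
      rw [a3 hs, hx2s, ← a7, a6, Pi.add_apply]
      rw [hx2s, add_sub_cancel_left] at a5
      refine hC.two_mul_inner_le hℓs ?_ ?_ ?_ a5
      · rw [a1]
        exact (ContinuousMap.norm_coe_le_norm _ _).trans ((norm_fst_le x₁).trans h₁)
      · rw [a2]
        exact (ContinuousMap.norm_coe_le_norm _ _).trans ((norm_fst_le y).trans h₂)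
      · rw [a2]
        exact (ContinuousMap.norm_coe_le_norm _ _).trans (norm_fst_le y)
    · rw [a4 hs, inner_zero_left, mul_zero]
      positivity

end EnergyEstimates

/-! ### Fixed points of causal maps on `L²(0, T; E)` -/

section Causal

variable {T : ℝ} {E : Type*} [NormedAddCommGroup E] [NormedSpace ℝ E]

theorem cutoff_cutoff {σ τ : Icc (0 : ℝ) T} (h : σ ≤ τ) (f : TimeL2 T E) :
    cutoff E σ (cutoff E τ f) = cutoff E σ f := by
  rw [indicatorL2_ext_iff]
  filter_upwards [coeFn_indicatorL2 (measurableSet_Iic (a := τ)) f] with s hs hsσ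
  rw [hs, indicator_of_mem (mem_Iic.2 (le_trans (mem_Iic.1 hsσ) h))]

theorem cutoff_top (hT : 0 ≤ T) (f : TimeL2 T E) :
    cutoff E (⟨T, hT, le_rfl⟩ : Icc (0 : ℝ) T) f = f := by
  rw [Lp.ext_iff]
  filter_upwards [coeFn_indicatorL2 (measurableSet_Iic (a := (⟨T, hT, le_rfl⟩ : Icc (0 : ℝ) T))) f]
    with s hs
  rw [hs, Iic_top_eq_univ hT, indicator_univ]

theorem cutoff_zero (hT : 0 ≤ T) (f : TimeL2 T E) :
    cutoff E (⟨0, le_rfl, hT⟩ : Icc (0 : ℝ) T) f = 0 := by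
  rw [← map_zero (cutoff E (⟨0, le_rfl, hT⟩ : Icc (0 : ℝ) T)), indicatorL2_ext_iff]
  have h : ∀ᵐ s ∂(timeMeasure T), s ≠ (⟨0, le_rfl, hT⟩ : Icc (0 : ℝ) T) := by
    rw [ae_iff]
    simp only [ne_eq, not_not, ofPred_eq_eq_singleton, measure_singleton]
  filter_upwards [h] with s hs hs'
  exact absurd (Subtype.ext (le_antisymm hs' s.2.1)) hs

theorem cutoff_add_indicator_Ioc {σ τ : Icc (0 : ℝ) T} (h : σ ≤ τ) (f : TimeL2 T E) :
    cutoff E τ f =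
      cutoff E σ f + indicatorL2 E (timeMeasure T) (measurableSet_Ioc (a := σ) (b := τ)) f := by
  rw [Lp.ext_iff]
  filter_upwards [coeFn_indicatorL2 (measurableSet_Iic (a := σ)) f,
    coeFn_indicatorL2 (measurableSet_Iic (a := τ)) f,
    coeFn_indicatorL2 (measurableSet_Ioc (a := σ) (b := τ)) f,
    Lp.coeFn_add (cutoff E σ f)
      (indicatorL2 E (timeMeasure T) (measurableSet_Ioc (a := σ) (b := τ)) f)] with s h1 h2 h3 h4
  rw [h4, Pi.add_apply, h1, h2, h3, ← Iic_union_Ioc_eq_Iic h,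
    indicator_union_of_disjoint (Iic_disjoint_Ioc le_rfl)]

theorem norm_sq_sub_cutoff (τ : Icc (0 : ℝ) T) (f : TimeL2 T E) :
    ‖f - cutoff E τ f‖ ^ 2 = ‖f‖ ^ 2 - ‖cutoff E τ f‖ ^ 2 := by
  rw [norm_indicatorL2_sq, Lp_two_norm_sq, Lp_two_norm_sq, eq_sub_iff_add_eq,
    ← integral_add_compl measurableSet_Iic (integrable_norm_sq f), add_comm, add_right_inj,
    ← integral_indicator measurableSet_Iic.compl]
  refine integral_congr_ae ?_
  filter_upwards [Lp.coeFn_sub f (cutoff E τ f),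
    coeFn_indicatorL2 (measurableSet_Iic (a := τ)) f] with s h1 h2
  rw [h1, Pi.sub_apply, h2]
  by_cases hs : s ∈ Iic τ
  · rw [indicator_of_mem hs, indicator_of_notMem (fun h : s ∈ (Iic τ)ᶜ => h hs), sub_self,
      norm_zero, zero_pow two_ne_zero]
  · rw [indicator_of_notMem hs, indicator_of_mem (mem_compl hs), sub_zero]

/-- A continuation argument. Solutions up to time τ are encoded as φ = 1_{[0, τ]} N φ. Along times
increasing to the supremum of those reached, they are restrictions of one another and bounded, hence
converge. The contraction near the limit holds on intervals of a length independent of the starting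
time, so a solution started close enough to the supremum would pass beyond it unless T is reached.
-/
theorem exists_fixedPoint_of_causal [CompleteSpace E] (hT : 0 ≤ T) {N : TimeL2 T E → TimeL2 T E}
    (causal : ∀ τ φ ψ, cutoff E τ φ = cutoff E τ ψ → cutoff E τ (N φ) = cutoff E τ (N ψ))
    (contr : ∀ φ₀, ∃ ε > 0, ∃ δ > 0, ∀ (A : Set (Icc (0 : ℝ) T)) (hA : MeasurableSet A),
      timeMeasure T A ≤ ENNReal.ofReal δ → ∀ φ ψ, ‖φ - φ₀‖ ≤ ε → ‖ψ - φ₀‖ ≤ ε →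
      ‖indicatorL2 E (timeMeasure T) hA (N φ - N ψ)‖ ≤ 1 / 2 * ‖φ - ψ‖)
    (bdd : ∃ C, ∀ τ φ, φ = cutoff E τ (N φ) → ‖φ‖ ≤ C)
    (uniq : ∀ τ φ ψ, φ = cutoff E τ (N φ) → ψ = cutoff E τ (N ψ) → φ = ψ) :
    ∃ φ, φ = N φ := by
  let S : Set ℝ := {t | ∃ ht : t ∈ Icc 0 T, ∃ φ, φ = cutoff E ⟨t, ht⟩ (N φ)}
  have hS0 : S.Nonempty := ⟨0, ⟨le_rfl, hT⟩, 0, (cutoff_zero hT _).symm⟩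
  have hSb : BddAbove S := ⟨T, fun t ht => ht.1.2⟩
  obtain ⟨C, hC⟩ := bdd
  obtain ⟨t, ht_mono, ht_lim, htS⟩ := exists_seq_tendsto_sSup hS0 hSb
  choose ht φ hφ using htS
  let τ : ℕ → Icc (0 : ℝ) T := fun n => ⟨t n, ht n⟩
  have hτ : Monotone τ := ht_mono
  -- Uniqueness makes the later solution restrict to the earlier one.
  have hrestrict : ∀ n k, n ≤ k → φ n = cutoff E (τ n) (φ k) := by
    intro n k hnk
    refine uniq (τ n) _ _ (hφ n) ?_
    rw [causal (τ n) _ (φ k) (cutoff_cutoff le_rfl _)]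
    nth_rewrite 1 [hφ k]
    exact cutoff_cutoff (hτ hnk) _
  have hdist : ∀ n k, n ≤ k → ‖φ k - φ n‖ ^ 2 = ‖φ k‖ ^ 2 - ‖φ n‖ ^ 2 := by
    intro n k hnk
    rw [hrestrict n k hnk]
    exact norm_sq_sub_cutoff _ _
  have hmono : Monotone fun n => ‖φ n‖ ^ 2 := fun n k hnk => by
    nlinarith [hdist n k hnk, sq_nonneg ‖φ k - φ n‖]
  -- By disjointness of supports the squared distance equals the increment of ‖φ‖², a bounded
  -- monotone sequence.
  have hcauchy : CauchySeq φ := by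
    have h1 : CauchySeq fun n => ‖φ n‖ ^ 2 := by
      refine (tendsto_atTop_ciSup hmono ⟨C ^ 2, ?_⟩).cauchySeq
      rintro _ ⟨n, rfl⟩
      exact pow_le_pow_left₀ (norm_nonneg _) (hC _ _ (hφ n)) 2
    rw [Metric.cauchySeq_iff'] at h1 ⊢
    intro ε hε
    obtain ⟨n, hn⟩ := h1 (ε ^ 2) (by positivity)
    refine ⟨n, fun k hk => ?_⟩
    have h2 := hn k hk
    rw [Real.dist_eq] at h2
    rw [dist_eq_norm]
    refine lt_of_pow_lt_pow_left₀ 2 hε.le ?_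
    rw [hdist n k hk]
    exact (le_abs_self _).trans_lt h2
  obtain ⟨φ', hφ'⟩ := cauchySeq_tendsto_of_complete hcauchy
  obtain ⟨ε, hε, δ, hδ, hcontr⟩ := contr φ'
  obtain ⟨δ', hδ', hsmall⟩ := exists_norm_indicatorL2_le (N φ') (ε := ε / 4) (by positivity)
  set d := min δ δ'
  have hd : 0 < d := lt_min hδ hδ'
  have hev1 : ∀ᶠ n in Filter.atTop, sSup S - d < t n :=
    ht_lim.eventually_const_lt (by linarith)
  have hev2 : ∀ᶠ n in Filter.atTop, ‖φ n - φ'‖ < ε / 4 := by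
    have := (tendsto_iff_norm_sub_tendsto_zero.1 hφ').eventually_lt_const
      (by positivity : 0 < ε / 4)
    exact this
  obtain ⟨n, hn1, hn2⟩ := (hev1.and hev2).exists
  let r : Icc (0 : ℝ) T := ⟨min (t n + d) T, le_min (by linarith [(ht n).1]) hT, min_le_right _ _⟩
  have hr : τ n ≤ r := Subtype.coe_le_coe.1 (le_min (by simp only [τ]; linarith) (ht n).2)
  have hA : MeasurableSet (Ioc (τ n) r) := measurableSet_Ioc
  have hμ : timeMeasure T (Ioc (τ n) r) ≤ ENNReal.ofReal d := by
    refine (timeMeasure_Ioc_le _ _).trans (ENNReal.ofReal_le_ofReal ?_)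
    have : (r : ℝ) ≤ t n + d := min_le_left _ _
    simp only [τ]
    linarith
  have hμδ := hμ.trans (ENNReal.ofReal_le_ofReal (min_le_left δ δ'))
  have hμδ' := hμ.trans (ENNReal.ofReal_le_ofReal (min_le_right δ δ'))
  -- The history `φ n` up to `t n` is frozen and only the values on (t n, r] are sought. A ball
  -- around the limit φ' is mapped to itself: φ n is within ε/4 of φ', and N φ' is small in norm on
  -- the short interval.
  let Θ : TimeL2 T E → TimeL2 T E := fun ψ =>
    φ n + indicatorL2 E (timeMeasure T) hA (N ψ)
  have hΘ : ∀ φ₁ φ₂, φ₁ ∈ Metric.closedBall φ' ε → φ₂ ∈ Metric.closedBall φ' ε →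
      dist (Θ φ₁) (Θ φ₂) ≤ 1 / 2 * dist φ₁ φ₂ := by
    intro φ₁ φ₂ h1 h2
    rw [mem_closedBall_iff_norm] at h1 h2
    rw [dist_eq_norm, dist_eq_norm, add_sub_add_left_eq_sub, ← map_sub]
    exact hcontr _ hA hμδ _ _ h1 h2
  have hmaps : MapsTo Θ (Metric.closedBall φ' ε) (Metric.closedBall φ' ε) := by
    intro ψ hψ
    have h1 := hΘ ψ φ' hψ (Metric.mem_closedBall_self hε.le)
    have h2 : ‖Θ φ' - φ'‖ ≤ ε / 2 := by
      have h3 := hsmall _ hA hμδ'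
      have h4 : Θ φ' - φ' = (φ n - φ') + indicatorL2 E (timeMeasure T) hA (N φ') := by
        simp only [Θ]
        abel
      rw [h4]
      exact (norm_add_le _ _).trans (by linarith)
    rw [Metric.mem_closedBall] at hψ ⊢
    have h3 := dist_triangle (Θ ψ) (Θ φ') φ'
    rw [dist_eq_norm (Θ φ') φ'] at h3
    linarith
  have hK : ContractingWith (1 / 2) (hmaps.restrict Θ _ _) := by
    refine ⟨by norm_num, LipschitzWith.of_dist_le_mul fun φ₁ φ₂ => ?_⟩
    have h := hΘ φ₁ φ₂ φ₁.2 φ₂.2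
    change dist (Θ φ₁) (Θ φ₂) ≤ ((1 / 2 : ℝ≥0) : ℝ) * dist (φ₁ : TimeL2 T E) φ₂
    simpa using h
  obtain ⟨ψ, -, hψ, -⟩ := hK.exists_fixedPoint' Metric.isClosed_closedBall.isComplete hmaps
    (Metric.mem_closedBall_self hε.le) (edist_ne_top _ _)
  have hψ' : ψ = φ n + indicatorL2 E (timeMeasure T) hA (N ψ) := hψ.symm
  have hφn : cutoff E (τ n) (φ n) = φ n := by
    rw [hφ n]
    exact cutoff_cutoff le_rfl _
  have hcut : cutoff E (τ n) ψ = φ n := by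
    have h1 : cutoff E (τ n) (indicatorL2 E (timeMeasure T) hA (N ψ)) = 0 := by
      rw [← map_zero (cutoff E (τ n)), indicatorL2_ext_iff]
      filter_upwards [coeFn_indicatorL2 hA (N ψ), Lp.coeFn_zero E 2 (timeMeasure T)] with s h1 h2 hs
      rw [h1, indicator_of_notMem (fun h => not_lt_of_ge hs h.1), h2, Pi.zero_apply]
    rw [hψ', map_add, h1, hφn, add_zero]
  have hfix : ψ = cutoff E r (N ψ) := by
    rw [cutoff_add_indicator_Ioc hr, causal (τ n) ψ (φ n) (by rw [hcut, hφn]), ← hφ n]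
    exact hψ'
  have hrS : (r : ℝ) ∈ S := ⟨r.2, ψ, hfix⟩
  -- Otherwise r = t n + d, which exceeds the supremum of S although r belongs to S.
  have hrT : r = ⟨T, hT, le_rfl⟩ := by
    refine Subtype.ext (min_eq_right ?_)
    by_contra! hlt
    have h1 : (r : ℝ) = t n + d := min_eq_left hlt.le
    have h2 := le_csSup hSb hrS
    linarith
  rw [hrT, cutoff_top hT] at hfix
  exact ⟨ψ, hfix⟩

end Causal

/-! ### Existence and uniqueness for the nonlinear equation -/

section WellPosed

variable {T : ℝ} {H : Type*} [NormedAddCommGroup H] [InnerProductSpace ℝ H] [CompleteSpace H]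
  {G : H →L[ℝ] H} {b : H →L[ℝ] H →L[ℝ] H} {c : ℝ} {f : Icc (0 : ℝ) T → H → H}
  {ℓ m : Icc (0 : ℝ) T → ℝ}

omit [CompleteSpace H] in
theorem setIntegral_norm_mul_le_indicatorL2 {A : Set (Icc (0 : ℝ) T)} (hA : MeasurableSet A)
    (w z : TimeL2 T H) : ∫ s in A, ‖w s‖ * ‖z s‖ ∂(timeMeasure T) ≤
      ‖w‖ * ‖indicatorL2 H (timeMeasure T) hA z‖ := by
  refine le_of_eq_of_le ?_ (integral_norm_mul_le w (indicatorL2 H (timeMeasure T) hA z))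
  rw [← integral_indicator hA]
  refine integral_congr_ae ?_
  filter_upwards [coeFn_indicatorL2 hA z] with s hs
  rw [hs]
  by_cases h : s ∈ A <;> simp [h]

omit [CompleteSpace H] in
-- Writing b(x, x) - b(y, y) = b(x - y, x) + b(y, x - y), the bound on b costs the sup norms of the
-- u's and ∫_A ‖x - y‖(‖x‖ + ‖y‖). The second factor is small when the L² masses of x and y on A
-- are: this is the source of the contraction on short intervals.
theorem setIntegral_norm_sq_rhs_sub_le (hC : IsConvection G b c) (hf : IsForcing G f ℓ m)
    {A : Set (Icc (0 : ℝ) T)} (hA : MeasurableSet A) {x y : TimeC T H × TimeL2 T H} {ρ η : ℝ}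
    (hx : ∀ᵐ s ∂(timeMeasure T), G (x.2 s) = x.1 s)
    (hy : ∀ᵐ s ∂(timeMeasure T), G (y.2 s) = y.1 s) (hxρ : ‖x.1‖ ≤ ρ) (hyρ : ‖y.1‖ ≤ ρ)
    (hxA : ‖indicatorL2 H (timeMeasure T) hA x.2‖ ≤ η)
    (hyA : ‖indicatorL2 H (timeMeasure T) hA y.2‖ ≤ η)
    (hℓA : ∫ s in A, ℓ s ^ 2 ∂(timeMeasure T) ≤ η ^ 2) :
    ∫ s in A, ‖rhs G b f x.2 s - rhs G b f y.2 s‖ ^ 2 ∂(timeMeasure T) ≤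
      3 * (‖G‖ ^ 2 * η ^ 2 + 2 * (c * ρ * η)) * ‖x - y‖ ^ 2 := by
  set D := ‖x - y‖
  have hc := hC.nonneg
  have hρ : 0 ≤ ρ := (norm_nonneg _).trans hxρ
  have hη : 0 ≤ η := (norm_nonneg _).trans hxA
  have hD1 : ‖x.1 - y.1‖ ≤ D := norm_fst_le (x - y)
  have hD2 : ‖x.2 - y.2‖ ≤ D := norm_snd_le (x - y)
  have hI1 := (Lp.memLp (x.2 - y.2)).integrable_norm_mul (Lp.memLp x.2)
  have hI2 := (Lp.memLp (x.2 - y.2)).integrable_norm_mul (Lp.memLp y.2)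
  have hI0 := hf.lip_memLp.integrable_sq
  have hpt : ∀ᵐ s ∂(timeMeasure T), ‖rhs G b f x.2 s - rhs G b f y.2 s‖ ^ 2 ≤
      3 * ‖G‖ ^ 2 * D ^ 2 * ℓ s ^ 2 + 3 * (c * D * ρ) * (‖(x.2 - y.2) s‖ * ‖x.2 s‖) +
        3 * (c * D * ρ) * (‖(x.2 - y.2) s‖ * ‖y.2 s‖) := by
    filter_upwards [hx, hy, Lp.coeFn_sub x.2 y.2] with s h1 h2 h3
    have hz : G ((x.2 - y.2) s) = (x.1 - y.1) s := by
      rw [h3, Pi.sub_apply, map_sub, h1, h2, ContinuousMap.sub_apply]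
    have e1 : ‖b ((x.2 - y.2) s) (x.2 s)‖ ^ 2 ≤ c * D * ρ * (‖(x.2 - y.2) s‖ * ‖x.2 s‖) :=
      (hC.norm_sq_le hz h1).trans (by gcongr)
    have e2 : ‖b (y.2 s) ((x.2 - y.2) s)‖ ^ 2 ≤ c * D * ρ * (‖(x.2 - y.2) s‖ * ‖y.2 s‖) := by
      refine (hC.norm_sq_le h2 hz).trans ?_
      calc _ ≤ c * ρ * D * (‖y.2 s‖ * ‖(x.2 - y.2) s‖) := by gcongr
        _ = _ := by ring
    have e3 : ‖G (f s (x.2 s) - f s (y.2 s))‖ ≤ ‖G‖ * (ℓ s * D) := by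
      refine (G.le_opNorm _).trans (mul_le_mul_of_nonneg_left ?_ (norm_nonneg _))
      refine (hf.lip s _ _).trans (mul_le_mul_of_nonneg_left ?_ (hf.lip_nonneg s))
      rw [← Pi.sub_apply, ← h3, hz]
      exact (ContinuousMap.norm_coe_le_norm _ _).trans hD1
    have e4 : rhs G b f x.2 s - rhs G b f y.2 s = G (f s (x.2 s) - f s (y.2 s)) -
        b ((x.2 - y.2) s) (x.2 s) - b (y.2 s) ((x.2 - y.2) s) := by
      rw [h3, Pi.sub_apply, rhs, rhs]
      simp only [map_sub, sub_apply]
      abel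
    have e5 : ‖rhs G b f x.2 s - rhs G b f y.2 s‖ ≤ ‖G‖ * (ℓ s * D) +
        ‖b ((x.2 - y.2) s) (x.2 s)‖ + ‖b (y.2 s) ((x.2 - y.2) s)‖ := by
      rw [e4]
      refine (norm_sub_le _ _).trans ?_
      gcongr
      refine (norm_sub_le _ _).trans ?_
      gcongr
    have e6 := pow_le_pow_left₀ (norm_nonneg _) e5 2
    nlinarith [sq_nonneg (‖G‖ * (ℓ s * D) - ‖b ((x.2 - y.2) s) (x.2 s)‖),
      sq_nonneg (‖G‖ * (ℓ s * D) - ‖b (y.2 s) ((x.2 - y.2) s)‖),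
      sq_nonneg (‖b ((x.2 - y.2) s) (x.2 s)‖ - ‖b (y.2 s) ((x.2 - y.2) s)‖)]
  have hJ1 := hI0.const_mul (3 * ‖G‖ ^ 2 * D ^ 2)
  have hJ2 := hI1.const_mul (3 * (c * D * ρ))
  have hJ3 := hI2.const_mul (3 * (c * D * ρ))
  have hJ12 : Integrable (fun s => 3 * ‖G‖ ^ 2 * D ^ 2 * ℓ s ^ 2 +
      3 * (c * D * ρ) * (‖(x.2 - y.2) s‖ * ‖x.2 s‖)) (timeMeasure T) := hJ1.add hJ2
  have hL : MemLp (fun s => rhs G b f x.2 s - rhs G b f y.2 s) 2 (timeMeasure T) :=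
    (memLp_rhs hC hf hx).sub (memLp_rhs hC hf hy)
  have hint := integral_mono_ae
    ((memLp_two_iff_integrable_sq_norm hL.aestronglyMeasurable).1 hL).integrableOn
    (hJ12.add hJ3).integrableOn (ae_restrict_of_ae (s := A) hpt)
  simp only [Pi.add_apply] at hint
  rw [integral_add hJ12.integrableOn hJ3.integrableOn,
    integral_add hJ1.integrableOn hJ2.integrableOn, integral_const_mul, integral_const_mul,
    integral_const_mul] at hint
  have k1 : ∫ s in A, ‖(x.2 - y.2) s‖ * ‖x.2 s‖ ∂(timeMeasure T) ≤ D * η :=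
    (setIntegral_norm_mul_le_indicatorL2 hA _ _).trans (by gcongr)
  have k2 : ∫ s in A, ‖(x.2 - y.2) s‖ * ‖y.2 s‖ ∂(timeMeasure T) ≤ D * η :=
    (setIntegral_norm_mul_le_indicatorL2 hA _ _).trans (by gcongr)
  have hD0 : 0 ≤ D := norm_nonneg _
  calc _ ≤ _ := hint
    _ ≤ 3 * ‖G‖ ^ 2 * D ^ 2 * η ^ 2 + 3 * (c * D * ρ) * (D * η) + 3 * (c * D * ρ) * (D * η) := by
      gcongr
    _ = _ := by ring

variable (hT : 0 ≤ T) (hC : IsConvection G b c) (hf : IsForcing G f ℓ m) (ξ : H)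

/-- The right-hand side as a function of the forcing of the linear equation. -/
def rhsMap (φ : TimeL2 T H) : TimeL2 T H :=
  (memLp_rhs hC hf (linearFlow_ae hT hC.symm hC.inj (ξ, φ))).toLp _

theorem coeFn_rhsMap (φ : TimeL2 T H) :
    rhsMap hT hC hf ξ φ =ᵐ[timeMeasure T] rhs G b f (linearFlow T G (ξ, φ)).2 :=
  MemLp.coeFn_toLp _

theorem norm_rhsMap_le (φ : TimeL2 T H) {ρ : ℝ} (hρ : ‖linearFlow T G (ξ, φ)‖ ≤ ρ) :
    ‖rhsMap hT hC hf ξ φ‖ ≤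
      ‖G‖ * (‖hf.zero_memLp.toLp m‖ + ρ * ‖hf.lip_memLp.toLp ℓ‖) + √c * ρ * ρ := by
  set x := linearFlow T G (ξ, φ)
  have hx := linearFlow_ae hT hC.symm hC.inj (ξ, φ)
  have hc := hC.nonneg
  have h1 : ‖x.1‖ ≤ ρ := (norm_fst_le x).trans hρ
  have h2 : ‖x.2‖ ≤ ρ := (norm_snd_le x).trans hρ
  have hρ0 : 0 ≤ ρ := (norm_nonneg _).trans hρ
  have hsplit : rhsMap hT hC hf ξ φ =
      G.compLp ((hf.memLp hx).toLp _) - (hC.memLp hx).toLp _ := by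
    rw [Lp.ext_iff]
    filter_upwards [coeFn_rhsMap hT hC hf ξ φ, Lp.coeFn_sub (G.compLp ((hf.memLp hx).toLp _))
      ((hC.memLp hx).toLp _), G.coeFn_compLp ((hf.memLp hx).toLp _), (hf.memLp hx).coeFn_toLp,
      (hC.memLp hx).coeFn_toLp] with s a1 a2 a3 a4 a5
    rw [a1, a2, Pi.sub_apply, a3, a4, a5, rhs]
  have hF : ‖(hf.memLp hx).toLp _‖ ≤ ‖hf.zero_memLp.toLp m‖ + ρ * ‖hf.lip_memLp.toLp ℓ‖ := by
    have h3 : ‖(hf.memLp hx).toLp _‖ ≤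
        ‖hf.zero_memLp.toLp m + ρ • hf.lip_memLp.toLp ℓ‖ := by
      refine Lp.norm_le_norm_of_ae_le ?_
      filter_upwards [(hf.memLp hx).coeFn_toLp, hf.zero_memLp.coeFn_toLp, hf.lip_memLp.coeFn_toLp,
        Lp.coeFn_add (hf.zero_memLp.toLp m) (ρ • hf.lip_memLp.toLp ℓ),
        Lp.coeFn_smul ρ (hf.lip_memLp.toLp ℓ), hx] with s a1 a2 a3 a4 a5 a6
      have hℓ := hf.lip_nonneg s
      have hm := hf.zero_nonneg s
      rw [a1, a4, Pi.add_apply, a5, Pi.smul_apply, a2, a3, smul_eq_mul,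
        Real.norm_of_nonneg (by positivity)]
      refine (hf.norm_le s _).trans ?_
      rw [a6, mul_comm ρ]
      gcongr
      exact (ContinuousMap.norm_coe_le_norm _ _).trans h1
    refine h3.trans ((norm_add_le _ _).trans ?_)
    rw [norm_smul, Real.norm_of_nonneg hρ0]
  have hB : ‖(hC.memLp hx).toLp _‖ ≤ √c * ρ * ρ := by
    have h3 : ‖(hC.memLp hx).toLp _‖ ≤ (√c * ρ) * ‖x.2‖ := by
      refine Lp.norm_le_mul_norm_of_ae_le_mul ?_
      filter_upwards [(hC.memLp hx).coeFn_toLp, hx] with s a1 a2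
      rw [a1]
      refine le_of_abs_le (abs_le_of_sq_le_sq ((hC.norm_sq_le a2 a2).trans ?_) (by positivity))
      rw [mul_pow, mul_pow, Real.sq_sqrt hc]
      calc c * ‖x.1‖ * ‖x.1‖ * (‖x.2 s‖ * ‖x.2 s‖) ≤ c * ρ * ρ * (‖x.2 s‖ * ‖x.2 s‖) := by gcongr
        _ = _ := by ring
    exact h3.trans (by gcongr)
  rw [hsplit]
  refine (norm_sub_le _ _).trans (add_le_add ((G.norm_compLp_le _).trans ?_) hB)
  gcongr

theorem rhsMap_causal (τ : Icc (0 : ℝ) T) (φ ψ : TimeL2 T H) (h : cutoff H τ φ = cutoff H τ ψ) :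
    cutoff H τ (rhsMap hT hC hf ξ φ) = cutoff H τ (rhsMap hT hC hf ξ ψ) := by
  rw [indicatorL2_ext_iff] at h ⊢
  filter_upwards [linearFlow_causal hT hC.symm hC.inj (ξ := ξ) h, coeFn_rhsMap hT hC hf ξ φ,
    coeFn_rhsMap hT hC hf ξ ψ] with s h1 h2 h3 hs
  rw [h2, h3, rhs, rhs, h1 hs]

theorem rhsMap_contracting (φ₀ : TimeL2 T H) : ∃ ε > 0, ∃ δ > 0, ∀ (A : Set (Icc (0 : ℝ) T))
    (hA : MeasurableSet A), timeMeasure T A ≤ ENNReal.ofReal δ → ∀ φ ψ, ‖φ - φ₀‖ ≤ ε →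
      ‖ψ - φ₀‖ ≤ ε → ‖indicatorL2 H (timeMeasure T) hA
        (rhsMap hT hC hf ξ φ - rhsMap hT hC hf ξ ψ)‖ ≤ 1 / 2 * ‖φ - ψ‖ := by
  have hc := hC.nonneg
  set x₀ := linearFlow T G (ξ, φ₀)
  set ρ := ‖x₀‖ + 1
  have hρ : 0 ≤ ρ := by positivity
  set K := ‖G‖ ^ 2 + 2 * (c * ρ)
  have hK : 0 ≤ K := by positivity
  -- The estimate above, with the flow 2-Lipschitz, gives 3(…)(2‖φ - ψ‖)² = 48(…)(½‖φ - ψ‖)². Since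
  -- η ≤ 1, the bracket is at most K η, so 48 K η ≤ 1 suffices.
  set η := 1 / (48 * K + 1)
  have hη : 0 < η := by positivity
  have hη1 : η ≤ 1 := (div_le_one (by positivity)).2 (by linarith)
  have hηK : 48 * (‖G‖ ^ 2 * η ^ 2 + 2 * (c * ρ * η)) ≤ 1 := by
    have h1 : (48 * K + 1) * η = 1 := mul_one_div_cancel (by positivity)
    have h2 : ‖G‖ ^ 2 * η ^ 2 ≤ ‖G‖ ^ 2 * η := by
      gcongr
      nlinarith
    nlinarith
  obtain ⟨δ₁, hδ₁, hw⟩ := exists_norm_indicatorL2_le x₀.2 (half_pos hη)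
  obtain ⟨δ₂, hδ₂, hl⟩ := exists_norm_indicatorL2_le (hf.lip_memLp.toLp ℓ) hη
  -- A ball of radius η/4 moves the flow by at most η/2. The other η/2 is left for the mass of the
  -- centre x₀ on A, and η/2 ≤ 1 keeps the sup norm below ρ.
  refine ⟨η / 4, by positivity, min δ₁ δ₂, lt_min hδ₁ hδ₂, fun A hA hμ φ ψ hφ hψ => ?_⟩
  have hdiff : ∀ φ ψ : TimeL2 T H, ‖linearFlow T G (ξ, φ) - linearFlow T G (ξ, ψ)‖ ≤
      2 * ‖φ - ψ‖ := by
    intro φ ψ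
    rw [← map_sub, Prod.mk_sub_mk, sub_self]
    refine (norm_linearFlow_le hT hC.symm hC.inj _).trans_eq ?_
    rw [Prod.norm_mk, norm_zero, max_eq_right (norm_nonneg _)]
  have hball : ∀ φ : TimeL2 T H, ‖φ - φ₀‖ ≤ η / 4 → ‖(linearFlow T G (ξ, φ)).1‖ ≤ ρ ∧
      ‖indicatorL2 H (timeMeasure T) hA (linearFlow T G (ξ, φ)).2‖ ≤ η := by
    intro φ hφ
    have h1 := (hdiff φ φ₀).trans (mul_le_mul_of_nonneg_left hφ zero_le_two)
    have h2 : linearFlow T G (ξ, φ) = x₀ + (linearFlow T G (ξ, φ) - x₀) := by abel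
    constructor
    · refine (norm_fst_le _).trans ?_
      rw [h2]
      exact (norm_add_le _ _).trans (add_le_add le_rfl (h1.trans (by linarith)))
    · rw [h2, Prod.snd_add, map_add]
      have h3 := hw A hA (hμ.trans (ENNReal.ofReal_le_ofReal (min_le_left _ _)))
      have h4 := (norm_indicatorL2_le hA (linearFlow T G (ξ, φ) - x₀).2).trans
        ((norm_snd_le _).trans h1)
      exact (norm_add_le _ _).trans (by linarith)
  have hℓA : ∫ s in A, ℓ s ^ 2 ∂(timeMeasure T) ≤ η ^ 2 := by
    have h1 := hl A hA (hμ.trans (ENNReal.ofReal_le_ofReal (min_le_right _ _)))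
    have h2 := pow_le_pow_left₀ (norm_nonneg _) h1 2
    rw [norm_indicatorL2_sq] at h2
    refine le_of_eq_of_le (integral_congr_ae (ae_restrict_of_ae ?_)) h2
    filter_upwards [hf.lip_memLp.coeFn_toLp] with s hs
    rw [hs, Real.norm_eq_abs, sq_abs]
  have hmain := setIntegral_norm_sq_rhs_sub_le hC hf hA
    (linearFlow_ae hT hC.symm hC.inj (ξ, φ)) (linearFlow_ae hT hC.symm hC.inj (ξ, ψ))
    (hball φ hφ).1 (hball ψ hψ).1 (hball φ hφ).2 (hball ψ hψ).2 hℓA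
  have heq : ‖indicatorL2 H (timeMeasure T) hA
      (rhsMap hT hC hf ξ φ - rhsMap hT hC hf ξ ψ)‖ ^ 2 =
      ∫ s in A, ‖rhs G b f (linearFlow T G (ξ, φ)).2 s -
        rhs G b f (linearFlow T G (ξ, ψ)).2 s‖ ^ 2 ∂(timeMeasure T) := by
    rw [norm_indicatorL2_sq]
    refine integral_congr_ae (ae_restrict_of_ae ?_)
    filter_upwards [coeFn_rhsMap hT hC hf ξ φ, coeFn_rhsMap hT hC hf ξ ψ,
      Lp.coeFn_sub (rhsMap hT hC hf ξ φ) (rhsMap hT hC hf ξ ψ)] with s h1 h2 h3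
    rw [h3, Pi.sub_apply, h1, h2]
  refine le_of_abs_le (abs_le_of_sq_le_sq ?_ (by positivity))
  rw [heq]
  refine hmain.trans ?_
  have h1 := pow_le_pow_left₀ (norm_nonneg _) (hdiff φ ψ) 2
  calc _ ≤ 3 * (‖G‖ ^ 2 * η ^ 2 + 2 * (c * ρ * η)) * (2 * ‖φ - ψ‖) ^ 2 := by gcongr
    _ = (48 * (‖G‖ ^ 2 * η ^ 2 + 2 * (c * ρ * η))) * (1 / 2 * ‖φ - ψ‖) ^ 2 := by ring
    _ ≤ 1 * (1 / 2 * ‖φ - ψ‖) ^ 2 := by gcongr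
    _ = _ := one_mul _

/-- The stability estimate with perturbation y = 0: the remainder, which is the whole difference of
the flows, vanishes. -/
theorem rhsMap_unique (τ : Icc (0 : ℝ) T) (φ ψ : TimeL2 T H)
    (hφ : φ = cutoff H τ (rhsMap hT hC hf ξ φ)) (hψ : ψ = cutoff H τ (rhsMap hT hC hf ξ ψ)) :
    φ = ψ := by
  have hℓ : Integrable ℓ (timeMeasure T) := hf.lip_memLp.integrable one_le_two
  have hd : ∀ᵐ s ∂(timeMeasure T), (ψ - φ) s = (Iic τ).indicator
      (fun s => rhs G b f (linearFlow T G (ξ, ψ)).2 s - rhs G b f (linearFlow T G (ξ, φ)).2 s)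
        s := by
    have h1 := Lp.ext_iff.1 hφ
    have h2 := Lp.ext_iff.1 hψ
    filter_upwards [h1, h2, coeFn_indicatorL2 measurableSet_Iic (rhsMap hT hC hf ξ φ),
      coeFn_indicatorL2 measurableSet_Iic (rhsMap hT hC hf ξ ψ), Lp.coeFn_sub ψ φ,
      coeFn_rhsMap hT hC hf ξ φ, coeFn_rhsMap hT hC hf ξ ψ] with s a1 a2 a3 a4 a5 a6 a7
    rw [a5, Pi.sub_apply, a1, a2, a3, a4]
    by_cases hs : s ∈ Iic τ
    · simp only [indicator_of_mem hs, a6, a7]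
    · simp only [indicator_of_notMem hs, sub_self]
  have hflow : linearFlow T G (ξ, ψ) = linearFlow T G (ξ, φ) + (0 + linearFlow T G (0, ψ - φ)) := by
    rw [zero_add, ← map_add, Prod.mk_add_mk, add_zero, add_sub_cancel]
  have hzero : ∀ᵐ s ∂(timeMeasure T), G ((0 : TimeC T H × TimeL2 T H).2 s) =
      (0 : TimeC T H × TimeL2 T H).1 s := by
    filter_upwards [Lp.coeFn_zero H 2 (timeMeasure T)] with s hs
    rw [Prod.snd_zero, hs, Pi.zero_apply, map_zero]
    rfl
  have h := norm_sq_remainder_le hT hC (A := Iic τ)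
    (g := fun s => f s ((linearFlow T G (ξ, ψ)).2 s) - f s ((linearFlow T G (ξ, φ)).2 s))
    (linearFlow_ae hT hC.symm hC.inj (ξ, φ)) hzero hℓ hf.lip_nonneg le_rfl hflow ?_ ?_ ?_ le_rfl
    (by rw [norm_zero]; positivity)
  · rw [norm_zero, zero_pow two_ne_zero, mul_zero, zero_mul, zero_mul] at h
    have h1 : linearFlow T G (0, ψ - φ) = 0 :=
      norm_eq_zero.1 (pow_eq_zero_iff two_ne_zero |>.1 (le_antisymm h (sq_nonneg _)))
    rw [h1, add_zero, add_zero] at hflow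
    rw [hφ, hψ, indicatorL2_ext_iff]
    filter_upwards [coeFn_rhsMap hT hC hf ξ φ, coeFn_rhsMap hT hC hf ξ ψ] with s a1 a2 _
    rw [a1, a2, hflow]
  · filter_upwards [hd] with s hs hsA
    rw [hs, indicator_of_mem hsA, rhs, rhs, map_sub]
    abel
  · filter_upwards [hd] with s hs hsA
    rw [hs, indicator_of_notMem hsA]
  · exact ae_of_all _ fun s => hf.lip s _ _

theorem exists_rhsMap_fixedPoint : ∃ φ, φ = rhsMap hT hC hf ξ φ := by
  set ρ := √((‖ξ‖ ^ 2 + ∫ s, m s ^ 2 ∂(timeMeasure T)) *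
    Real.exp (2 * ∫ s, (1 + 2 * ℓ s) ∂(timeMeasure T)) *
      (1 + ∫ s, (1 + 2 * ℓ s) ∂(timeMeasure T)))
  refine exists_fixedPoint_of_causal hT (rhsMap_causal hT hC hf ξ) (rhsMap_contracting hT hC hf ξ)
    ⟨‖G‖ * (‖hf.zero_memLp.toLp m‖ + ρ * ‖hf.lip_memLp.toLp ℓ‖) + √c * ρ * ρ, fun τ φ hφ => ?_⟩
    (rhsMap_unique hT hC hf ξ)
  have h1 : φ =ᵐ[timeMeasure T] (Iic τ).indicator (rhs G b f (linearFlow T G (ξ, φ)).2) := by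
    have h2 := Lp.ext_iff.1 hφ
    filter_upwards [h2, coeFn_indicatorL2 measurableSet_Iic (rhsMap hT hC hf ξ φ),
      coeFn_rhsMap hT hC hf ξ φ] with s a1 a2 a3
    rw [a1, a2]
    by_cases hs : s ∈ Iic τ
    · rw [indicator_of_mem hs, indicator_of_mem hs, a3]
    · rw [indicator_of_notMem hs, indicator_of_notMem hs]
  have h2 := Real.le_sqrt_of_sq_le (norm_sq_le_of_rhs hT hC hf h1 le_rfl le_rfl)
  calc ‖φ‖ = ‖cutoff H τ (rhsMap hT hC hf ξ φ)‖ := by rw [← hφ]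
    _ ≤ ‖rhsMap hT hC hf ξ φ‖ := norm_indicatorL2_le _ _
    _ ≤ _ := norm_rhsMap_le hT hC hf ξ φ h2

end WellPosed

/-! ### Weak convergence of the forcing and strong convergence of the solutions -/

section OperatorFunctions

variable {T : ℝ} {H : Type*} [NormedAddCommGroup H] [InnerProductSpace ℝ H]

/-- The operator norm is at most the Hilbert–Schmidt norm. Through the adjoint: |S* y|² = ∑ᵢ (S eᵢ,
y)² ≤ |y|² ∑ᵢ |S eᵢ|². -/
theorem enorm_sq_le_tsum [CompleteSpace H] {ι : Type*} (e : HilbertBasis ι ℝ H) (S : H →L[ℝ] H) :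
    ‖S‖ₑ ^ 2 ≤ ∑' i, ‖S (e i)‖ₑ ^ 2 := by
  by_cases htop : ∑' i, ‖S (e i)‖ₑ ^ 2 = ∞
  · rw [htop]
    exact le_top
  have hadj : ∀ y, ‖S.adjoint y‖ₑ ^ 2 ≤ ‖y‖ₑ ^ 2 * ∑' i, ‖S (e i)‖ₑ ^ 2 := by
    intro y
    rw [← tsum_enorm_inner_sq e, ← ENNReal.tsum_mul_left]
    refine ENNReal.tsum_le_tsum fun i => ?_
    rw [ContinuousLinearMap.adjoint_inner_right, mul_comm, ← mul_pow]
    gcongr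
    rw [← ofReal_norm, ← ofReal_norm, ← ofReal_norm, ← ENNReal.ofReal_mul (norm_nonneg _)]
    exact ENNReal.ofReal_le_ofReal (norm_inner_le_norm _ _)
  set R := (∑' i, ‖S (e i)‖ₑ ^ 2).toReal
  have hR : ∑' i, ‖S (e i)‖ₑ ^ 2 = ENNReal.ofReal R := (ENNReal.ofReal_toReal htop).symm
  have hnorm : ‖S‖ ≤ √R := by
    rw [← ContinuousLinearMap.adjoint.norm_map S]
    refine ContinuousLinearMap.opNorm_le_bound _ (Real.sqrt_nonneg _) fun y => ?_
    have h := hadj y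
    rw [hR, ← ofReal_norm, ← ofReal_norm, ← ENNReal.ofReal_pow (norm_nonneg _),
      ← ENNReal.ofReal_pow (norm_nonneg _), ← ENNReal.ofReal_mul (by positivity),
      ENNReal.ofReal_le_ofReal_iff (by positivity)] at h
    refine le_of_abs_le (abs_le_of_sq_le_sq ?_ (by positivity))
    rw [mul_pow, Real.sq_sqrt ENNReal.toReal_nonneg, mul_comm]
    exact h
  rw [hR, ← ofReal_norm, ← ENNReal.ofReal_pow (norm_nonneg _)]
  refine ENNReal.ofReal_le_ofReal ?_
  calc ‖S‖ ^ 2 ≤ √R ^ 2 := by gcongr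
    _ = R := Real.sq_sqrt ENNReal.toReal_nonneg

theorem denseRange_of_symm_of_injective [CompleteSpace H] {G : H →L[ℝ] H}
    (hG : ∀ x y, inner ℝ (G x) y = inner ℝ x (G y)) (hinj : Function.Injective G) : DenseRange G := by
  have h1 : (LinearMap.range G.toLinearMap).topologicalClosure = ⊤ := by
    rw [Submodule.topologicalClosure_eq_top_iff, Submodule.eq_bot_iff]
    intro z hz
    have h2 := hz (G (G z)) ⟨_, rfl⟩
    rw [hG, inner_self_eq_zero] at h2
    exact hinj (h2.trans (map_zero G).symm)
  exact (Submodule.dense_iff_topologicalClosure_eq_top.2 h1 :)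

/-- Essentially bounded operator valued functions. -/
structure IsBoundedOperatorFun (Φ : Icc (0 : ℝ) T → H →L[ℝ] H) : Prop where
  meas : AEStronglyMeasurable Φ (timeMeasure T)
  bdd : ∃ C, ∀ᵐ s ∂(timeMeasure T), ‖Φ s‖ ≤ C

namespace IsBoundedOperatorFun

variable {Φ Φ' : Icc (0 : ℝ) T → H →L[ℝ] H}

theorem memLp_apply (hΦ : IsBoundedOperatorFun Φ) (k : TimeL2 T H) :
    MemLp (fun s => Φ s (k s)) 2 (timeMeasure T) := by
  obtain ⟨C, hC⟩ := hΦ.bdd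
  refine ((Lp.memLp k).norm.const_mul C).mono' ?_ ?_
  · exact isBoundedBilinearMap_apply.continuous.comp_aestronglyMeasurable
      (hΦ.meas.prodMk (Lp.aestronglyMeasurable k))
  · filter_upwards [hC] with s hs
    exact (Φ s).le_of_opNorm_le hs _

/-- The pointwise action of an operator valued function on `L²(0, T; H)`. -/
def mulL2 (hΦ : IsBoundedOperatorFun Φ) (k : TimeL2 T H) : TimeL2 T H :=
  (hΦ.memLp_apply k).toLp _

theorem coeFn_mulL2 (hΦ : IsBoundedOperatorFun Φ) (k : TimeL2 T H) :
    hΦ.mulL2 k =ᵐ[timeMeasure T] fun s => Φ s (k s) :=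
  MemLp.coeFn_toLp _

theorem memLp (hΦ : IsBoundedOperatorFun Φ) : MemLp Φ 2 (timeMeasure T) := by
  obtain ⟨C, hC⟩ := hΦ.bdd
  exact MemLp.of_bound hΦ.meas C hC

theorem add (hΦ : IsBoundedOperatorFun Φ) (hΦ' : IsBoundedOperatorFun Φ') :
    IsBoundedOperatorFun fun s => Φ s + Φ' s := by
  obtain ⟨C, hC⟩ := hΦ.bdd
  obtain ⟨C', hC'⟩ := hΦ'.bdd
  refine ⟨hΦ.meas.add hΦ'.meas, C + C', ?_⟩
  filter_upwards [hC, hC'] with s h1 h2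
  exact (norm_add_le _ _).trans (add_le_add h1 h2)

end IsBoundedOperatorFun

/-- The operator `x ↦ (e, x) a`. -/
def rankOne (e a : H) : H →L[ℝ] H := (innerSL ℝ e).smulRight a

theorem rankOne_apply (e a x : H) : rankOne e a x = inner ℝ e x • a := rfl

theorem rankOne_add (e a a' : H) : rankOne e (a + a') = rankOne e a + rankOne e a' := by
  ext x
  simp [rankOne_apply]

theorem rankOne_sub (e a a' : H) : rankOne e (a - a') = rankOne e a - rankOne e a' := by
  ext x
  simp [rankOne_apply, smul_sub]

theorem norm_rankOne (e a : H) : ‖rankOne e a‖ = ‖e‖ * ‖a‖ := by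
  rw [rankOne, ContinuousLinearMap.norm_smulRight_apply, innerSL_apply_norm]

theorem IsBoundedOperatorFun.rankOne (e : H) {a : Icc (0 : ℝ) T → H}
    (ha : AEStronglyMeasurable a (timeMeasure T)) {C : ℝ} (hC : ∀ᵐ s ∂(timeMeasure T), ‖a s‖ ≤ C) :
    IsBoundedOperatorFun fun s => rankOne e (a s) := by
  refine ⟨?_, ‖e‖ * C, ?_⟩
  · have : Continuous fun a : H => _root_.rankOne e a :=
      (ContinuousLinearMap.smulRightL ℝ H H (innerSL ℝ e)).continuous
    exact this.comp_aestronglyMeasurable ha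
  · filter_upwards [hC] with s hs
    rw [norm_rankOne]
    gcongr

end OperatorFunctions

/-! ### Linear flows driven by weakly convergent controls -/

section WeakStrong

open Filter Topology

variable {T : ℝ} {H : Type*} [NormedAddCommGroup H] [InnerProductSpace ℝ H]

omit [InnerProductSpace ℝ H] in
-- Equicontinuity upgrades pointwise convergence on a finite net to uniform convergence. Filters
-- replace sequences because the weak topology on the controls is handled directly.
theorem tendsto_zero_of_pointwise {F : Filter (TimeL2 T H)} {p : TimeL2 T H → TimeC T H} {C : ℝ}
    (hC : ∀ᶠ k in F, ∀ s t : Icc (0 : ℝ) T, ‖p k t - p k s‖ ≤ √|(t : ℝ) - s| * C)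
    (hp : ∀ t, Tendsto (fun k => p k t) F (𝓝 0)) : Tendsto p F (𝓝 0) := by
  rw [Metric.tendsto_nhds]
  intro ε hε
  obtain ⟨δ, hδ, hδε⟩ : ∃ δ > 0, √δ * |C| ≤ ε / 4 := by
    refine ⟨(ε / 4 / (|C| + 1)) ^ 2, by positivity, ?_⟩
    rw [Real.sqrt_sq (by positivity), div_mul_eq_mul_div, div_le_iff₀ (by positivity)]
    gcongr
    linarith
  obtain ⟨t, -, htfin, htcover⟩ :=
    (isCompact_univ (X := Icc (0 : ℝ) T)).finite_cover_balls hδ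
  have h1 : ∀ᶠ k in F, ∀ s ∈ t, ‖p k s‖ < ε / 4 := by
    rw [eventually_all_finite htfin]
    intro s _
    have := (hp s).norm
    rw [norm_zero] at this
    exact this.eventually_lt_const (by positivity)
  filter_upwards [hC, h1] with k hk1 hk2
  rw [dist_zero_right]
  refine lt_of_le_of_lt ((ContinuousMap.norm_le _ (by positivity : (0 : ℝ) ≤ ε / 2)).2 fun r => ?_)
    (half_lt_self hε)
  obtain ⟨s, hs, hrs⟩ := mem_iUnion₂.1 (htcover (mem_univ r))
  have h2 := hk1 s r
  have h3 : √|(r : ℝ) - s| * C ≤ √δ * |C| := by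
    have h4 : |(r : ℝ) - s| ≤ δ := (Metric.mem_ball.1 hrs).le
    calc _ ≤ √|(r : ℝ) - s| * |C| := by gcongr; exact le_abs_self C
      _ ≤ _ := by gcongr
  have h5 := norm_add_le (p k r - p k s) (p k s)
  rw [sub_add_cancel] at h5
  linarith [hk2 s hs]

variable [CompleteSpace H] {G : H →L[ℝ] H} {F : Filter (TimeL2 T H)} {k₀ : TimeL2 T H}

/-- The solutions of the linear equation forced by `Φ (k - k₀)` tend to zero along `F`. -/
def TendstoFlow (G : H →L[ℝ] H) (F : Filter (TimeL2 T H)) (k₀ : TimeL2 T H)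
    (Φ : Icc (0 : ℝ) T → H →L[ℝ] H) : Prop :=
  ∃ hΦ : IsBoundedOperatorFun Φ,
    Tendsto (fun k => linearFlow T G (0, G.compLp (hΦ.mulL2 (k - k₀)))) F (𝓝 0)

theorem TendstoFlow.add {Φ Φ' : Icc (0 : ℝ) T → H →L[ℝ] H} (h : TendstoFlow G F k₀ Φ)
    (h' : TendstoFlow G F k₀ Φ') : TendstoFlow G F k₀ fun s => Φ s + Φ' s := by
  obtain ⟨hΦ, h⟩ := h
  obtain ⟨hΦ', h'⟩ := h'
  refine ⟨hΦ.add hΦ', ?_⟩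
  have h1 := h.add h'
  rw [add_zero] at h1
  refine h1.congr fun k => ?_
  rw [← map_add, Prod.mk_add_mk, add_zero]
  congr 2
  rw [Lp.ext_iff]
  filter_upwards [Lp.coeFn_add (G.compLp (hΦ.mulL2 (k - k₀))) (G.compLp (hΦ'.mulL2 (k - k₀))),
    G.coeFn_compLp (hΦ.mulL2 (k - k₀)), G.coeFn_compLp (hΦ'.mulL2 (k - k₀)),
    G.coeFn_compLp ((hΦ.add hΦ').mulL2 (k - k₀)), hΦ.coeFn_mulL2 (k - k₀),
    hΦ'.coeFn_mulL2 (k - k₀), (hΦ.add hΦ').coeFn_mulL2 (k - k₀)] with s a1 a2 a3 a4 a5 a6 a7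
  rw [a1, Pi.add_apply, a2, a3, a4, a5, a6, a7, add_apply, map_add]

theorem TendstoFlow.zero : TendstoFlow G F k₀ fun _ => 0 := by
  have h0 : IsBoundedOperatorFun (T := T) (H := H) fun _ => 0 :=
    ⟨aestronglyMeasurable_const, 0, ae_of_all _ fun s => norm_zero.le⟩
  refine ⟨h0, ?_⟩
  refine tendsto_const_nhds.congr fun k => ?_
  have h1 : h0.mulL2 (k - k₀) = 0 := by
    rw [Lp.ext_iff]
    filter_upwards [h0.coeFn_mulL2 (k - k₀), Lp.coeFn_zero H 2 (timeMeasure T)] with s a1 a2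
    rw [a1, a2]
    rfl
  have h2 : G.compLp (0 : TimeL2 T H) = 0 := map_zero (G.compLpL 2 (timeMeasure T))
  rw [h1, h2, ← Prod.zero_eq_mk, map_zero]

theorem TendstoFlow.sum {ι : Type*} {Φ : ι → Icc (0 : ℝ) T → H →L[ℝ] H} (t : Finset ι)
    (h : ∀ i, TendstoFlow G F k₀ (Φ i)) : TendstoFlow G F k₀ fun s => ∑ i ∈ t, Φ i s := by
  classical
  induction t using Finset.induction_on with
  | empty => simpa using TendstoFlow.zero
  | insert i t hi ih =>
    simp only [Finset.sum_insert hi]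
    exact (h i).add ih

variable (hT : 0 ≤ T) (hG : ∀ x y, inner ℝ (G x) y = inner ℝ x (G y))
  (hinj : Function.Injective G)
include hT hG hinj

/-- The flow is controlled by the L¹ norm of Φ(k - k₀), hence by ‖Φ‖ in L² times the bounded ‖k -
k₀‖. The admissible coefficients are therefore closed under L² approximation in time; an L² bound on
the forcing would have demanded uniform approximation. -/
theorem TendstoFlow.of_approx {C : ℝ} (hF : ∀ᶠ k in F, ‖k - k₀‖ ≤ C)
    {Φ : Icc (0 : ℝ) T → H →L[ℝ] H} (hΦ : IsBoundedOperatorFun Φ)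
    (h : ∀ ε : ℝ, 0 < ε → ∃ Φ', TendstoFlow G F k₀ Φ' ∧
      eLpNorm (fun s => Φ s - Φ' s) 2 (timeMeasure T) ≤ ENNReal.ofReal ε) :
    TendstoFlow G F k₀ Φ := by
  refine ⟨hΦ, ?_⟩
  rw [Metric.tendsto_nhds]
  intro ε hε
  obtain ⟨Φ', ⟨hΦ', h1⟩, h2⟩ := h (ε / 4 / (|C| + 1)) (by positivity)
  have h3 := h1.norm
  rw [norm_zero] at h3
  filter_upwards [hF, h3.eventually_lt_const (half_pos hε)] with k hk1 hk2
  rw [dist_zero_right]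
  have hsub : linearFlow T G (0, G.compLp (hΦ.mulL2 (k - k₀))) =
      linearFlow T G (0, G.compLp (hΦ'.mulL2 (k - k₀))) +
        linearFlow T G (0, G.compLp (hΦ.mulL2 (k - k₀) - hΦ'.mulL2 (k - k₀))) := by
    have h4 : G.compLp (hΦ.mulL2 (k - k₀) - hΦ'.mulL2 (k - k₀)) =
        G.compLp (hΦ.mulL2 (k - k₀)) - G.compLp (hΦ'.mulL2 (k - k₀)) :=
      map_sub (G.compLpL 2 (timeMeasure T)) _ _
    rw [h4, ← map_add, Prod.mk_add_mk, add_zero, add_sub_cancel]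
  have hM : MemLp (fun s => Φ s - Φ' s) 2 (timeMeasure T) := hΦ.memLp.sub hΦ'.memLp
  have hint : ∫ s, ‖(hΦ.mulL2 (k - k₀) - hΦ'.mulL2 (k - k₀)) s‖ ∂(timeMeasure T) ≤
      ‖hM.toLp _‖ * ‖k - k₀‖ := by
    refine le_trans (integral_mono_ae (Lp_two_integrable _).norm
      ((Lp.memLp (hM.toLp _)).integrable_norm_mul (Lp.memLp (k - k₀))) ?_)
      (integral_norm_mul_le (hM.toLp _) (k - k₀))
    filter_upwards [Lp.coeFn_sub (hΦ.mulL2 (k - k₀)) (hΦ'.mulL2 (k - k₀)),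
      hΦ.coeFn_mulL2 (k - k₀), hΦ'.coeFn_mulL2 (k - k₀), hM.coeFn_toLp] with s a1 a2 a3 a4
    rw [a1, Pi.sub_apply, a2, a3, a4, ← sub_apply]
    exact ContinuousLinearMap.le_opNorm _ _
  have hM' : ‖hM.toLp _‖ ≤ ε / 4 / (|C| + 1) := by
    rw [Lp.norm_toLp]
    exact ENNReal.toReal_le_of_le_ofReal (by positivity) h2
  have h5 := norm_linearFlow_zero_compLp_le hT hG hinj
    (hΦ.mulL2 (k - k₀) - hΦ'.mulL2 (k - k₀))
  have h6 : ‖hM.toLp _‖ * ‖k - k₀‖ ≤ ε / 4 / (|C| + 1) * |C| :=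
    mul_le_mul hM' (hk1.trans (le_abs_self C)) (norm_nonneg _) (by positivity)
  have h7 : ε / 4 / (|C| + 1) * |C| < ε / 4 := by
    rw [div_mul_eq_mul_div, div_lt_iff₀ (by positivity)]
    nlinarith [abs_nonneg C]
  rw [hsub]
  exact (norm_add_le _ _).trans_lt (by linarith)

/-- The solution of the linear equation with forcing in the range of `A^{-1}`. -/
theorem linearFlow_compLp_comp (q : TimeL2 T H) :
    linearFlow T G (0, (G ∘L G).compLp q) =
      (G.compLeftContinuous ℝ (Icc (0 : ℝ) T) (primitive T H q),
        contToL2 T H (primitive T H q)) - linearFlow T G (0, contToL2 T H (primitive T H q)) := by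
  have hcurve : curve T H (0, q) = primitive T H q := by
    ext t
    rw [curve_apply, zero_add]
  -- The smooth curve ∫q starting from zero has data (0, ∫q + G² q); linearity isolates the part
  -- forced by G² q.
  have h1 : smoothData T G (0, q) =
      (0, contToL2 T H (primitive T H q)) + (0, (G ∘L G).compLp q) := by
    rw [Prod.mk_add_mk, add_zero]
    refine Prod.ext (map_zero G) ?_
    change contToL2 T H (curve T H (0, q)) + _ = _
    rw [hcurve]
    rfl
  have h2 := linearFlow_smoothData hT hG hinj (0, q)
  rw [h1, map_add] at h2
  have h3 : smoothFlow T G (0, q) = (G.compLeftContinuous ℝ (Icc (0 : ℝ) T) (primitive T H q),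
        contToL2 T H (primitive T H q)) := by
    change (G.compLeftContinuous ℝ (Icc (0 : ℝ) T) (curve T H (0, q)),
        contToL2 T H (curve T H (0, q))) = _
    rw [hcurve]
  rw [← h3, ← h2, add_sub_cancel_left]

variable {C : ℝ} (hF : ∀ᶠ k in F, ‖k - k₀‖ ≤ C)
  (hweak : ∀ g : TimeL2 T H, Tendsto (fun k => inner ℝ g (k - k₀)) F (𝓝 0))
include hF hweak

/-- With values in the range of G² the forcing is G² q, where q is a scalar function times the fixed
vector G y. By `linearFlow_compLp_comp` the solution depends continuously on ∫q alone. Its value at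
t is the pairing of k - k₀ with the indicator of [0, t] ∩ A times e, so it tends to zero by weak
convergence, and uniformly in t by equicontinuity. -/
theorem tendstoFlow_indicator_range {A : Set (Icc (0 : ℝ) T)} (hA : MeasurableSet A) (e y : H) :
    TendstoFlow G F k₀ fun s => rankOne e (A.indicator (fun _ => G (G y)) s) := by
  have hΦ : IsBoundedOperatorFun fun s : Icc (0 : ℝ) T =>
      rankOne e (A.indicator (fun _ => G (G y)) s) :=
    IsBoundedOperatorFun.rankOne e (aestronglyMeasurable_const.indicator hA)
      (ae_of_all _ fun s => norm_indicator_le_norm_self (fun _ => G (G y)) s)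
  refine ⟨hΦ, ?_⟩
  let q : TimeL2 T H → TimeL2 T H := fun k =>
    indicatorL2 H (timeMeasure T) hA ((rankOne e (G y)).compLp (k - k₀))
  have hq : ∀ k, G.compLp (hΦ.mulL2 (k - k₀)) = (G ∘L G).compLp (q k) := by
    intro k
    rw [Lp.ext_iff]
    filter_upwards [G.coeFn_compLp (hΦ.mulL2 (k - k₀)), hΦ.coeFn_mulL2 (k - k₀),
      (G ∘L G).coeFn_compLp (q k), coeFn_indicatorL2 hA ((rankOne e (G y)).compLp (k - k₀)),
      (rankOne e (G y)).coeFn_compLp (k - k₀)] with s a1 a2 a3 a4 a5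
    rw [a1, a2, a3, a4]
    by_cases hs : s ∈ A
    · rw [indicator_of_mem hs, indicator_of_mem hs, a5, rankOne_apply, rankOne_apply, map_smul,
        ContinuousLinearMap.comp_apply, map_smul, map_smul]
    · rw [indicator_of_notMem hs, indicator_of_notMem hs, rankOne_apply, smul_zero, map_zero,
        map_zero]
  have hprim : Tendsto (fun k => primitive T H (q k)) F (𝓝 0) := by
    refine tendsto_zero_of_pointwise (C := ‖e‖ * ‖G y‖ * C) ?_ fun t => ?_
    · filter_upwards [hF] with k hk s t
      refine (norm_setIntegral_Iic_sub_le (q k) s t).trans ?_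
      gcongr
      refine (norm_indicatorL2_le hA _).trans ((ContinuousLinearMap.norm_compLp_le _ _).trans ?_)
      rw [norm_rankOne]
      gcongr
    · have hAt : MeasurableSet (Iic t ∩ A) := measurableSet_Iic.inter hA
      have h1 : ∀ k, primitive T H (q k) t =
          inner ℝ (indicatorConstLp 2 hAt (measure_ne_top (timeMeasure T) _) e) (k - k₀) • G y := by
        intro k
        rw [L2.inner_indicatorConstLp_eq_inner_setIntegral, primitive_apply]
        have h2 : ∫ s in Iic t, q k s ∂(timeMeasure T) =
            ∫ s in Iic t ∩ A, (rankOne e (G y)) ((k - k₀) s) ∂(timeMeasure T) := by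
          rw [inter_comm, ← Measure.restrict_restrict hA, ← integral_indicator hA]
          refine integral_congr_ae (ae_restrict_of_ae ?_)
          filter_upwards [coeFn_indicatorL2 hA ((rankOne e (G y)).compLp (k - k₀)),
            (rankOne e (G y)).coeFn_compLp (k - k₀)] with s a1 a2
          rw [a1]
          by_cases hs : s ∈ A
          · rw [indicator_of_mem hs, indicator_of_mem hs, a2]
          · rw [indicator_of_notMem hs, indicator_of_notMem hs]
        rw [h2, ContinuousLinearMap.integral_comp_comm _ (Lp_two_integrable _).integrableOn,
          rankOne_apply]
      simp only [h1]
      have h2 := (hweak (indicatorConstLp 2 hAt (measure_ne_top (timeMeasure T) _) e)).smul_const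
        (G y)
      rwa [zero_smul] at h2
  simp only [hq, linearFlow_compLp_comp hT hG hinj]
  have hcont : Continuous fun p : TimeC T H =>
      (G.compLeftContinuous ℝ (Icc (0 : ℝ) T) p, contToL2 T H p) -
        linearFlow T G (0, contToL2 T H p) := by fun_prop
  have h := (hcont.tendsto 0).comp hprim
  simp only [map_zero, Prod.mk_zero_zero, sub_zero] at h
  exact h

theorem tendstoFlow_indicator {A : Set (Icc (0 : ℝ) T)} (hA : MeasurableSet A) {e : H}
    (he : ‖e‖ ≤ 1) (a : H) :
    TendstoFlow G F k₀ fun s => rankOne e (A.indicator (fun _ => a) s) := by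
  have hΦ : IsBoundedOperatorFun fun s : Icc (0 : ℝ) T =>
      rankOne e (A.indicator (fun _ => a) s) :=
    IsBoundedOperatorFun.rankOne e (aestronglyMeasurable_const.indicator hA)
      (ae_of_all _ fun s => norm_indicator_le_norm_self (fun _ => a) s)
  refine TendstoFlow.of_approx hT hG hinj hF hΦ fun ε hε => ?_
  have hd := denseRange_of_symm_of_injective hG hinj
  have hGG : DenseRange fun y => G (G y) := hd.comp hd G.continuous
  set K : ℝ := (timeMeasure T univ ^ (1 / 2 : ℝ)).toReal
  have hK : 0 ≤ K := ENNReal.toReal_nonneg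
  obtain ⟨y, hy⟩ := hGG.exists_dist_lt a (show 0 < ε / (K + 1) by positivity)
  refine ⟨_, tendstoFlow_indicator_range hT hG hinj hF hweak hA e y, ?_⟩
  refine (eLpNorm_le_of_ae_bound (C := ε / (K + 1)) (ae_of_all _ fun s => ?_)).trans ?_
  · rw [← rankOne_sub, norm_rankOne]
    refine (mul_le_of_le_one_left (norm_nonneg _) he).trans ?_
    by_cases hs : s ∈ A
    · rw [indicator_of_mem hs, indicator_of_mem hs, ← dist_eq_norm]
      exact hy.le
    · rw [indicator_of_notMem hs, indicator_of_notMem hs, sub_zero, norm_zero]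
      positivity
  · have h1 : timeMeasure T univ ^ (1 / 2 : ℝ) = ENNReal.ofReal K :=
      (ENNReal.ofReal_toReal (ENNReal.rpow_ne_top_of_nonneg (by norm_num)
        (measure_ne_top _ _))).symm
    have h2 : (2 : ℝ≥0∞).toReal⁻¹ = 1 / 2 := by norm_num
    rw [h2, h1, ← ENNReal.ofReal_mul hK]
    refine ENNReal.ofReal_le_ofReal ?_
    rw [mul_div_assoc', div_le_iff₀ (by positivity)]
    nlinarith

theorem tendstoFlow_simpleFunc {e : H} (he : ‖e‖ ≤ 1) (g : SimpleFunc (Icc (0 : ℝ) T) H) :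
    TendstoFlow G F k₀ fun s => rankOne e (g s) := by
  induction g using SimpleFunc.induction with
  | const a hA =>
    convert tendstoFlow_indicator hT hG hinj hF hweak hA he a using 3 with s
    rw [SimpleFunc.coe_piecewise, SimpleFunc.coe_const, SimpleFunc.coe_const]
    simp [indicator, piecewise, Function.const]
  | @add f g _ hf hg =>
    convert hf.add hg using 2 with s
    rw [SimpleFunc.coe_add, Pi.add_apply, rankOne_add]

theorem tendstoFlow_rankOne {e : H} (he : ‖e‖ ≤ 1) {a : Icc (0 : ℝ) T → H}
    (ha : AEStronglyMeasurable a (timeMeasure T)) {C' : ℝ}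
    (hC' : ∀ᵐ s ∂(timeMeasure T), ‖a s‖ ≤ C') :
    TendstoFlow G F k₀ fun s => rankOne e (a s) := by
  refine TendstoFlow.of_approx hT hG hinj hF (IsBoundedOperatorFun.rankOne e ha hC') fun ε hε => ?_
  obtain ⟨g, hg, -⟩ := (MemLp.of_bound (p := 2) ha C' hC').exists_simpleFunc_eLpNorm_sub_lt
    ENNReal.ofNat_ne_top (ENNReal.ofReal_pos.2 hε).ne'
  refine ⟨_, tendstoFlow_simpleFunc hT hG hinj hF hweak he g, ?_⟩
  refine le_trans (eLpNorm_mono fun s => ?_) hg.le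
  rw [← rankOne_sub, norm_rankOne]
  exact mul_le_of_le_one_left (norm_nonneg _) he

/-- If `Ψ` takes values in the Hilbert-Schmidt operators, weak convergence of the controls implies
strong convergence of the solutions of the linear equation. -/
theorem tendstoFlow_hilbertSchmidt {ι : Type*} [Countable ι] (e : HilbertBasis ι ℝ H)
    {Ψ : Icc (0 : ℝ) T → H →L[ℝ] H} (hΨ : IsBoundedOperatorFun Ψ) {D : ℝ}
    (hD : ∀ᵐ s ∂(timeMeasure T), ∑' i, ‖Ψ s (e i)‖ₑ ^ 2 ≤ ENNReal.ofReal D) :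
    TendstoFlow G F k₀ Ψ := by
  classical
  have hmeas : ∀ i, AEStronglyMeasurable (fun s => Ψ s (e i)) (timeMeasure T) := fun i =>
    (ContinuousLinearMap.apply ℝ H (e i)).continuous.comp_aestronglyMeasurable hΨ.meas
  refine TendstoFlow.of_approx hT hG hinj hF hΨ fun ε hε => ?_
  -- By Tonelli the column norms ∫|Ψ eᵢ|² are summable, so the tails, which dominate the L² error of
  -- truncating to finitely many columns, are small.
  have hsum : ∑' i, ∫⁻ s, ‖Ψ s (e i)‖ₑ ^ 2 ∂(timeMeasure T) ≠ ∞ := by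
    rw [← lintegral_tsum fun i => ((hmeas i).enorm.pow_const 2)]
    refine ((lintegral_mono_ae hD).trans_lt ?_).ne
    rw [lintegral_const]
    exact ENNReal.mul_lt_top ENNReal.ofReal_lt_top (measure_lt_top _ _)
  obtain ⟨t, ht⟩ := ((ENNReal.tendsto_tsum_compl_atTop_zero hsum).eventually_le_const
    (ENNReal.ofReal_pos.2 (show 0 < ε ^ 2 by positivity))).exists
  obtain ⟨C', hC'⟩ := hΨ.bdd
  refine ⟨fun s => ∑ i ∈ t, rankOne (e i) (Ψ s (e i)), TendstoFlow.sum t fun i => ?_, ?_⟩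
  · refine tendstoFlow_rankOne hT hG hinj hF hweak (e.orthonormal.1 i).le (hmeas i) (C' := C') ?_
    filter_upwards [hC'] with s hs
    refine ((Ψ s).le_of_opNorm_le hs _).trans_eq ?_
    rw [e.orthonormal.1 i, mul_one]
  -- The truncation agrees with Ψ on eᵢ for i ∈ t and kills the other basis vectors.
  · have hbasis : ∀ s i, (Ψ s - ∑ i ∈ t, rankOne (e i) (Ψ s (e i))) (e i) =
        if i ∈ t then 0 else Ψ s (e i) := by
      intro s i
      have h1 : (∑ j ∈ t, rankOne (e j) (Ψ s (e j))) (e i) =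
          ∑ j ∈ t, if j = i then Ψ s (e i) else 0 := by
        rw [sum_apply]
        refine Finset.sum_congr rfl fun j _ => ?_
        rw [rankOne_apply, orthonormal_iff_ite.1 e.orthonormal j i]
        by_cases hij : j = i
        · rw [if_pos hij, if_pos hij, one_smul, hij]
        · rw [if_neg hij, if_neg hij, zero_smul]
      rw [sub_apply, h1, Finset.sum_ite_eq']
      by_cases hi : i ∈ t
      · rw [if_pos hi, if_pos hi, sub_self]
      · rw [if_neg hi, if_neg hi, sub_zero]
    have hpt : ∀ s, ‖Ψ s - ∑ i ∈ t, rankOne (e i) (Ψ s (e i))‖ₑ ^ 2 ≤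
        ∑' i : {i // i ∉ t}, ‖Ψ s (e i)‖ₑ ^ 2 := by
      intro s
      refine (enorm_sq_le_tsum e _).trans_eq ?_
      have h1 := tsum_subtype {i | i ∉ t} fun i => ‖Ψ s (e i)‖ₑ ^ 2
      refine Eq.trans (tsum_congr fun i => ?_) h1.symm
      rw [hbasis]
      by_cases hi : i ∈ t
      · rw [if_pos hi, indicator_of_notMem (show i ∉ {i | i ∉ t} from not_not.2 hi), enorm_zero, zero_pow two_ne_zero]
      · rw [if_neg hi, indicator_of_mem (show i ∈ {i | i ∉ t} from hi)]
    have hint : ∫⁻ s, ‖Ψ s - ∑ i ∈ t, rankOne (e i) (Ψ s (e i))‖ₑ ^ 2 ∂(timeMeasure T) ≤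
        ENNReal.ofReal (ε ^ 2) := by
      refine (lintegral_mono hpt).trans ?_
      rw [lintegral_tsum fun i : {i // i ∉ t} => ((hmeas i).enorm.pow_const 2)]
      exact ht
    rw [eLpNorm_eq_lintegral_rpow_enorm_toReal two_ne_zero ENNReal.ofNat_ne_top]
    simp only [ENNReal.toReal_ofNat, ENNReal.rpow_ofNat]
    calc _ ≤ ENNReal.ofReal (ε ^ 2) ^ (1 / 2 : ℝ) := by gcongr
      _ = ENNReal.ofReal ε := by
        rw [ENNReal.ofReal_rpow_of_nonneg (by positivity) (by norm_num), ← Real.sqrt_eq_rpow,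
          Real.sqrt_sq hε.le]

end WeakStrong

/-! ### Compactness of the set of solutions -/

section WeakCompactness

open Filter Topology

/-- The image of a ball under a weakly continuous map is compact. -/
theorem isCompact_image_closedBall {E Y : Type*} [NormedAddCommGroup E] [InnerProductSpace ℝ E]
    [CompleteSpace E] [TopologicalSpace Y] {X : E → Y} {M : ℝ}
    (hX : ∀ k₀ (F : Filter E), (∀ᶠ k in F, ‖k‖ ≤ M) →
      (∀ g, Tendsto (fun k => inner ℝ g (k - k₀)) F (𝓝 0)) → Tendsto X F (𝓝 (X k₀))) :
    IsCompact (X '' Metric.closedBall 0 M) := by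
  -- The Riesz identification moves the ball to the weak dual, where Banach–Alaoglu makes it
  -- compact. Continuity of X ∘ ψ there is the hypothesis applied to pushed forward neighbourhood
  -- filters.
  let ψ : WeakDual ℝ E → E := fun d => (InnerProductSpace.toDual ℝ E).symm (WeakDual.toStrongDual d)
  set D : Set (WeakDual ℝ E) := WeakDual.toStrongDual ⁻¹' Metric.closedBall 0 M
  have hD : IsCompact D := WeakDual.isCompact_closedBall 0 M
  have hψ : ∀ d, ‖ψ d‖ = ‖WeakDual.toStrongDual d‖ := fun d => LinearIsometryEquiv.norm_map _ _
  have hψD : ∀ d ∈ D, ‖ψ d‖ ≤ M := fun d hd => by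
    rw [hψ]
    exact mem_closedBall_zero_iff.1 hd
  have himage : X '' Metric.closedBall 0 M = (X ∘ ψ) '' D := by
    rw [image_comp]
    congr 1
    ext k
    constructor
    · intro hk
      refine ⟨StrongDual.toWeakDual (InnerProductSpace.toDual ℝ E k), ?_, ?_⟩
      · change InnerProductSpace.toDual ℝ E k ∈ Metric.closedBall 0 M
        rw [mem_closedBall_zero_iff, LinearIsometryEquiv.norm_map]
        exact mem_closedBall_zero_iff.1 hk
      · exact (InnerProductSpace.toDual ℝ E).symm_apply_apply k
    · rintro ⟨d, hd, rfl⟩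
      exact mem_closedBall_zero_iff.2 (hψD d hd)
  rw [himage]
  refine hD.image_of_continuousOn fun d₀ _ => ?_
  refine (hX (ψ d₀) (map ψ (𝓝[D] d₀)) ?_ fun g => ?_ :)
  · rw [eventually_map]
    exact eventually_nhdsWithin_of_forall hψD
  · rw [tendsto_map'_iff]
    have h1 : Continuous fun d : WeakDual ℝ E => d g - d₀ g :=
      (WeakDual.eval_continuous g).sub continuous_const
    have h2 : (fun k => inner ℝ g (k - ψ d₀)) ∘ ψ = fun d : WeakDual ℝ E => d g - d₀ g := by
      ext d
      have h3 : ∀ d : WeakDual ℝ E, inner ℝ g (ψ d) = d g := fun d => by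
        rw [real_inner_comm]
        exact InnerProductSpace.toDual_symm_apply
      simp only [Function.comp_apply, inner_sub_right, h3]
    rw [h2]
    have h4 := h1.tendsto d₀
    rw [sub_self] at h4
    exact h4.mono_left nhdsWithin_le_nhds

end WeakCompactness

/-- A drift which is Lipschitz in the state. -/
structure IsDrift {T : ℝ} {H : Type*} [NormedAddCommGroup H] (ϱ : Icc (0 : ℝ) T → H → H)
    (R₀ R₁ : ℝ) : Prop where
  cont : Continuous (Function.uncurry ϱ)
  nonneg₀ : 0 ≤ R₀
  nonneg₁ : 0 ≤ R₁
  zero_le : ∀ s, ‖ϱ s 0‖ ≤ R₀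
  lip : ∀ s x y, ‖ϱ s x - ϱ s y‖ ≤ R₁ * ‖x - y‖

/-- A Hilbert-Schmidt valued diffusion coefficient, transported to `H` by `A^{1/2}` and `Q^{1/2}`. -/
structure IsDiffusion {T : ℝ} {H : Type*} [NormedAddCommGroup H] [InnerProductSpace ℝ H]
    {ι : Type*} (e : HilbertBasis ι ℝ H) (G : H →L[ℝ] H) (S : Icc (0 : ℝ) T → H → H →L[ℝ] H)
    (K₀ K₁ L₁ : ℝ) : Prop where
  cont : Continuous (Function.uncurry S)
  nonneg₀ : 0 ≤ K₀
  nonneg₁ : 0 ≤ K₁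
  lip_nonneg : 0 ≤ L₁
  growth : ∀ s x, ∑' i, ‖S s x (e i)‖ₑ ^ 2 ≤ ENNReal.ofReal (K₀ + K₁ * ‖G x‖ ^ 2)
  lip : ∀ s x y, ‖S s x - S s y‖ ^ 2 ≤ L₁ * ‖G (x - y)‖ ^ 2

/-! ### The controlled equation transported to H -/

section Controlled

open Filter Topology

variable {T : ℝ} {H : Type*} [NormedAddCommGroup H] [InnerProductSpace ℝ H] [CompleteSpace H]
  {G : H →L[ℝ] H} {b : H →L[ℝ] H →L[ℝ] H} {c : ℝ} {ϱ : Icc (0 : ℝ) T → H → H}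
  {S : Icc (0 : ℝ) T → H → H →L[ℝ] H} {R₀ R₁ K₀ K₁ L₁ : ℝ} {ι : Type*} {e : HilbertBasis ι ℝ H}

/-- The forcing `σ(s, w) k(s) - ϱ(s, G w)`. -/
def controlForcing (G : H →L[ℝ] H) (ϱ : Icc (0 : ℝ) T → H → H) (S : Icc (0 : ℝ) T → H → H →L[ℝ] H)
    (k : Icc (0 : ℝ) T → H) (s : Icc (0 : ℝ) T) (x : H) : H :=
  S s x (k s) - ϱ s (G x)

theorem IsDiffusion.norm_sq_le (hS : IsDiffusion e G S K₀ K₁ L₁) (s : Icc (0 : ℝ) T) (x : H) :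
    ‖S s x‖ ^ 2 ≤ K₀ + K₁ * ‖G x‖ ^ 2 := by
  have h := (enorm_sq_le_tsum e (S s x)).trans (hS.growth s x)
  have h0 := hS.nonneg₀
  have h1 := hS.nonneg₁
  rwa [← ofReal_norm, ← ENNReal.ofReal_pow (norm_nonneg _),
    ENNReal.ofReal_le_ofReal_iff (by positivity)] at h

/-- The control enters the Lipschitz and growth constants only through |k(s)|, which is square
integrable; hence the time dependent constants in `IsForcing`. -/
theorem isForcing_controlForcing (hϱ : IsDrift ϱ R₀ R₁) (hS : IsDiffusion e G S K₀ K₁ L₁)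
    (k : TimeL2 T H) : IsForcing G (controlForcing G ϱ S k) (fun s => R₁ + √L₁ * ‖k s‖)
      (fun s => R₀ + √K₀ * ‖k s‖) where
  meas w hw := by
    refine AEStronglyMeasurable.sub ?_ ?_
    · refine isBoundedBilinearMap_apply.continuous.comp_aestronglyMeasurable
        (AEStronglyMeasurable.prodMk ?_ (Lp.aestronglyMeasurable k))
      exact hS.cont.comp_aestronglyMeasurable (aestronglyMeasurable_id.prodMk hw)
    · exact hϱ.cont.comp_aestronglyMeasurable
        (aestronglyMeasurable_id.prodMk (G.continuous.comp_aestronglyMeasurable hw))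
  lip s x y := by
    have h1 : ‖S s x - S s y‖ ≤ √L₁ * ‖G (x - y)‖ := by
      refine le_of_abs_le (abs_le_of_sq_le_sq ?_ (by positivity))
      rw [mul_pow, Real.sq_sqrt hS.lip_nonneg]
      exact hS.lip s x y
    have h2 := hϱ.lip s (G x) (G y)
    rw [← map_sub] at h2
    have h3 : controlForcing G ϱ S k s x - controlForcing G ϱ S k s y =
        (S s x - S s y) (k s) - (ϱ s (G x) - ϱ s (G y)) := by
      rw [controlForcing, controlForcing, sub_apply]
      abel
    rw [h3]
    calc _ ≤ ‖(S s x - S s y) (k s)‖ + ‖ϱ s (G x) - ϱ s (G y)‖ := norm_sub_le _ _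
      _ ≤ √L₁ * ‖G (x - y)‖ * ‖k s‖ + R₁ * ‖G (x - y)‖ :=
        add_le_add ((S s x - S s y).le_of_opNorm_le h1 _) h2
      _ = _ := by ring
  zero_le s := by
    have h1 := hS.norm_sq_le s 0
    rw [map_zero, norm_zero, zero_pow two_ne_zero, mul_zero, add_zero] at h1
    have h2 := (S s 0).le_of_opNorm_le (Real.le_sqrt_of_sq_le h1) (k s)
    have h3 := hϱ.zero_le s
    rw [controlForcing, map_zero]
    exact (norm_sub_le _ _).trans (by linarith)
  lip_nonneg s := by
    have := hϱ.nonneg₁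
    positivity
  lip_memLp := (memLp_const R₁).add ((Lp.memLp k).norm.const_mul √L₁)
  zero_memLp := (memLp_const R₀).add ((Lp.memLp k).norm.const_mul √K₀)

/-- `x = (u, w)` solves the controlled equation with control `k`. -/
def IsControlledFlow (G : H →L[ℝ] H) (b : H →L[ℝ] H →L[ℝ] H) (ϱ : Icc (0 : ℝ) T → H → H)
    (S : Icc (0 : ℝ) T → H → H →L[ℝ] H) (ξ : H) (k : TimeL2 T H) (x : TimeC T H × TimeL2 T H) :
    Prop :=
  ∃ φ : TimeL2 T H, x = linearFlow T G (ξ, φ) ∧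
    φ =ᵐ[timeMeasure T] rhs G b (controlForcing G ϱ S k) x.2

variable (hT : 0 ≤ T) (hC : IsConvection G b c) (hϱ : IsDrift ϱ R₀ R₁)
  (hS : IsDiffusion e G S K₀ K₁ L₁) (ξ : H)
include hT hC hϱ hS

theorem exists_isControlledFlow (k : TimeL2 T H) : ∃ x, IsControlledFlow G b ϱ S ξ k x := by
  have hf := isForcing_controlForcing hϱ hS k
  obtain ⟨φ, hφ⟩ := exists_rhsMap_fixedPoint hT hC hf ξ
  refine ⟨_, φ, rfl, ?_⟩
  have h := coeFn_rhsMap hT hC hf ξ φ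
  rwa [← hφ] at h

theorem isControlledFlow_unique {k : TimeL2 T H} {x y : TimeC T H × TimeL2 T H}
    (hx : IsControlledFlow G b ϱ S ξ k x) (hy : IsControlledFlow G b ϱ S ξ k y) : x = y := by
  have hf := isForcing_controlForcing hϱ hS k
  obtain ⟨φ, rfl, hφ⟩ := hx
  obtain ⟨ψ, rfl, hψ⟩ := hy
  have h1 : φ = cutoff H ⟨T, hT, le_rfl⟩ (rhsMap hT hC hf ξ φ) := by
    rw [cutoff_top hT]
    exact Lp.ext (hφ.trans (coeFn_rhsMap hT hC hf ξ φ).symm)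
  have h2 : ψ = cutoff H ⟨T, hT, le_rfl⟩ (rhsMap hT hC hf ξ ψ) := by
    rw [cutoff_top hT]
    exact Lp.ext (hψ.trans (coeFn_rhsMap hT hC hf ξ ψ).symm)
  rw [rhsMap_unique hT hC hf ξ _ φ ψ h1 h2]

/-- The solution depends continuously on the control in the weak topology. -/
theorem tendsto_controlledFlow [Countable ι] {X : TimeL2 T H → TimeC T H × TimeL2 T H}
    (hX : ∀ k, IsControlledFlow G b ϱ S ξ k (X k)) {F : Filter (TimeL2 T H)} {k₀ : TimeL2 T H}
    {M : ℝ} (hF : ∀ᶠ k in F, ‖k‖ ≤ M)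
    (hweak : ∀ g : TimeL2 T H, Tendsto (fun k => inner ℝ g (k - k₀)) F (𝓝 0)) :
    Tendsto X F (𝓝 (X k₀)) := by
  obtain ⟨φ₀, hx₀, hφ₀⟩ := hX k₀
  have hae₀ : ∀ᵐ s ∂(timeMeasure T), G ((X k₀).2 s) = (X k₀).1 s := by
    rw [hx₀]
    exact linearFlow_ae hT hC.symm hC.inj _
  -- The coefficient is frozen along the limit solution. It is bounded and Hilbert–Schmidt because u
  -- is bounded on [0, T].
  set Ψ : Icc (0 : ℝ) T → H →L[ℝ] H := fun s => S s ((X k₀).2 s)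
  set D : ℝ := K₀ + K₁ * ‖(X k₀).1‖ ^ 2
  have hK1 := hS.nonneg₁
  have hΨ : IsBoundedOperatorFun Ψ := by
    refine ⟨hS.cont.comp_aestronglyMeasurable
      (aestronglyMeasurable_id.prodMk (Lp.aestronglyMeasurable (X k₀).2)), √D, ?_⟩
    filter_upwards [hae₀] with s hs
    refine Real.le_sqrt_of_sq_le ((hS.norm_sq_le s _).trans ?_)
    rw [hs]
    simp only [D]
    gcongr
    exact ContinuousMap.norm_coe_le_norm _ _
  have hHS : ∀ᵐ s ∂(timeMeasure T), ∑' i, ‖Ψ s (e i)‖ₑ ^ 2 ≤ ENNReal.ofReal D := by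
    filter_upwards [hae₀] with s hs
    refine (hS.growth s _).trans (ENNReal.ofReal_le_ofReal ?_)
    rw [hs]
    simp only [D]
    gcongr
    exact ContinuousMap.norm_coe_le_norm _ _
  have hF' : ∀ᶠ k in F, ‖k - k₀‖ ≤ M + ‖k₀‖ := by
    filter_upwards [hF] with k hk
    exact (norm_sub_le _ _).trans (by linarith)
  obtain ⟨hΨ', hy⟩ := tendstoFlow_hilbertSchmidt hT hC.symm hC.inj hF' hweak e hΨ hHS
  set y : TimeL2 T H → TimeC T H × TimeL2 T H := fun k =>
    linearFlow T G (0, G.compLp (hΨ'.mulL2 (k - k₀)))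
  choose φ hx hφ using hX
  -- The change of forcing splits as S(w)k - S(w₀)k₀ = (S(w) - S(w₀))k + S(w₀)(k - k₀). The second
  -- term drives y; the first is Lipschitz in w - w₀ for the same control k and goes into the
  -- remainder r.
  let r : TimeL2 T H → TimeC T H × TimeL2 T H := fun k =>
    linearFlow T G (0, φ k - φ k₀ - G.compLp (hΨ'.mulL2 (k - k₀)))
  have hXr : ∀ k, X k = X k₀ + (y k + r k) := by
    intro k
    rw [hx k, hx k₀, ← map_add, ← map_add, Prod.mk_add_mk, Prod.mk_add_mk, add_zero, add_zero,
      add_sub_cancel, add_sub_cancel]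
  set μ := timeMeasure T
  -- A bound for ∫(R₁ + √L₁ |k|), uniform over controls of norm at most M, so that the stability
  -- constant does not depend on k.
  set Λ : ℝ := R₁ * μ.real univ + √L₁ * (√(μ.real univ) * M)
  set ρ : ℝ := ‖X k₀‖ + 1
  have hbound : ∀ᶠ k in F, ‖r k‖ ^ 2 ≤ (20 * c * ρ ^ 2 + Λ) * ‖y k‖ ^ 2 *
      Real.exp (2 * (256 * c ^ 2 * ρ ^ 4 + 3 * Λ)) * (1 + (256 * c ^ 2 * ρ ^ 4 + 3 * Λ)) := by
    have hy1 := hy.norm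
    rw [norm_zero] at hy1
    filter_upwards [hF, hy1.eventually_lt_const one_pos] with k hk hyk
    have hf := isForcing_controlForcing hϱ hS k
    have hℓ := hf.lip_memLp.integrable one_le_two
    have hkn : ∫ s, ‖k s‖ ∂μ ≤ √(μ.real univ) * M := by
      have h1 := sq_integral_norm_mul_le (memLp_const (1 : ℝ) (μ := μ)) (Lp.memLp k)
      simp only [norm_one, one_mul, one_pow, integral_const, smul_eq_mul, mul_one] at h1
      rw [← Lp_two_norm_sq] at h1
      refine (le_of_abs_le (abs_le_of_sq_le_sq (b := √(μ.real univ) * ‖k‖) (h1.trans_eq ?_)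
        (by positivity))).trans (by gcongr)
      rw [mul_pow, Real.sq_sqrt measureReal_nonneg]
    refine norm_sq_remainder_le hT hC (A := univ) (x₁ := X k₀) (x₂ := X k) (y := y k)
      (ℓ := fun s => R₁ + √L₁ * ‖k s‖)
      (g := fun s => controlForcing G ϱ S k s ((X k).2 s) -
        controlForcing G ϱ S k s ((X k₀).2 s)) hae₀ (linearFlow_ae hT hC.symm hC.inj _)
      hℓ hf.lip_nonneg ?_ (hXr k) ?_ ?_ ?_ ?_ ?_
    · rw [integral_add (integrable_const _) ((Lp_two_integrable k).norm.const_mul _),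
        integral_const, integral_const_mul, smul_eq_mul]
      have := mul_le_mul_of_nonneg_left hkn (Real.sqrt_nonneg L₁)
      simp only [Λ]
      linarith [mul_comm (μ.real univ) R₁]
    · filter_upwards [hφ k, hφ k₀, Lp.coeFn_sub (φ k) (φ k₀),
        Lp.coeFn_sub (φ k - φ k₀) (G.compLp (hΨ'.mulL2 (k - k₀))),
        G.coeFn_compLp (hΨ'.mulL2 (k - k₀)), hΨ'.coeFn_mulL2 (k - k₀), Lp.coeFn_sub k k₀]
        with s a1 a2 a3 a4 a5 a6 a7 _
      rw [a4, Pi.sub_apply, a3, Pi.sub_apply, a1, a2, a5, a6, a7, Pi.sub_apply]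
      simp only [rhs, controlForcing, map_sub, Ψ]
      abel
    · exact ae_of_all _ fun s hs => absurd (mem_univ s) hs
    · exact ae_of_all _ fun s => hf.lip s _ _
    · simp [ρ]
    · have := norm_nonneg (X k₀)
      simp only [ρ]
      linarith
  have hr : Tendsto r F (𝓝 0) := by
    have h1 : Tendsto (fun k => (20 * c * ρ ^ 2 + Λ) * ‖y k‖ ^ 2 *
        Real.exp (2 * (256 * c ^ 2 * ρ ^ 4 + 3 * Λ)) * (1 + (256 * c ^ 2 * ρ ^ 4 + 3 * Λ))) F
        (𝓝 0) := by
      have h2 := ((((hy.norm.pow 2).const_mul (20 * c * ρ ^ 2 + Λ)).mul_const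
        (Real.exp (2 * (256 * c ^ 2 * ρ ^ 4 + 3 * Λ)))).mul_const
          (1 + (256 * c ^ 2 * ρ ^ 4 + 3 * Λ)))
      simpa using h2
    have h3 := squeeze_zero' (Eventually.of_forall fun k => sq_nonneg ‖r k‖) hbound h1
    have h4 := h3.sqrt
    simp only [Real.sqrt_sq (norm_nonneg _), Real.sqrt_zero] at h4
    exact tendsto_zero_iff_norm_tendsto_zero.2 h4
  have hlim := (tendsto_const_nhds (x := X k₀) (f := F)).add (hy.add hr)
  rw [add_zero, add_zero] at hlim
  exact hlim.congr fun k => (hXr k).symm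

/-- The set of solutions for controls in a ball is compact. -/
theorem isCompact_controlledFlows [Countable ι] (M : ℝ) :
    IsCompact {x | ∃ k : TimeL2 T H, ‖k‖ ≤ M ∧ IsControlledFlow G b ϱ S ξ k x} := by
  choose X hX using exists_isControlledFlow hT hC hϱ hS ξ
  have h : {x | ∃ k : TimeL2 T H, ‖k‖ ≤ M ∧ IsControlledFlow G b ϱ S ξ k x} =
      X '' Metric.closedBall 0 M := by
    ext x
    constructor
    · rintro ⟨k, hk, hx⟩
      exact ⟨k, mem_closedBall_zero_iff.2 hk, isControlledFlow_unique hT hC hϱ hS ξ (hX k) hx⟩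
    · rintro ⟨k, hk, rfl⟩
      exact ⟨k, mem_closedBall_zero_iff.1 hk, hX k⟩
  rw [h]
  exact isCompact_image_closedBall fun k₀ F hF hweak =>
    tendsto_controlledFlow hT hC hϱ hS ξ hX hF hweak

end Controlled

/-! ### The operator `A^{-1/2}` -/

section InverseRoot

variable {H : Type u} [NormedAddCommGroup H] [InnerProductSpace ℝ H] [CompleteSpace H]

omit [CompleteSpace H] in
-- Distinct basis vectors are at distance √2. Countability permits exchanging the Hilbert–Schmidt
-- sum with the time integral.
theorem HilbertBasis.countable_index [TopologicalSpace.SeparableSpace H] {ι : Type*}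
    (e : HilbertBasis ι ℝ H) : Countable ι := by
  refine Pairwise.countable_of_isOpen_disjoint (s := fun i => Metric.ball (e i) (1 / 2)) ?_
    (fun i => Metric.isOpen_ball) fun i => ⟨e i, Metric.mem_ball_self (by norm_num)⟩
  intro i j hij
  refine Metric.ball_disjoint_ball ?_
  have h1 : ‖e i - e j‖ ^ 2 = 2 := by
    rw [norm_sub_sq_real, e.orthonormal.2 hij, e.orthonormal.1, e.orthonormal.1]
    norm_num
  rw [dist_eq_norm]
  nlinarith [norm_nonneg (e i - e j)]

namespace PositiveOperator

variable {𝒜 : PositiveOperator H} {c : ℝ}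

theorem inner_root_incl (u v : 𝒜.V) :
    inner ℝ (𝒜.root u) (𝒜.incl v) = inner ℝ (𝒜.incl u) (𝒜.root v) := by
  have hS := 𝒜.isSqrt.selfAdjoint
  have h := LinearPMap.adjoint_isFormalAdjoint (T := 𝒜.sqrt) hS.dense_domain
  rw [LinearPMap.isSelfAdjoint_def.1 hS] at h
  exact h u v

/-- Since |v| ≤ c |A^{1/2} v|, convergence of the images forces the preimages to be Cauchy in H; the
graph of a self-adjoint operator is closed. -/
theorem isClosed_range_root (hc : ∀ v : 𝒜.V, ‖𝒜.incl v‖ ≤ c * ‖v‖) :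
    IsClosed (LinearMap.range 𝒜.root : Set H) := by
  refine IsSeqClosed.isClosed fun x p hx hp => ?_
  choose v hv using hx
  have hcau : CauchySeq fun n => 𝒜.incl (v n) := by
    have h0 : 0 ≤ max c 0 := le_max_right _ _
    rw [Metric.cauchySeq_iff]
    intro ε hε
    obtain ⟨N, hN⟩ := Metric.cauchySeq_iff.1 hp.cauchySeq (ε / (max c 0 + 1)) (by positivity)
    refine ⟨N, fun m hm n hn => ?_⟩
    have h1 := hN m hm n hn
    rw [dist_eq_norm, lt_div_iff₀ (by positivity), ← hv, ← hv, ← map_sub] at h1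
    rw [dist_eq_norm, ← map_sub]
    have h2 := hc (v m - v n)
    rw [norm_def] at h2
    have h3 := mul_le_mul_of_nonneg_right (le_max_left c 0) (norm_nonneg (𝒜.root (v m - v n)))
    nlinarith [norm_nonneg (𝒜.root (v m - v n))]
  obtain ⟨q, hq⟩ := cauchySeq_tendsto_of_complete hcau
  have hclosed : IsClosed (𝒜.sqrt.graph : Set (H × H)) := 𝒜.isSqrt.selfAdjoint.isClosed
  have hmem : (q, p) ∈ 𝒜.sqrt.graph := by
    refine hclosed.mem_of_tendsto (hq.prodMk_nhds hp) (Filter.Eventually.of_forall fun n => ?_)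
    rw [← hv]
    exact (LinearPMap.mem_graph_iff _).2 ⟨v n, rfl, rfl⟩
  obtain ⟨y, -, hy⟩ := (LinearPMap.mem_graph_iff _).1 hmem
  exact ⟨y, hy⟩

/-- A vector orthogonal to the range lies in the domain of the adjoint, which is A^{1/2} itself, and
in its kernel, which is trivial. -/
theorem range_root_eq_top (hc : ∀ v : 𝒜.V, ‖𝒜.incl v‖ ≤ c * ‖v‖) :
    LinearMap.range 𝒜.root = ⊤ := by
  have hS := 𝒜.isSqrt.selfAdjoint
  rw [← (isClosed_range_root hc).submodule_topologicalClosure_eq,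
    Submodule.topologicalClosure_eq_top_iff, Submodule.eq_bot_iff]
  intro z hz
  have hzS : ∀ v : 𝒜.V, inner ℝ z (𝒜.root v) = 0 := fun v => by
    rw [real_inner_comm]
    exact hz _ ⟨v, rfl⟩
  have hmem : z ∈ 𝒜.sqrt.domain := by
    have h := LinearPMap.mem_adjoint_domain_of_exists (T := 𝒜.sqrt) z
      ⟨0, fun v => by rw [inner_zero_left]; exact (hzS v).symm⟩
    rwa [LinearPMap.isSelfAdjoint_def.1 hS] at h
  let z' : 𝒜.V := ⟨z, hmem⟩
  have h0 : 𝒜.root z' = 0 := by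
    refine hS.dense_domain.eq_of_inner_left ℝ fun v hv => ?_
    rw [inner_zero_left]
    exact (inner_root_incl z' ⟨v, hv⟩).trans (hzS ⟨v, hv⟩)
  have h1 : z' = 0 := 𝒜.root_injective (h0.trans (map_zero _).symm)
  exact congrArg 𝒜.incl h1

/-- `A^{1/2}` as an isometry of `V` onto `H`. -/
def rootEquiv (hc : ∀ v : 𝒜.V, ‖𝒜.incl v‖ ≤ c * ‖v‖) : 𝒜.V ≃ₗᵢ[ℝ] H where
  toLinearEquiv := LinearEquiv.ofBijective 𝒜.root
    ⟨𝒜.root_injective, LinearMap.range_eq_top.1 (range_root_eq_top hc)⟩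
  norm_map' _ := rfl

theorem rootEquiv_apply (hc : ∀ v : 𝒜.V, ‖𝒜.incl v‖ ≤ c * ‖v‖) (v : 𝒜.V) :
    rootEquiv hc v = 𝒜.root v := rfl

/-- `A^{-1/2}` as an operator on `H`. -/
def invRoot (hc : ∀ v : 𝒜.V, ‖𝒜.incl v‖ ≤ c * ‖v‖) : H →L[ℝ] H :=
  (𝒜.incl.mkContinuous c hc).comp ((rootEquiv hc).symm.toContinuousLinearEquiv : H →L[ℝ] 𝒜.V)

variable (hc : ∀ v : 𝒜.V, ‖𝒜.incl v‖ ≤ c * ‖v‖)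

theorem incl_rootEquiv_symm (x : H) : 𝒜.incl ((rootEquiv hc).symm x) = invRoot hc x := rfl

theorem invRoot_rootEquiv (v : 𝒜.V) : invRoot hc (rootEquiv hc v) = 𝒜.incl v := by
  rw [← incl_rootEquiv_symm, LinearIsometryEquiv.symm_apply_apply]

theorem invRoot_symm (x y : H) : inner ℝ (invRoot hc x) y = inner ℝ x (invRoot hc y) := by
  have h := inner_root_incl ((rootEquiv hc).symm x) ((rootEquiv hc).symm y)
  rw [← rootEquiv_apply hc, ← rootEquiv_apply hc, LinearIsometryEquiv.apply_symm_apply,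
    LinearIsometryEquiv.apply_symm_apply, incl_rootEquiv_symm, incl_rootEquiv_symm] at h
  exact h.symm

theorem invRoot_injective : Function.Injective (invRoot hc) :=
  Subtype.val_injective.comp (rootEquiv hc).symm.injective

theorem rootEquiv_ofDomain (v : 𝒜.A.domain) :
    rootEquiv hc (𝒜.ofDomain v) = invRoot hc (𝒜.A v) := by
  obtain ⟨hx, hSx⟩ := (𝒜.isSqrt.mem_domain_iff _).1 v.2
  have h1 : 𝒜.A v = rootEquiv hc ⟨𝒜.sqrt ⟨v, hx⟩, hSx⟩ := 𝒜.isSqrt.apply_eq v hx hSx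
  exact ((congrArg (invRoot hc) h1).trans (invRoot_rootEquiv hc _)).symm

/-- `Dom(A)` is the range of `A^{-1}`. -/
theorem exists_domain (y : H) : ∃ v : 𝒜.A.domain, 𝒜.A v = y ∧ (v : H) = invRoot hc (invRoot hc y) := by
  set x : 𝒜.V := (rootEquiv hc).symm (invRoot hc y)
  have h1 : 𝒜.sqrt ⟨x.1, x.2⟩ = invRoot hc y := (rootEquiv hc).apply_symm_apply (invRoot hc y)
  have h2 : 𝒜.sqrt ⟨x.1, x.2⟩ ∈ 𝒜.sqrt.domain := by
    rw [h1]
    exact ((rootEquiv hc).symm y).2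
  have h3 : x.1 ∈ 𝒜.A.domain := (𝒜.isSqrt.mem_domain_iff _).2 ⟨x.2, h2⟩
  refine ⟨⟨x.1, h3⟩, ?_, rfl⟩
  rw [𝒜.isSqrt.apply_eq ⟨x.1, h3⟩ x.2 h2]
  refine Eq.trans ?_ ((rootEquiv hc).apply_symm_apply y)
  exact congrArg 𝒜.sqrt (Subtype.ext h1)

theorem coe_domain (v : 𝒜.A.domain) : (v : H) = invRoot hc (invRoot hc (𝒜.A v)) := by
  rw [← rootEquiv_ofDomain, invRoot_rootEquiv, incl_ofDomain]

end PositiveOperator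

end InverseRoot

/-! ### The transported coefficients -/

section Transport

open PositiveOperator

variable {H : Type u} [NormedAddCommGroup H] [InnerProductSpace ℝ H] [CompleteSpace H]
  {𝒜 : PositiveOperator H} {𝒬 : Covariance H} {c : ℝ} {T : ℝ}
  {B : 𝒜.V →L[ℝ] 𝒜.V →L[ℝ] StrongDual ℝ 𝒜.V}

/-- Combining |v| ≤ ‖j‖ ‖v‖_ℋ with the interpolation inequality and dividing by |v|. This is where
invertibility of A^{1/2} comes from, as positivity of A alone does not bound its inverse. -/
theorem ConditionC1.exists_norm_incl_le (hB : ConditionC1 𝒜 B) :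
    ∃ c : ℝ, ∀ v : 𝒜.V, ‖𝒜.incl v‖ ≤ c * ‖v‖ := by
  obtain ⟨-, ℋ, _, _, _, k, j, -, hjk, ⟨a₀, ha₀, hk⟩, -⟩ := hB
  refine ⟨‖j‖ ^ 2 * a₀, fun v => ?_⟩
  have h1 : ‖𝒜.incl v‖ ≤ ‖j‖ * ‖k v‖ := by
    rw [← hjk]
    exact j.le_opNorm _
  have h2 : ‖𝒜.incl v‖ ^ 2 ≤ ‖j‖ ^ 2 * (a₀ * ‖𝒜.incl v‖ * ‖v‖) := by
    refine (pow_le_pow_left₀ (norm_nonneg _) h1 2).trans ?_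
    rw [mul_pow]
    exact mul_le_mul_of_nonneg_left (hk v) (by positivity)
  rcases (norm_nonneg (𝒜.incl v)).eq_or_lt with h | h
  · rw [← h]
    positivity
  · nlinarith

/-- The scaling invariant form of the bound on `B`. -/
theorem ConditionC1.exists_norm_sq_le (hB : ConditionC1 𝒜 B) :
    ∃ C : ℝ, 0 ≤ C ∧ ∀ u v : 𝒜.V,
      ‖B u v‖ ^ 2 ≤ C * (‖𝒜.incl u‖ * ‖u‖ * (‖𝒜.incl v‖ * ‖v‖)) := by
  obtain ⟨-, ℋ, _, _, _, k, j, -, -, ⟨a₀, ha₀, hk⟩, hη⟩ := hB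
  obtain ⟨C, hC, hbd⟩ := hη 1 one_pos
  refine ⟨4 * C * a₀ ^ 2, by positivity, fun u v => ?_⟩
  set P : ℝ := ‖k u‖ * ‖k v‖
  have hP : 0 ≤ P := by positivity
  have h1 : ∀ z : 𝒜.V, ‖B u v z‖ ≤ 2 * √C * P * ‖z‖ := by
    intro z
    -- The bound for r z is a quadratic in r that is nonnegative for all r; its discriminant gives
    -- |⟨B(u, v), z⟩| ≤ 2√C P ‖z‖. The choice η = 1 is immaterial.
    have hs : ∀ r : ℝ, 0 ≤ 1 * ‖z‖ ^ 2 * (r * r) + -|B u v z| * r + C * P ^ 2 := by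
      intro r
      have h := hbd u v (r • z)
      rw [map_smul, smul_eq_mul, norm_smul, abs_mul, mul_pow, Real.norm_eq_abs, sq_abs] at h
      have h2 := mul_le_mul_of_nonneg_right (le_abs_self r) (abs_nonneg (B u v z))
      simp only [P]
      nlinarith
    have hd := discrim_le_zero hs
    rw [discrim] at hd
    rw [Real.norm_eq_abs]
    refine le_of_abs_le (abs_le_of_sq_le_sq ?_ (by positivity))
    rw [mul_pow, mul_pow, mul_pow, Real.sq_sqrt hC.le]
    linarith
  have h2 : ‖B u v‖ ≤ 2 * √C * P := ContinuousLinearMap.opNorm_le_bound _ (by positivity) h1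
  calc ‖B u v‖ ^ 2 ≤ (2 * √C * P) ^ 2 := pow_le_pow_left₀ (norm_nonneg _) h2 2
    _ = 4 * C * (‖k u‖ ^ 2 * ‖k v‖ ^ 2) := by
      rw [mul_pow, mul_pow, Real.sq_sqrt hC.le]
      ring
    _ ≤ 4 * C * (a₀ * ‖𝒜.incl u‖ * ‖u‖ * (a₀ * ‖𝒜.incl v‖ * ‖v‖)) := by
      gcongr
      · exact hk u
      · exact hk v
    _ = _ := by ring

variable (hc : ∀ v : 𝒜.V, ‖𝒜.incl v‖ ≤ c * ‖v‖)

/-- `B` transported to `H` by `A^{1/2}`. -/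
def convection (B : 𝒜.V →L[ℝ] 𝒜.V →L[ℝ] StrongDual ℝ 𝒜.V) : H →L[ℝ] H →L[ℝ] H :=
  let r : H →L[ℝ] 𝒜.V := ((rootEquiv hc).symm.toContinuousLinearEquiv : H →L[ℝ] 𝒜.V)
  LinearMap.mkContinuousOfExistsBound₂
    (LinearMap.mk₂ ℝ (fun x y => (InnerProductSpace.toDual ℝ H).symm ((B (r x) (r y)).comp r))
      (fun _ _ _ => by simp only [map_add, add_apply, ContinuousLinearMap.add_comp])
      (fun _ _ _ => by simp only [map_smul, smul_apply, ContinuousLinearMap.smul_comp])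
      (fun _ _ _ => by simp only [map_add, ContinuousLinearMap.add_comp])
      (fun _ _ _ => by simp only [map_smul, ContinuousLinearMap.smul_comp]))
    (by
      obtain ⟨C, hC⟩ : ∃ C, ∀ u v, ‖B u v‖ ≤ C * ‖u‖ * ‖v‖ := ⟨_, B.le_opNorm₂⟩
      refine ⟨C, fun x y => ?_⟩
      rw [LinearMap.mk₂_apply, LinearIsometryEquiv.norm_map]
      have hr : ∀ z, ‖r z‖ = ‖z‖ := (rootEquiv hc).symm.norm_map
      have h := hC (r x) (r y)
      rw [hr, hr] at h
      refine ContinuousLinearMap.opNorm_le_bound _ ((norm_nonneg _).trans h) fun z => ?_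
      refine ((B (r x) (r y)).le_opNorm (r z)).trans ?_
      rw [hr z]
      exact mul_le_mul_of_nonneg_right h (norm_nonneg z))

theorem inner_convection (x y z : H) : inner ℝ (convection hc B x y) z =
    B ((rootEquiv hc).symm x) ((rootEquiv hc).symm y) ((rootEquiv hc).symm z) :=
  InnerProductSpace.toDual_symm_apply

theorem norm_convection_le (x y : H) : ‖convection hc B x y‖ ≤
    ‖B ((rootEquiv hc).symm x) ((rootEquiv hc).symm y)‖ := by
  have h1 := (B ((rootEquiv hc).symm x) ((rootEquiv hc).symm y)).le_opNorm
    ((rootEquiv hc).symm (convection hc B x y))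
  rw [← inner_convection, real_inner_self_eq_norm_sq, LinearIsometryEquiv.norm_map,
    Real.norm_of_nonneg (sq_nonneg _), sq] at h1
  rcases (norm_nonneg (convection hc B x y)).eq_or_lt with h | h
  · rw [← h]
    exact norm_nonneg _
  · exact le_of_mul_le_mul_right h1 h

theorem ConditionC1.isConvection (hB : ConditionC1 𝒜 B) :
    ∃ C, IsConvection (invRoot hc) (convection hc B) C := by
  obtain ⟨C, hC, h⟩ := hB.exists_norm_sq_le
  refine ⟨C, invRoot_symm hc, invRoot_injective hc, hC, fun x y z => ?_, fun x y => ?_⟩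
  · rw [inner_convection, inner_convection, hB.1]
  · refine (pow_le_pow_left₀ (norm_nonneg _) (norm_convection_le hc x y) 2).trans ((h _ _).trans ?_)
    rw [incl_rootEquiv_symm, incl_rootEquiv_symm, LinearIsometryEquiv.norm_map,
      LinearIsometryEquiv.norm_map]

omit [InnerProductSpace ℝ H] [CompleteSpace H] in
theorem ConditionC3ii.isDrift {R : Icc 0 T → H → H} (hR : ConditionC3ii T R) :
    ∃ R₀ R₁, IsDrift R R₀ R₁ := by
  obtain ⟨hcont, R₀, R₁, h0, h1, hz, hl⟩ := hR
  exact ⟨R₀, R₁, hcont, h0, h1, hz, hl⟩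

/-- `Q^{1/2} : H → H₀` as a continuous linear map. -/
def Covariance.sqrtL (𝒬 : Covariance H) : H →L[ℝ] 𝒬.H₀ :=
  𝒬.sqrtTo.mkContinuous 1 fun x => by simpa using 𝒬.norm_sqrtTo_le x

/-- `Q^{-1/2} : H₀ → H` as an isometry. -/
def Covariance.invSqrtL (𝒬 : Covariance H) : 𝒬.H₀ →ₗᵢ[ℝ] H where
  toLinearMap := 𝒬.invSqrt
  norm_map' _ := rfl

theorem Covariance.sqrtL_invSqrtL (φ : 𝒬.H₀) : 𝒬.sqrtL (𝒬.invSqrtL φ) = φ :=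
  Subtype.ext (𝒬.sqrt_invSqrt φ)

theorem Covariance.norm_sqrtL_le (x : H) : ‖𝒬.sqrtL x‖ ≤ ‖x‖ := 𝒬.norm_sqrtTo_le x

/-- `σ` transported to `H` by `A^{1/2}` and `Q^{1/2}`. -/
def diffusion (σ : Icc 0 T → 𝒜.V → (𝒬.H₀ →L[ℝ] H)) (s : Icc (0 : ℝ) T) (x : H) : H →L[ℝ] H :=
  (σ s ((rootEquiv hc).symm x)).comp 𝒬.sqrtL

theorem diffusion_apply (σ : Icc 0 T → 𝒜.V → (𝒬.H₀ →L[ℝ] H)) (s : Icc (0 : ℝ) T) (x y : H) :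
    diffusion hc σ s x y = σ s ((rootEquiv hc).symm x) (𝒬.sqrtL y) := rfl

theorem enorm_comp_sqrtL_sq_le (L : 𝒬.H₀ →L[ℝ] H) : ‖L.comp 𝒬.sqrtL‖ₑ ^ 2 ≤ 𝒬.lqNormSq L :=
  enorm_sq_le_tsum (onb H) _

theorem enorm_diffusion_sub_sq_le (σ : Icc 0 T → 𝒜.V → (𝒬.H₀ →L[ℝ] H)) (s t : Icc (0 : ℝ) T)
    (x y : H) : ‖diffusion hc σ s x - diffusion hc σ t y‖ₑ ^ 2 ≤
      𝒬.lqNormSq (σ s ((rootEquiv hc).symm x) - σ t ((rootEquiv hc).symm y)) := by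
  rw [diffusion, diffusion, ← ContinuousLinearMap.sub_comp]
  exact enorm_comp_sqrtL_sq_le _

theorem ConditionC2.isDiffusion {σ : Icc 0 T → 𝒜.V → (𝒬.H₀ →L[ℝ] H)}
    (hσ : ConditionC2 𝒜 𝒬 T σ 0 0) :
    ∃ K₀ K₁ L₁, IsDiffusion (onb H) (invRoot hc) (diffusion hc σ) K₀ K₁ L₁ := by
  obtain ⟨-, hcont, K₀, K₁, L₁, h0, h1, hL, hgr, hlip⟩ := hσ
  refine ⟨K₀, K₁, L₁, ?_, h0, h1, hL, fun s x => ?_, fun s x y => ?_⟩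
  · rw [continuous_iff_continuousAt]
    intro p
    have hp : Continuous fun p : Icc (0 : ℝ) T × H => (p.1, (rootEquiv hc).symm p.2) :=
      continuous_fst.prodMk ((rootEquiv hc).symm.continuous.comp continuous_snd)
    have h2 := (hcont (p.1, (rootEquiv hc).symm p.2)).comp (hp.tendsto p)
    have h3 : Filter.Tendsto (fun q : Icc (0 : ℝ) T × H =>
        ‖Function.uncurry (diffusion hc σ) q - Function.uncurry (diffusion hc σ) p‖ₑ ^ 2)
        (nhds p) (nhds 0) :=
      tendsto_of_tendsto_of_tendsto_of_le_of_le tendsto_const_nhds h2 (fun _ => bot_le)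
        fun q => enorm_diffusion_sub_sq_le hc σ q.1 p.1 q.2 p.2
    -- Continuity is assumed for the squared L_Q norm, so a square root is taken to reach the
    -- distance.
    have h4 := (ENNReal.continuous_rpow_const (y := 1 / 2)).tendsto 0 |>.comp h3
    rw [ContinuousAt, tendsto_iff_edist_tendsto_0]
    rw [ENNReal.zero_rpow_of_pos (by norm_num)] at h4
    refine h4.congr fun q => ?_
    rw [Function.comp_apply, ← ENNReal.rpow_natCast, ← ENNReal.rpow_mul, edist_eq_enorm_sub]
    norm_num
  · have h := hgr s ((rootEquiv hc).symm x)
    rwa [incl_rootEquiv_symm, zero_mul, add_zero] at h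
  · have h := (enorm_diffusion_sub_sq_le hc σ s s x y).trans
      (hlip s ((rootEquiv hc).symm x) ((rootEquiv hc).symm y))
    rw [← map_sub, incl_rootEquiv_symm, zero_mul, add_zero, ← ofReal_norm,
      ← ENNReal.ofReal_pow (norm_nonneg _), ENNReal.ofReal_le_ofReal_iff (by positivity)] at h
    exact h

end Transport

/-! ### Weak solutions -/

section WeakSolutions

open PositiveOperator

variable {H : Type u} [NormedAddCommGroup H] [InnerProductSpace ℝ H] [CompleteSpace H]
  {𝒜 : PositiveOperator H} {𝒬 : Covariance H} {c C : ℝ} {T : ℝ}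
  {B : 𝒜.V →L[ℝ] 𝒜.V →L[ℝ] StrongDual ℝ 𝒜.V} {R : Icc 0 T → H → H}
  {σ : Icc 0 T → 𝒜.V → (𝒬.H₀ →L[ℝ] H)} {R₀ R₁ K₀ K₁ L₁ : ℝ}
  (hc : ∀ v : 𝒜.V, ‖𝒜.incl v‖ ≤ c * ‖v‖)

namespace EnergySpace

/-- The pair `(u, A^{1/2} u)` of an element `u` of `X`. -/
def toFlow (x : EnergySpace 𝒜 T) : TimeC T H × TimeL2 T H :=
  (toC x, ((rootEquiv hc).toContinuousLinearEquiv : 𝒜.V →L[ℝ] H).compLp (toL2V x))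

theorem toFlow_snd_ae (x : EnergySpace 𝒜 T) :
    ∀ᵐ s ∂(timeMeasure T), (toFlow hc x).2 s = rootEquiv hc (toL2V x s) :=
  ContinuousLinearMap.coeFn_compLp _ _

theorem toFlow_ae (x : EnergySpace 𝒜 T) :
    ∀ᵐ s ∂(timeMeasure T), invRoot hc ((toFlow hc x).2 s) = (toFlow hc x).1 s := by
  filter_upwards [toFlow_snd_ae hc x, x.2] with s h1 h2
  rw [h1, invRoot_rootEquiv]
  exact h2

/-- The map `(u, w) ↦ (u, A^{-1/2} w)`. -/
def ofPair (z : TimeC T H × TimeL2 T H) : WithLp 2 (C(Icc 0 T, H) × Lp 𝒜.V 2 (timeMeasure T)) :=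
  WithLp.toLp 2 (z.1,
    ((rootEquiv hc).symm.toContinuousLinearEquiv : H →L[ℝ] 𝒜.V).compLpL 2 (timeMeasure T) z.2)

theorem continuous_ofPair : Continuous (ofPair hc (T := T)) :=
  (WithLp.prod_continuous_toLp 2 _ _).comp
    (continuous_fst.prodMk ((ContinuousLinearMap.continuous _).comp continuous_snd))

theorem ofPair_snd_ae (z : TimeC T H × TimeL2 T H) :
    ∀ᵐ s ∂(timeMeasure T), (ofPair hc z).snd s = (rootEquiv hc).symm (z.2 s) :=
  ContinuousLinearMap.coeFn_compLp _ _

theorem ofPair_toFlow (x : EnergySpace 𝒜 T) : ofPair hc (toFlow hc x) = x.1 := by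
  refine (WithLp.ofLp_injective 2) (Prod.ext rfl (Lp.ext ?_))
  filter_upwards [ofPair_snd_ae hc (toFlow hc x), toFlow_snd_ae hc x] with s h1 h2
  refine h1.trans ?_
  rw [h2, LinearIsometryEquiv.symm_apply_apply]
  rfl

theorem ofPair_mem {z : TimeC T H × TimeL2 T H}
    (hz : ∀ᵐ s ∂(timeMeasure T), invRoot hc (z.2 s) = z.1 s) :
    ofPair hc z ∈ EnergySpace 𝒜 T := by
  change ∀ᵐ s ∂(timeMeasure T), _
  filter_upwards [ofPair_snd_ae hc z, hz] with s h1 h2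
  rw [h1, incl_rootEquiv_symm]
  exact h2

theorem toFlow_ofPair {z : TimeC T H × TimeL2 T H}
    (hz : ∀ᵐ s ∂(timeMeasure T), invRoot hc (z.2 s) = z.1 s) :
    toFlow hc ⟨ofPair hc z, ofPair_mem hc hz⟩ = z := by
  refine Prod.ext rfl (Lp.ext ?_)
  filter_upwards [ofPair_snd_ae hc z, toFlow_snd_ae hc ⟨ofPair hc z, ofPair_mem hc hz⟩] with s h1 h2
  refine h2.trans ((congrArg (rootEquiv hc) h1).trans ?_)
  rw [LinearIsometryEquiv.apply_symm_apply]

theorem toFlow_injective : Function.Injective (toFlow hc (T := T)) := fun x y h =>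
  Subtype.ext (by rw [← ofPair_toFlow hc, h, ofPair_toFlow])

end EnergySpace

open EnergySpace

variable (hC : IsConvection (invRoot hc) (convection hc B) C) (hR : IsDrift R R₀ R₁)
  (hσ : IsDiffusion (onb H) (invRoot hc) (diffusion hc σ) K₀ K₁ L₁)
  (ξ : H) {h : Lp 𝒬.H₀ 2 (timeMeasure T)} {k : TimeL2 T H}
  (hk : ∀ᵐ s ∂(timeMeasure T), 𝒬.sqrtL (k s) = h s)
include hC hR hσ hk

/-- The weak equation tested against `v` is the integrated equation tested against `A^{1/2} v`. -/
theorem weak_equation_iff (x : EnergySpace 𝒜 T) {φ : TimeL2 T H}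
    (hφ : φ =ᵐ[timeMeasure T] rhs (invRoot hc) (convection hc B)
      (controlForcing (invRoot hc) R (diffusion hc σ) k) (toFlow hc x).2)
    (v : 𝒜.A.domain) (t : Icc 0 T) :
    (inner ℝ (toC x t) (v : H) - inner ℝ ξ (v : H) +
      ∫ s in Iic t, (inner ℝ (toC x s) (𝒜.A v) + B (toL2V x s) (toL2V x s) (𝒜.ofDomain v) +
        inner ℝ (R s (toC x s)) (v : H)) ∂(timeMeasure T) =
    ∫ s in Iic t, inner ℝ (σ s (toL2V x s) (h s)) (v : H) ∂(timeMeasure T)) ↔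
    inner ℝ (invRoot hc (toC x t) - (invRoot hc ξ + primitive T H (φ - (toFlow hc x).2) t))
      (invRoot hc (𝒜.A v)) = 0 := by
  set G := invRoot hc
  set y := 𝒜.A v
  set w := (toFlow hc x).2
  set u := toC x
  have hv : (v : H) = G (G y) := coe_domain hc v
  have hae : ∀ᵐ s ∂(timeMeasure T), G (w s) = u s := toFlow_ae hc x
  have hf := isForcing_controlForcing hR hσ k
  have hRi : Integrable (fun s => R s (u s)) (timeMeasure T) :=
    integrableOn_univ.1 ((hR.cont.comp
      (continuous_id.prodMk u.continuous)).continuousOn.integrableOn_compact isCompact_univ)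
  have hui : Integrable (fun s => u s) (timeMeasure T) :=
    integrableOn_univ.1 (u.continuous.continuousOn.integrableOn_compact isCompact_univ)
  have hbi := (hC.memLp hae).integrable one_le_two
  have hfi := (hf.memLp hae).integrable one_le_two
  have hσi : Integrable (fun s => σ s (toL2V x s) (h s)) (timeMeasure T) := by
    refine (hfi.add hRi).congr ?_
    filter_upwards [hae, hk, toFlow_snd_ae hc x] with s h1 h2 h3
    rw [Pi.add_apply, controlForcing, h1, sub_add_cancel, diffusion_apply, h2, h3,
      LinearIsometryEquiv.symm_apply_apply]
  have hBe : ∀ᵐ s ∂(timeMeasure T), B (toL2V x s) (toL2V x s) (𝒜.ofDomain v) =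
      inner ℝ (convection hc B (w s) (w s)) (G y) := by
    filter_upwards [toFlow_snd_ae hc x] with s h3
    rw [h3, ← rootEquiv_ofDomain, inner_convection]
    simp only [LinearIsometryEquiv.symm_apply_apply]
  have h1 : Integrable (fun s => inner ℝ (u s) y + B (toL2V x s) (toL2V x s) (𝒜.ofDomain v) +
      inner ℝ (R s (u s)) (v : H)) (timeMeasure T) := by
    refine ((hui.inner_const y).add ?_).add (hRi.inner_const _)
    exact (hbi.inner_const (G y)).congr (hBe.mono fun s hs => hs.symm)
  -- With v = G² y and y = A v, symmetry gives (u, y) = (G w, y) = (w, G y) and (f, v) = (G f, G y),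
  -- so every term is a pairing with G y.
  have h2 : (∫ s in Iic t, inner ℝ (σ s (toL2V x s) (h s)) (v : H) ∂(timeMeasure T)) -
      ∫ s in Iic t, (inner ℝ (u s) y + B (toL2V x s) (toL2V x s) (𝒜.ofDomain v) +
        inner ℝ (R s (u s)) (v : H)) ∂(timeMeasure T) =
      inner ℝ (primitive T H (φ - w) t) (G y) := by
    rw [← integral_sub (hσi.inner_const _).restrict h1.restrict, primitive_apply,
      real_inner_comm, ← integral_inner (Lp_two_integrable _).restrict]
    refine integral_congr_ae (ae_restrict_of_ae ?_)
    filter_upwards [hae, hk, toFlow_snd_ae hc x, hBe, hφ, Lp.coeFn_sub φ w] with s a1 a2 a3 a4 a5 a6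
    have a7 : diffusion hc σ s (w s) (k s) = σ s (toL2V x s) (h s) := by
      rw [diffusion_apply, a2, a3, LinearIsometryEquiv.symm_apply_apply]
    rw [a6, Pi.sub_apply, a5, rhs, controlForcing, a7, a1, a4, hv, ← a1]
    simp only [inner_sub_right, map_sub]
    rw [real_inner_comm _ (G y), real_inner_comm _ (G y), real_inner_comm _ (G y),
      real_inner_comm _ (G y), invRoot_symm, invRoot_symm, invRoot_symm]
    ring
  rw [inner_sub_left, inner_add_left, ← h2, invRoot_symm, invRoot_symm, ← hv]
  constructor <;> intro h <;> linarith

/-- As v runs through Dom(A), A v runs through H, so the test vectors G(A v) fill the dense range of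
G and the weak equation is equivalent to the identity in H. `linearFlow_unique` then recognises the
solution as a value of the linear flow. -/
theorem isControlSolution_iff (hT : 0 ≤ T) (x : EnergySpace 𝒜 T) :
    IsControlSolution 𝒜 𝒬 T B R σ ξ h x ↔
      IsControlledFlow (invRoot hc) (convection hc B) R (diffusion hc σ) ξ k (toFlow hc x) := by
  have hae := toFlow_ae hc x
  have hf := isForcing_controlForcing hR hσ k
  set φ : TimeL2 T H := (memLp_rhs hC hf hae).toLp _
  have hφ : φ =ᵐ[timeMeasure T] _ := (memLp_rhs hC hf hae).coeFn_toLp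
  constructor
  · intro hx
    refine ⟨φ, (linearFlow_unique hT hC.symm hC.inj hae fun t => ?_).symm, hφ⟩
    rw [← sub_eq_zero]
    refine (denseRange_of_symm_of_injective hC.symm hC.inj).eq_of_inner_left ℝ ?_
    intro y
    obtain ⟨v, rfl, -⟩ := exists_domain hc y
    rw [inner_zero_left]
    exact (weak_equation_iff hc hC hR hσ ξ hk x hφ v t).1 (hx v t)
  · rintro ⟨ψ, hx, hψ⟩ v t
    refine (weak_equation_iff hc hC hR hσ ξ hk x hψ v t).2 ?_
    have h1 := linearFlow_equation hT hC.symm hC.inj (ξ, ψ) t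
    rw [← hx] at h1
    have h2 : invRoot hc (toC x t) = _ := h1
    rw [h2, sub_self, inner_zero_left]

end WeakSolutions

end

/-! ### Return to X and to controls with values in H₀ -/

theorem proposition3p6 {H : Type*} [NormedAddCommGroup H] [InnerProductSpace ℝ H]
    [CompleteSpace H] [TopologicalSpace.SeparableSpace H]
    (𝒜 : PositiveOperator H) (𝒬 : Covariance H) (T : ℝ) (hT : 0 < T)
    (B : 𝒜.V →L[ℝ] 𝒜.V →L[ℝ] StrongDual ℝ 𝒜.V)
    (R : Set.Icc 0 T → H → H)
    (σ : Set.Icc 0 T → 𝒜.V → (𝒬.H₀ →L[ℝ] H))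
    (hB : ConditionC1 𝒜 B) (hσ : ConditionC2 𝒜 𝒬 T σ 0 0)
    (hR : ConditionC3ii T R) (hσt : ConditionC4 𝒜 𝒬 T σ)
    (M : ℝ) (hM : 0 < M) (ξ : H) :
    (∀ h ∈ controlSet 𝒬 T M, ∃! x : EnergySpace 𝒜 T, IsControlSolution 𝒜 𝒬 T B R σ ξ h x) ∧
      IsCompact (controlledSolutions 𝒜 𝒬 T B R σ ξ M) := by
  obtain ⟨c, hc⟩ := hB.exists_norm_incl_le
  obtain ⟨C, hC⟩ := hB.isConvection hc
  obtain ⟨R₀, R₁, hϱ⟩ := hR.isDrift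
  obtain ⟨K₀, K₁, L₁, hS⟩ := hσ.isDiffusion hc
  have hcount : Countable (onbIndex H) := (onb H).countable_index
  -- Controls are lifted by the isometry Q^{-1/2}, which preserves the norm and is inverted by
  -- Q^{1/2}.
  have hlift : ∀ h : Lp 𝒬.H₀ 2 (timeMeasure T), ∃ k : TimeL2 T H, ‖k‖ ^ 2 = ‖h‖ ^ 2 ∧
      ∀ᵐ s ∂(timeMeasure T), 𝒬.sqrtL (k s) = h s := fun h => by
    have hk := 𝒬.invSqrtL.toContinuousLinearMap.coeFn_compLp h
    refine ⟨_, ?_, hk.mono fun s hs => by rw [hs]; exact 𝒬.sqrtL_invSqrtL _⟩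
    rw [Lp_two_norm_sq, Lp_two_norm_sq]
    refine integral_congr_ae (hk.mono fun s hs => ?_)
    simp only [hs]
    exact congrArg (· ^ 2) (𝒬.invSqrtL.norm_map _)
  have hae : ∀ k z, IsControlledFlow (PositiveOperator.invRoot hc) (convection hc B) R
      (diffusion hc σ) ξ k z →
      ∀ᵐ s ∂(timeMeasure T), PositiveOperator.invRoot hc (z.2 s) = z.1 s := by
    rintro k _ ⟨φ, rfl, -⟩
    exact linearFlow_ae hT.le hC.symm hC.inj _
  constructor
  · intro h _
    obtain ⟨k, -, hk⟩ := hlift h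
    obtain ⟨z, hz⟩ := exists_isControlledFlow hT.le hC hϱ hS ξ k
    refine ⟨⟨_, EnergySpace.ofPair_mem hc (hae k z hz)⟩,
      (isControlSolution_iff hc hC hϱ hS ξ hk hT.le _).2 ?_, fun x hx => ?_⟩
    · rwa [EnergySpace.toFlow_ofPair hc (hae k z hz)]
    · refine EnergySpace.toFlow_injective hc ?_
      rw [EnergySpace.toFlow_ofPair hc (hae k z hz)]
      exact isControlledFlow_unique hT.le hC hϱ hS ξ
        ((isControlSolution_iff hc hC hϱ hS ξ hk hT.le _).1 hx) hz
  -- The two families coincide: lifting maps S_M into the ball of radius √M, and the contraction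
  -- Q^{1/2} maps that whole ball, not only the lifted controls, back into S_M.
  · have himage : Subtype.val '' controlledSolutions 𝒜 𝒬 T B R σ ξ M =
        EnergySpace.ofPair hc '' {z | ∃ k : TimeL2 T H, ‖k‖ ≤ √M ∧
          IsControlledFlow (PositiveOperator.invRoot hc) (convection hc B) R
            (diffusion hc σ) ξ k z} := by
      ext p
      constructor
      · rintro ⟨x, ⟨h, hh, hx⟩, rfl⟩
        obtain ⟨k, hkn, hk⟩ := hlift h
        refine ⟨_, ⟨k, Real.le_sqrt_of_sq_le ?_,
          (isControlSolution_iff hc hC hϱ hS ξ hk hT.le x).1 hx⟩, EnergySpace.ofPair_toFlow hc x⟩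
        rw [hkn, Lp_two_norm_sq]
        exact hh
      · rintro ⟨z, ⟨k, hkn, hz⟩, rfl⟩
        have hk := 𝒬.sqrtL.coeFn_compLp k
        refine ⟨⟨_, EnergySpace.ofPair_mem hc (hae k z hz)⟩, ⟨𝒬.sqrtL.compLp k, ?_,
          (isControlSolution_iff hc hC hϱ hS ξ (hk.mono fun s hs => hs.symm) hT.le _).2 ?_⟩, rfl⟩
        · change ∫ s, _ ∂(timeMeasure T) ≤ M
          refine (integral_mono_ae (integrable_norm_sq _) (integrable_norm_sq k)
            (hk.mono fun s hs => ?_)).trans ?_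
          · simp only [hs]
            exact pow_le_pow_left₀ (norm_nonneg _) (𝒬.norm_sqrtL_le _) 2
          · rw [← Lp_two_norm_sq, ← Real.sq_sqrt hM.le]
            exact pow_le_pow_left₀ (norm_nonneg _) hkn 2
        · rwa [EnergySpace.toFlow_ofPair hc (hae k z hz)]
    rw [Subtype.isCompact_iff, himage]
    exact (isCompact_controlledFlows hT.le hC hϱ hS ξ √M).image (EnergySpace.continuous_ofPair hc)
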